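/- Fix integers $e\ge 2$ and $\ell\ge 2$. An $\ell$-abacus is a set $\mathcal A\subset\mathbb Z\times\{1,\dots,\ell\}$ of beads $(\beta,j)$ ($\beta$ is the column, $j$ the row) containing all $(\beta,j)$ with $\beta$ small enough and no $(\beta,j)$ with $\beta$ large enough. Positions are ordered by $(\beta,j)<(\beta',j')$ iff $\beta<\beta'$, or $\beta=\beta'$ and $j>j'$; sequences of $e$ positions are ordered lexicographically. **Quasiperiods, fore and aft periods.** A quasiperiod in a set $S$ of beads is a sequence $(b_1,\dots,b_e)$ in $S$, $b_i=(\beta_i,j_i)$, with $\beta_{i+1}=\beta_i-1$ and $j_{i+1}\le j_i$. The first fore period $P_1$ of $\mathcal A$ is its largest quasiperiod; inductively, $P_k$ is the largest quasiperiod of $\mathcal A$ that is smaller than $P_{k-1}$ and disjoint from $P_1,\dots,P_{k-1}$. Beads of $\mathcal A$ in no fore period are free. Write $b_k^{(i)}$ for the $i$-th bead of $P_k$ and $\beta(b)$, $j(b)$ for the column and row of $b$. The $k$-th vessel $V_k$ is the union of $P_k$ and of the free beads $(\beta,j)$ with $\beta(b_{k+1}^{(e)})\le\beta\le\beta(b_k^{(1)})$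 such that: if $\beta=\beta(b_k^{(i)})$ for some $i$, then $j>j(b_k^{(i)})$; if $\beta=\beta(b_{k+1}^{(i)})$ for some $i$, then $j<j(b_{k+1}^{(i)})$; and if $\beta<\beta(b_k^{(e)})$, then $(\beta+1,j')\in V_k$ for some $j'$. The $k$-th aft period $Q_k$ is the smallest quasiperiod in $V_k$. A quasiperiod $P$ of $\mathcal A$ is right-shiftable if, for each row that it meets, the position just to the right of its rightmost bead in this row is not in $\mathcal A$; then shifting $P$ one unit to the right means replacing $\mathcal A$ by $(\mathcal A\setminus P)\cup\tilde P$, where the shift $\tilde P$ of $P$ is obtained by increasing all its columns by $1$. Left shifts are defined symmetrically. **The $\widehat{\mathfrak{sl}}_e$-crystal.** For $i\in\mathbb Z/e\mathbb Z$, mark a position $(\beta,j)$ with $\beta\equiv i \pmod e$ by $+$ if $(\beta,j)\in\mathcal A$ and $(\beta+1,j)\notin\mathcal A$, and by $-$ if $(\beta,j)\notin\mathcal A$ and $(\beta+1,j)\in\mathcal A$. Read the marks in increasing order of positions and delete factors $-+$ recursively, until the word is $+\cdots+-\cdots-$. If a $+$ remains, $\tilde f_i\mathcal A$ is obtained by moving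 the bead at the rightmost remaining $+$ one unit to the right; otherwise $\tilde f_i\mathcal A=0$. An abacus not of the form $\tilde f_i\mathcal B$ for any $i$ and $\mathcal B$ is called a highest weight vertex for $\widehat{\mathfrak{sl}}_e$. **The $\mathfrak{sl}_\infty$-crystal.** Let $\sigma=(\sigma_1\ge\sigma_2\ge\cdots)$ be a partition. If $\mathcal A$ is a highest weight vertex for $\widehat{\mathfrak{sl}}_e$, its beads are partitioned into its periods, where each period is the quasiperiod that starts in the rightmost nonempty column, and takes the bead in the lowest row of each of its $e$ columns, of what remains of $\mathcal A$ after removal of the previous periods; then $\tilde b_\sigma\mathcal A$ is obtained by shifting the $k$-th period $\sigma_k$ units to the right, for all $k\ge 1$. The operator $\tilde b_\sigma$ is extended to all abaci by $\tilde b_\sigma\tilde f_i=\tilde f_i\tilde b_\sigma$. A highest weight vertex for $\mathfrak{sl}_\infty$ is an abacus that is not of the form $\tilde b_\sigma\mathcal B$ with $\sigma\ne\emptyset$. Every $\ell$-abacus is $\tilde b_\theta\mathcal A^\circ$ for a unique partition $\theta$ and a unique highest weight vertex $\mathcal A^\circ$ for $\mathfrak{sl}_\infty$. There is an arrow $\mathcal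 A\to\mathcal A'$ in the $\mathfrak{sl}_\infty$-crystal iff $\mathcal A=\tilde b_\theta\mathcal A^\circ$ and $\mathcal A'=\tilde b_\rho\mathcal A^\circ$ for such an $\mathcal A^\circ$ and partitions $\theta,\rho$ such that $\rho$ is obtained from $\theta$ by adding one box. For $k\ge1$, $\Upsilon_k^+$ (resp. $\Upsilon_k^-$) sends $\tilde b_\theta\mathcal A^\circ$ to $\tilde b_{\rho}\mathcal A^\circ$, where $\rho$ is obtained from $\theta$ by adding (resp. removing) a box in row $k$, if this gives a partition, and to $0$ otherwise. **Theorem.** Let $\mathcal A$ and $\mathcal A'$ be $\ell$-abaci. There is an arrow $\mathcal A\to\mathcal A'$ in the $\mathfrak{sl}_\infty$-crystal if and only if, for some $k\ge 1$, the following equivalent situations hold: 1. $\mathcal A'$ is obtained from $\mathcal A$ by shifting the $k$-th fore period $P_k$ of $\mathcal A$ one unit to the right, and the shift $\tilde P_k$ of $P_k$ is equal to the $k$-th aft period $Q'_k$ of $\mathcal A'$. 2. $\mathcal A$ is obtained from $\mathcal A'$ by shifting the $k$-th aft period $Q'_k$ of $\mathcal A'$ one unit to the left, and the shift $\tilde Q'_k$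 of $Q'_k$ is equal to the $k$-th fore period $P_k$ of $\mathcal A$. (For every $k$, (1) and (2) are equivalent.) In this case $\mathcal A'=\Upsilon_k^+\mathcal A$, or equivalently $\mathcal A=\Upsilon_k^-\mathcal A'$. -/

import Mathlib

namespace AbacusCrystal

/-! ### Abaci

Rows are indexed by `Fin ℓ`, with `0` the bottom row; positions are pairs (column, row).
All sequences (periods, vessels, rows of a partition) are indexed from `0`: index `k` here is
the `(k+1)`-st object in the usual counting. -/

/-- Positions `(β, j)` of an `ℓ`-abacus. -/
abbrev Pos (ℓ : ℕ) : Type := ℤ × Fin ℓ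

/-- An `ℓ`-abacus: a set of positions, full far to the left and empty far to the right. -/
@[ext]
structure Abacus (ℓ : ℕ) where
  beads : Set (Pos ℓ)
  full_left : ∃ m : ℤ, ∀ β ≤ m, ∀ j : Fin ℓ, (β, j) ∈ beads
  empty_right : ∃ m : ℤ, ∀ β ≥ m, ∀ j : Fin ℓ, (β, j) ∉ beads

/-- The total order on positions: `(β, j) < (β', j')` iff `β < β'`, or `β = β'` and `j > j'`. -/
def PosLT {ℓ : ℕ} (b b' : Pos ℓ) : Prop :=
  b.1 < b'.1 ∨ (b.1 = b'.1 ∧ b'.2 < b.2)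

/-! ### The crystal of affine `sl_e` (Uglov realization)

A sign is recorded at the position `x = (β, j)` from which a bead moves when it is shifted to the
right to `(β + 1, j)`: a `+` when the bead can be shifted from `x` to the right, a `-` when the
bead to the right of `x` can be shifted left into `x`. The residue is that of `β`. -/

/-- There is a right-shiftable `i`-bead at `x`. -/
def IsPlus {ℓ : ℕ} (e : ℕ) (i : ZMod e) (A : Abacus ℓ) (x : Pos ℓ) : Prop :=
  x ∈ A.beads ∧ (x.1 + 1, x.2) ∉ A.beads ∧ (x.1 : ZMod e) = i

/-- There is a left-shiftable `i`-bead just to the right of `x`. -/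
def IsMinus {ℓ : ℕ} (e : ℕ) (i : ZMod e) (A : Abacus ℓ) (x : Pos ℓ) : Prop :=
  x ∉ A.beads ∧ (x.1 + 1, x.2) ∈ A.beads ∧ (x.1 : ZMod e) = i

/-- The `+` at `x` survives the recursive deletion of all factors `-+` from the `i`-signature
(read in increasing order): every stretch of the signature ending just before `x` has at most as
many `-` as `+`. -/
def SurvivingPlus {ℓ : ℕ} (e : ℕ) (i : ZMod e) (A : Abacus ℓ) (x : Pos ℓ) : Prop :=
  IsPlus e i A x ∧ ∀ y : Pos ℓ,
    {z | IsMinus e i A z ∧ (z = y ∨ PosLT y z) ∧ PosLT z x}.ncard ≤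
      {z | IsPlus e i A z ∧ (z = y ∨ PosLT y z) ∧ PosLT z x}.ncard

/-- The good right-shiftable `i`-bead: the rightmost `+` of the reduced `i`-signature. -/
def IsGood {ℓ : ℕ} (e : ℕ) (i : ZMod e) (A : Abacus ℓ) (x : Pos ℓ) : Prop :=
  SurvivingPlus e i A x ∧ ∀ z, SurvivingPlus e i A z → z = x ∨ PosLT z x

/-- The arrow `A → A'` labelled `i`, i.e. `A' = f_i A`, in the crystal of affine `sl_e`. -/
def AffineArrow {ℓ : ℕ} (e : ℕ) (i : ZMod e) (A A' : Abacus ℓ) : Prop :=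
  ∃ x, IsGood e i A x ∧ A'.beads = (A.beads \ {x}) ∪ {(x.1 + 1, x.2)}

/-- `A` is a highest weight (source) vertex of the crystal of affine `sl_e`. -/
def AffineHighestWeight {ℓ : ℕ} (e : ℕ) (A : Abacus ℓ) : Prop :=
  ∀ (i : ZMod e) (B : Abacus ℓ), ¬ AffineArrow e i B A

/-! ### Quasiperiods and periods -/

/-- `P` is an `e`-quasiperiod contained in the set `S` of positions: consecutive columns, going
left, and weakly decreasing rows. -/
def IsQuasiperiod {ℓ : ℕ} (e : ℕ) (S : Set (Pos ℓ)) (P : Fin e → Pos ℓ) : Prop :=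
  (∀ i, P i ∈ S) ∧
  ∀ i i' : Fin e, (i' : ℕ) = i + 1 → (P i').1 = (P i).1 - 1 ∧ (P i').2 ≤ (P i).2

/-- Lexicographic order on sequences of `e` positions. -/
def QLT {ℓ e : ℕ} (P Q : Fin e → Pos ℓ) : Prop :=
  ∃ i, (∀ m, m < i → P m = Q m) ∧ PosLT (P i) (Q i)

/-- Translate a sequence of positions by `t` columns. -/
def shift {ℓ e : ℕ} (t : ℤ) (P : Fin e → Pos ℓ) : Fin e → Pos ℓ :=
  fun i => ((P i).1 + t, (P i).2)

/-- `P` is the first `e`-period (Jacon--Lecouvey) of the set `S`: a quasiperiod starting in the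
rightmost nonempty column of `S` and using the lowest bead of `S` in each of its columns. -/
def IsFirstPeriod {ℓ : ℕ} (e : ℕ) (S : Set (Pos ℓ)) (P : Fin e → Pos ℓ) : Prop :=
  IsQuasiperiod e S P ∧
  (∀ i : Fin e, (i : ℕ) = 0 → ∀ b ∈ S, b.1 ≤ (P i).1) ∧
  (∀ i : Fin e, ∀ b ∈ S, b.1 = (P i).1 → (P i).2 ≤ b.2)

/-- `P 0, P 1, …` are the successive `e`-periods of `A`: each is the first period of what remains
after the earlier ones are peeled off. -/
def IsPeriodSeq {ℓ : ℕ} (e : ℕ) (A : Abacus ℓ) (P : ℕ → Fin e → Pos ℓ) : Prop :=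
  ∀ k, IsFirstPeriod e (A.beads \ ⋃ i ∈ Set.Iio k, Set.range (P i)) (P k)

/-! ### The `sl_∞`-crystal -/

/-- The graph of the operator `b_σ` on abaci, `σ` a partition (Young diagram with row lengths
`σ.rowLen 0 ≥ σ.rowLen 1 ≥ …`). On a highest weight vertex for affine `sl_e`, whose beads are
partitioned into its periods, `b_σ` shifts the `k`-th period by `σ_k` units to the right; it is
extended to all abaci by requiring that it commutes with the crystal operators `f_i`. -/
inductive BOp {ℓ : ℕ} (e : ℕ) (σ : YoungDiagram) : Abacus ℓ → Abacus ℓ → Prop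
  | highestWeight (A B : Abacus ℓ) (P : ℕ → Fin e → Pos ℓ)
      (hA : AffineHighestWeight e A) (hP : IsPeriodSeq e A P)
      (hB : B.beads = ⋃ k, Set.range (shift (σ.rowLen k : ℤ) (P k))) : BOp e σ A B
  | commute (i : ZMod e) (A B A₁ B₁ : Abacus ℓ) (h : BOp e σ A B)
      (hA : AffineArrow e i A A₁) (hB : AffineArrow e i B B₁) : BOp e σ A₁ B₁

/-- `A` is a highest weight vertex for `sl_∞`: `A = b_σ B` only for `σ = ∅`. -/
def HighestWeight {ℓ : ℕ} (e : ℕ) (A : Abacus ℓ) : Prop :=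
  ∀ (B : Abacus ℓ) (σ : YoungDiagram), BOp e σ B A → σ = ⊥

/-- `ρ` is obtained from `θ` by adding a box in row `k`. -/
def AddBox (k : ℕ) (θ ρ : YoungDiagram) : Prop :=
  ρ.cells = insert (k, θ.rowLen k) θ.cells ∧ (k, θ.rowLen k) ∉ θ.cells

/-- The graph of the operator on abaci which corresponds, under `b_θ A° ↦ θ` (`A°` a highest
weight vertex), to adding a box in row `k` of the partition. -/
def AddBoxOp {ℓ : ℕ} (e k : ℕ) (A A' : Abacus ℓ) : Prop :=
  ∃ (A₀ : Abacus ℓ) (θ ρ : YoungDiagram),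
    HighestWeight e A₀ ∧ BOp e θ A₀ A ∧ BOp e ρ A₀ A' ∧ AddBox k θ ρ

/-- There is an arrow `A → A'` in the `sl_∞`-crystal: under `b_θ A° ↦ θ` it is an arrow of the
Young graph. -/
def Arrow {ℓ : ℕ} (e : ℕ) (A A' : Abacus ℓ) : Prop :=
  ∃ k, AddBoxOp e k A A'

open Classical in
/-- The operator `Υ_k^+` (value `none` stands for `0`). -/
noncomputable def UpsilonPlus {ℓ : ℕ} (e k : ℕ) (A : Abacus ℓ) : Option (Abacus ℓ) :=
  if h : ∃ A', AddBoxOp e k A A' then some h.choose else none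

open Classical in
/-- The operator `Υ_k^-` (value `none` stands for `0`). -/
noncomputable def UpsilonMinus {ℓ : ℕ} (e k : ℕ) (A' : Abacus ℓ) : Option (Abacus ℓ) :=
  if h : ∃ A, AddBoxOp e k A A' then some h.choose else none

/-! ### Fore periods, vessels, aft periods -/

/-- `P 0, P 1, …` are the successive fore periods of `A`. -/
def IsForeSeq {ℓ : ℕ} (e : ℕ) (A : Abacus ℓ) (P : ℕ → Fin e → Pos ℓ) : Prop :=
  ∀ k,
    (IsQuasiperiod e A.beads (P k) ∧ (∀ i, i + 1 = k → QLT (P k) (P i)) ∧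
      ∀ i < k, Disjoint (Set.range (P k)) (Set.range (P i))) ∧
    ∀ Q : Fin e → Pos ℓ, IsQuasiperiod e A.beads Q → (∀ i, i + 1 = k → QLT Q (P i)) →
      (∀ i < k, Disjoint (Set.range Q) (Set.range (P i))) → Q = P k ∨ QLT Q (P k)

/-- The free beads of `A`: those in no fore period. -/
def freeBeads {ℓ e : ℕ} (A : Abacus ℓ) (P : ℕ → Fin e → Pos ℓ) : Set (Pos ℓ) :=
  {b | b ∈ A.beads ∧ ∀ k, b ∉ Set.range (P k)}

/-- `b` lies between the fore periods `p` and `q` (`q` the one after `p`): its column is at least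
the last column of `q` and at most the first column of `p`; it is above the bead of `p`, and below
the bead of `q`, in its column, if there is one. -/
def Between {ℓ e : ℕ} (p q : Fin e → Pos ℓ) (b : Pos ℓ) : Prop :=
  (∃ i, (q i).1 ≤ b.1) ∧ (∃ i, b.1 ≤ (p i).1) ∧
  (∀ i, b.1 = (p i).1 → (p i).2 < b.2) ∧ (∀ i, b.1 = (q i).1 → b.2 < (q i).2)

/-- The vessel of the fore period `p`, with next fore period `q` and set `F` of free beads: the
beads of `p` and the free beads between `p` and `q` such that, if they are to the left of all beads
of `p`, the vessel meets the column just to their right. -/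
inductive Vessel {ℓ e : ℕ} (F : Set (Pos ℓ)) (p q : Fin e → Pos ℓ) : Pos ℓ → Prop
  | fore (i : Fin e) : Vessel F p q (p i)
  | near (b : Pos ℓ) (hF : b ∈ F) (hb : Between p q b) (hn : ∃ i, (p i).1 ≤ b.1) : Vessel F p q b
  | far (b : Pos ℓ) (hF : b ∈ F) (hb : Between p q b) (hn : ∀ i, b.1 < (p i).1) (j : Fin ℓ)
      (hc : Vessel F p q (b.1 + 1, j)) : Vessel F p q b

/-- `p` is the `k`-th fore period of `A`. -/
def IsForePeriod {ℓ : ℕ} (e k : ℕ) (A : Abacus ℓ) (p : Fin e → Pos ℓ) : Prop :=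
  ∃ P : ℕ → Fin e → Pos ℓ, IsForeSeq e A P ∧ P k = p

/-- `q` is the `k`-th aft period of `A`: the smallest quasiperiod in the `k`-th vessel. -/
def IsAftPeriod {ℓ : ℕ} (e k : ℕ) (A : Abacus ℓ) (q : Fin e → Pos ℓ) : Prop :=
  ∃ P : ℕ → Fin e → Pos ℓ, IsForeSeq e A P ∧
    IsQuasiperiod e {b | Vessel (freeBeads A P) (P k) (P (k + 1)) b} q ∧
    ∀ Q : Fin e → Pos ℓ,
      IsQuasiperiod e {b | Vessel (freeBeads A P) (P k) (P (k + 1)) b} Q → Q = q ∨ QLT q Q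

/-- `P` is right-shiftable in `A`: in each of its rows, the position to the right of its rightmost
bead is a space. -/
def RightShiftable {ℓ e : ℕ} (A : Abacus ℓ) (P : Fin e → Pos ℓ) : Prop :=
  ∀ i, (∀ i', (P i').2 = (P i).2 → (P i').1 ≤ (P i).1) → ((P i).1 + 1, (P i).2) ∉ A.beads

/-- `P` is left-shiftable in `A`. -/
def LeftShiftable {ℓ e : ℕ} (A : Abacus ℓ) (P : Fin e → Pos ℓ) : Prop :=
  ∀ i, (∀ i', (P i').2 = (P i).2 → (P i).1 ≤ (P i').1) → ((P i).1 - 1, (P i).2) ∉ A.beads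

/-- Traveling downstream: `A'` is obtained from `A` by shifting the `k`-th fore period of `A` one
unit to the right, and the result of the shift is the `k`-th aft period of `A'`. -/
def Downstream {ℓ : ℕ} (e k : ℕ) (A A' : Abacus ℓ) : Prop :=
  ∃ p : Fin e → Pos ℓ, IsForePeriod e k A p ∧ RightShiftable A p ∧
    A'.beads = (A.beads \ Set.range p) ∪ Set.range (shift 1 p) ∧
    IsAftPeriod e k A' (shift 1 p)

/-- Traveling upstream: `A` is obtained from `A'` by shifting the `k`-th aft period of `A'` one
unit to the left, and the result of the shift is the `k`-th fore period of `A`. -/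
def Upstream {ℓ : ℕ} (e k : ℕ) (A A' : Abacus ℓ) : Prop :=
  ∃ q : Fin e → Pos ℓ, IsAftPeriod e k A' q ∧ LeftShiftable A' q ∧
    A.beads = (A'.beads \ Set.range q) ∪ Set.range (shift (-1) q) ∧
    IsForePeriod e k A (shift (-1) q)

end AbacusCrystal

/-! Number the positions by the integers in increasing order, so that a step to the right adds `ℓ`.
A quasiperiod becomes a cycle: a function `b` on `ZMod e` with `b i` of residue `i` and `b (i + 1) ≤
b i + ℓ` for every `i`; the wrap-around inequality comes for free. The pointwise order on cycles
refines the lexicographic order on quasiperiods, and a semi-infinite set contains a pointwise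
greatest cycle. So the fore periods are the greedy sequence obtained by removing greatest cycles one
after another (`IsForeSeq.greedy`).

A cycle `b` lies below its translate `sh b`, and the integers of residue `i` from `b i` to `sh b i`,
for all `i`, form a wall. A move replaces the `k`-th greedy cycle `b` by `sh b` when no other bead
lies in the wall (`Adm`, `Moves`). Traveling downstream is the same thing (`Downstream.moves`,
`downstream_of_moves`): if the wall is free, the move leaves the earlier greedy cycles alone, the
new `k`-th one dominates `sh b` and meets it, and the later ones stay behind the wall. Hence `sh b`
lies in the `k`-th vessel, and is its smallest quasiperiod.

The core is that moves commute with the affine crystal and keep their index. Summing the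
`i`-signature gives a potential on the integers; the crystal operator acts at its first maximum and
the inverse operator at its last. Adding `b` lowers the potential by one on an interval where the
free wall makes it monotone, so the good position is unchanged or replaced by `b i`, and the same
step can be followed on `S ∪ b` and on `S ∪ sh b` (`Adm.transfer`). A half turn gives the inverse
operators. The index survives because the greedy sequence dominates every decreasing chain of cycles
(`index_eq`).

It remains to treat affine highest weight vertices. There every `-` is cancelled, so the greatest
elements of the residue classes form a cycle and the abacus is the disjoint union of its greedy
cycles. Moves now translate single members of a pointwise decreasing family. Starting from a family
where nothing can move left, the translated families that stay decreasing are exactly those given by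
partitions (`antitone_of_shn`, `shn_antitone`); thus a move is the addition of a box, and `b_σ` is a
chain of moves (`BOp.chain`). Descending in both crystals lowers an energy, so every abacus comes
from a source (`exists_bOp`). -/

namespace AbacusCrystal

/-! ### Integer codes: residues, cycles, weights and potentials -/

/-- The residue modulo `e` of the column of the position with code `n`. -/
def res (e ℓ : ℕ) (n : ℤ) : ZMod e := ((n / (ℓ : ℤ) : ℤ) : ZMod e)

theorem res_add {e ℓ : ℕ} [NeZero ℓ] (n : ℤ) : res e ℓ (n + ℓ) = res e ℓ n + 1 := by
  have h : (ℓ : ℤ) ≠ 0 := by exact_mod_cast NeZero.ne ℓ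
  have h1 := Int.add_mul_ediv_right n 1 h
  rw [one_mul] at h1
  simp [res, h1]

theorem res_sub {e ℓ : ℕ} [NeZero ℓ] (n : ℤ) : res e ℓ (n - ℓ) = res e ℓ n - 1 := by
  have := res_add (e := e) (ℓ := ℓ) (n - ℓ)
  rw [sub_add_cancel] at this
  rw [this]; ring

theorem res_neg {e ℓ : ℕ} [NeZero ℓ] (n : ℤ) : res e ℓ (-1 - n) = -1 - res e ℓ n := by
  have h : (0 : ℤ) < ℓ := by exact_mod_cast Nat.pos_of_ne_zero (NeZero.ne ℓ)
  have : (-1 - n) / (ℓ : ℤ) = -1 - n / ℓ := by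
    have h1 := Int.emod_nonneg n h.ne'
    have h2 := Int.emod_lt_of_pos n h
    have h3 := Int.emod_add_mul_ediv n ℓ
    rw [Int.ediv_eq_iff_of_pos h]
    constructor <;> nlinarith
  simp [res, this]

/-- A quasiperiod as a family of codes indexed by residues. -/
structure IsCycle {e : ℕ} (ℓ : ℕ) (b : ZMod e → ℤ) : Prop where
  res_eq : ∀ i, res e ℓ (b i) = i
  succ_le : ∀ i, b (i + 1) ≤ b i + ℓ

/-- The translate of a cycle by one column to the right. -/
def sh {e : ℕ} (ℓ : ℕ) (b : ZMod e → ℤ) : ZMod e → ℤ := fun i => b (i - 1) + ℓ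

/-- The translate of a cycle by one column to the left. -/
def unsh {e : ℕ} (ℓ : ℕ) (b : ZMod e → ℤ) : ZMod e → ℤ := fun i => b (i + 1) - ℓ

theorem sh_unsh {e : ℕ} (ℓ : ℕ) (b : ZMod e → ℤ) : sh ℓ (unsh ℓ b) = b := by
  funext i; simp [sh, unsh]

namespace IsCycle
variable {e ℓ : ℕ} {b c : ZMod e → ℤ}

theorem le_pred (h : IsCycle ℓ b) (i : ZMod e) : b i ≤ b (i - 1) + ℓ := by
  simpa using h.succ_le (i - 1)

theorem le_sh (h : IsCycle ℓ b) : b ≤ sh ℓ b := fun i => h.le_pred i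

theorem unsh_le (h : IsCycle ℓ b) : unsh ℓ b ≤ b := fun i => by
  have := h.succ_le i; simp only [unsh]; linarith

theorem sh [NeZero ℓ] (h : IsCycle ℓ b) : IsCycle ℓ (sh ℓ b) where
  res_eq i := by simp [AbacusCrystal.sh, res_add, h.res_eq]
  succ_le i := by
    have := h.le_pred i
    simp only [AbacusCrystal.sh, add_sub_cancel_right]; linarith

theorem unsh [NeZero ℓ] (h : IsCycle ℓ b) : IsCycle ℓ (unsh ℓ b) where
  res_eq i := by simp [AbacusCrystal.unsh, res_sub, h.res_eq]
  succ_le i := by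
    have := h.succ_le (i + 1)
    simp only [AbacusCrystal.unsh]; linarith

/-- Allows the part of a cycle lying below another one to be replaced by that one, so as to leave
beads that are not wanted. -/
theorem max (h : IsCycle ℓ b) (h' : IsCycle ℓ c) : IsCycle ℓ (b ⊔ c) where
  res_eq i := by
    rcases le_total (b i) (c i) with hi | hi
    · simp [hi, h'.res_eq]
    · simp [hi, h.res_eq]
  succ_le i := by
    have := h.succ_le i
    have := h'.succ_le i
    simp only [Pi.sup_apply]
    omega

theorem inj (h : IsCycle ℓ b) {i j : ZMod e} (hij : b i = b j) : i = j := by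
  rw [← h.res_eq i, ← h.res_eq j, hij]

theorem mem_range (h : IsCycle ℓ b) {n : ℤ} : n ∈ Set.range b ↔ n = b (res e ℓ n) := by
  constructor
  · rintro ⟨i, rfl⟩; rw [h.res_eq]
  · intro hn; exact ⟨_, hn.symm⟩

end IsCycle

/-- A property of residues which passes from each residue to the next one holds everywhere if it
holds somewhere. -/
theorem cyclic_induction {e : ℕ} [NeZero e] {p : ZMod e → Prop} (hp : ∀ i, p i → p (i + 1))
    {i : ZMod e} (hi : p i) (j : ZMod e) : p j := by
  have h : ∀ n : ℕ, p (i + n) := by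
    intro n
    induction n with
    | zero => simpa using hi
    | succ n ih => have := hp _ ih; push_cast; rwa [← add_assoc]
  have := h (j - i).val
  simpa using this

theorem cyclic_induction' {e : ℕ} [NeZero e] {p : ZMod e → Prop} (hp : ∀ i, p i → p (i - 1))
    {i : ZMod e} (hi : p i) (j : ZMod e) : p j := by
  have := cyclic_induction (p := fun i => p (-i)) (fun i hi => by
    have := hp _ hi
    rwa [neg_add, ← sub_eq_add_neg]) (i := -i) (by simpa using hi) (-j)
  simpa using this

/-- `S` avoids the wall between the cycle `b` and its translate to the right. -/
structure Adm {e : ℕ} (ℓ : ℕ) (S : Set ℤ) (b : ZMod e → ℤ) : Prop where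
  cycle : IsCycle ℓ b
  off : ∀ n ∈ S, b (res e ℓ n) ≤ n → b (res e ℓ n - 1) + ℓ < n

namespace Adm
variable {e ℓ : ℕ} {S : Set ℤ} {b z : ZMod e → ℤ}

theorem off_res (h : Adm ℓ S b) {n : ℤ} (hn : n ∈ S) {i : ZMod e} (hi : res e ℓ n = i)
    (hb : b i ≤ n) : b (i - 1) + ℓ < n := by
  subst hi; exact h.off n hn hb

theorem notMem (h : Adm ℓ S b) (i : ZMod e) : b i ∉ S := fun hi => by
  have := h.off_res hi (h.cycle.res_eq i) le_rfl
  have := h.cycle.le_pred i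
  omega

theorem sh_notMem [NeZero ℓ] (h : Adm ℓ S b) (i : ZMod e) : sh ℓ b i ∉ S := fun hi => by
  have := h.off_res hi (h.cycle.sh.res_eq i) (h.cycle.le_pred i)
  simp [sh] at this

theorem disjoint (h : Adm ℓ S b) : Disjoint S (Set.range b) := by
  rw [Set.disjoint_right]; rintro _ ⟨i, rfl⟩; exact h.notMem i

theorem disjoint_sh [NeZero ℓ] (h : Adm ℓ S b) : Disjoint S (Set.range (sh ℓ b)) := by
  rw [Set.disjoint_right]; rintro _ ⟨i, rfl⟩; exact h.sh_notMem i

/-- A cycle in `S ∪ range b` is behind `b` or in front of the wall. -/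
theorem le_or_front [NeZero e] (h : Adm ℓ S b) (hz : IsCycle ℓ z)
    (hs : Set.range z ⊆ S ∪ Set.range b) : z ≤ b ∨ ∀ i, b (i - 1) + ℓ < z i := by
  by_cases hex : ∃ i, z i ≤ b i
  · obtain ⟨i, hi⟩ := hex
    refine Or.inl fun j => cyclic_induction (p := fun i => z i ≤ b i) (fun i hi => ?_) hi j
    by_contra! hlt
    rcases hs ⟨i + 1, rfl⟩ with hS | hb
    · have h1 := h.off_res hS (hz.res_eq _) hlt.le
      have h2 := hz.succ_le i
      simp only [add_sub_cancel_right] at h1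
      omega
    · rw [h.cycle.mem_range, hz.res_eq] at hb
      omega
  · push Not at hex
    refine Or.inr fun i => ?_
    rcases hs ⟨i, rfl⟩ with hS | hb
    · exact h.off_res hS (hz.res_eq _) (hex i).le
    · rw [h.cycle.mem_range, hz.res_eq] at hb
      have := hex i
      omega

/-- A cycle in `S ∪ range (sh b)` is in front of `sh b` or behind the wall. -/
theorem sh_le_or_behind [NeZero e] [NeZero ℓ] (h : Adm ℓ S b) (hz : IsCycle ℓ z)
    (hs : Set.range z ⊆ S ∪ Set.range (sh ℓ b)) : sh ℓ b ≤ z ∨ ∀ i, z i < b i := by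
  have key : ∀ i, z i < b i ∨ sh ℓ b i ≤ z i := by
    intro i
    rcases hs ⟨i, rfl⟩ with hS | hb
    · rcases lt_or_ge (z i) (b i) with hlt | hge
      · exact Or.inl hlt
      · exact Or.inr (h.off_res hS (hz.res_eq _) hge).le
    · rw [h.cycle.sh.mem_range, hz.res_eq] at hb
      exact Or.inr hb.ge
  by_cases hex : ∃ i, sh ℓ b i ≤ z i
  · obtain ⟨i, hi⟩ := hex
    refine Or.inl fun j => cyclic_induction' (p := fun i => sh ℓ b i ≤ z i) (fun i hi => ?_) hi j
    refine (key _).resolve_left fun hlt => ?_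
    have h2 := hz.le_pred i
    simp only [sh] at hi
    omega
  · push Not at hex
    exact Or.inr fun i => (key i).resolve_right (not_le.2 (hex i))

end Adm

open Classical in
/-- The contribution of the position `n` to the `i`-signature of `S`. -/
noncomputable def wt {e : ℕ} (ℓ : ℕ) (i : ZMod e) (S : Set ℤ) (n : ℤ) : ℤ :=
  if res e ℓ n = i then (if n ∈ S then 1 else 0) - (if n + ℓ ∈ S then 1 else 0) else 0

/-- `h` is a primitive of the `i`-signature of `S`. -/
def IsPotential {e : ℕ} (ℓ : ℕ) (i : ZMod e) (S : Set ℤ) (h : ℤ → ℤ) : Prop :=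
  ∀ n, h (n + 1) = h n + wt ℓ i S n

theorem exists_primitive (w : ℤ → ℤ) : ∃ h : ℤ → ℤ, ∀ n, h (n + 1) = h n + w n := by
  refine ⟨fun n => ∑ k ∈ Finset.Ico 0 n, w k - ∑ k ∈ Finset.Ico n 0, w k, fun n => ?_⟩
  rcases le_or_gt 0 n with hn | hn
  · have h1 : Finset.Ico 0 (n + 1) = insert n (Finset.Ico 0 n) := by ext; simp; omega
    have h2 : Finset.Ico (n + 1) 0 = ∅ := by ext; simp; omega
    have h3 : Finset.Ico n 0 = ∅ := by ext; simp; omega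
    simp only [h1, h2, h3, Finset.sum_empty]
    rw [Finset.sum_insert (by simp)]; ring
  · have h1 : Finset.Ico n 0 = insert n (Finset.Ico (n + 1) 0) := by ext; simp; omega
    have h2 : Finset.Ico 0 (n + 1) = ∅ := by ext; simp; omega
    have h3 : Finset.Ico 0 n = ∅ := by ext; simp; omega
    simp only [h1, h2, h3, Finset.sum_empty]
    rw [Finset.sum_insert (by simp)]; ring

theorem exists_potential {e : ℕ} (ℓ : ℕ) (i : ZMod e) (S : Set ℤ) : ∃ h, IsPotential ℓ i S h :=
  exists_primitive _

/-- Potentials are unique up to a constant, so the positions of their extrema do not depend on the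
choice. -/
theorem IsPotential.sub_const {e ℓ : ℕ} {i : ZMod e} {S : Set ℤ} {h h' : ℤ → ℤ}
    (hh : IsPotential ℓ i S h) (hh' : IsPotential ℓ i S h') (m n : ℤ) :
    h m - h' m = h n - h' n := by
  have key : ∀ n, h n - h' n = h 0 - h' 0 := by
    intro n
    induction n using Int.induction_on with
    | zero => rfl
    | succ k ih => rw [hh, hh']; linarith
    | pred k ih =>
      have h1 := hh (-(k : ℤ) - 1)
      have h2 := hh' (-(k : ℤ) - 1)
      rw [sub_add_cancel] at h1 h2
      linarith
  rw [key m, key n]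

/-- `x + 1` is the first point where `h` reaches its maximum. -/
def FirstMax (h : ℤ → ℤ) (x : ℤ) : Prop := (∀ y ≤ x, h y < h (x + 1)) ∧ ∀ y, h y ≤ h (x + 1)

/-- `x` is the last point where `h` reaches its maximum. -/
def LastMax (h : ℤ → ℤ) (x : ℤ) : Prop := (∀ y, x < y → h y < h x) ∧ ∀ y, h y ≤ h x

/-- `x` is the good position of the `i`-signature of `S`. -/
def Good {e : ℕ} (ℓ : ℕ) (i : ZMod e) (S : Set ℤ) (x : ℤ) : Prop :=
  ∃ h, IsPotential ℓ i S h ∧ FirstMax h x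

/-- `x` is the position at which the crystal operator lowering `S` acts. -/
def CoGood {e : ℕ} (ℓ : ℕ) (i : ZMod e) (S : Set ℤ) (x : ℤ) : Prop :=
  ∃ h, IsPotential ℓ i S h ∧ LastMax h x

/-- `T` is obtained from `S` by the `i`-th crystal operator. -/
def FStep {e : ℕ} (ℓ : ℕ) (i : ZMod e) (S T : Set ℤ) : Prop :=
  ∃ x, Good ℓ i S x ∧ T = (S \ {x}) ∪ {x + (ℓ : ℤ)}

/-! ### Crystal operators as first and last maxima of potentials -/

section crystal
variable {e ℓ : ℕ} {i : ZMod e} {S T : Set ℤ} {x y : ℤ} {h h' : ℤ → ℤ}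

theorem Good.firstMax (hx : Good ℓ i S x) (hh : IsPotential ℓ i S h) : FirstMax h x := by
  obtain ⟨h', hh', h1, h2⟩ := hx
  constructor
  · intro y hy
    have := h1 y hy
    have := hh.sub_const hh' y (x + 1)
    omega
  · intro y
    have := h2 y
    have := hh.sub_const hh' y (x + 1)
    omega

theorem CoGood.lastMax (hx : CoGood ℓ i S x) (hh : IsPotential ℓ i S h) : LastMax h x := by
  obtain ⟨h', hh', h1, h2⟩ := hx
  constructor
  · intro y hy
    have := h1 y hy
    have := hh.sub_const hh' y x
    omega
  · intro y
    have := h2 y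
    have := hh.sub_const hh' y x
    omega

theorem FirstMax.unique (hx : FirstMax h x) (hy : FirstMax h y) : x = y := by
  rcases lt_trichotomy x y with hlt | heq | hlt
  · have h1 := hy.1 (x + 1) (by omega)
    have h2 := hx.2 (y + 1)
    omega
  · exact heq
  · have h1 := hx.1 (y + 1) (by omega)
    have h2 := hy.2 (x + 1)
    omega

theorem Good.unique (hx : Good ℓ i S x) (hy : Good ℓ i S y) : x = y := by
  obtain ⟨h, hh⟩ := exists_potential ℓ i S
  exact (hx.firstMax hh).unique (hy.firstMax hh)

theorem wt_congr {n : ℤ} (h1 : n ∈ S ↔ n ∈ T) (h2 : n + ℓ ∈ S ↔ n + ℓ ∈ T) :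
    wt ℓ i S n = wt ℓ i T n := by
  unfold wt; split_ifs <;> tauto

theorem wt_le_one (n : ℤ) : wt ℓ i S n ≤ 1 := by
  unfold wt; split_ifs <;> simp

theorem neg_one_le_wt (n : ℤ) : -1 ≤ wt ℓ i S n := by
  unfold wt; split_ifs <;> simp

theorem wt_pos (hw : 0 < wt ℓ i S x) : res e ℓ x = i ∧ x ∈ S ∧ x + ℓ ∉ S := by
  unfold wt at hw; split_ifs at hw <;> simp_all

theorem wt_neg (hw : wt ℓ i S x < 0) : res e ℓ x = i ∧ x ∉ S ∧ x + ℓ ∈ S := by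
  unfold wt at hw; split_ifs at hw <;> simp_all

theorem Good.mem (hx : Good ℓ i S x) : res e ℓ x = i ∧ x ∈ S ∧ x + ℓ ∉ S := by
  obtain ⟨h, hh, h1, -⟩ := hx
  apply wt_pos
  have := hh x
  have := h1 x le_rfl
  omega

theorem CoGood.mem (hx : CoGood ℓ i S x) : res e ℓ x = i ∧ x ∉ S ∧ x + ℓ ∈ S := by
  obtain ⟨h, hh, h1, -⟩ := hx
  apply wt_neg
  have := hh x
  have := h1 (x + 1) (by omega)
  omega

theorem FStep.unique {T' : Set ℤ} (h : FStep ℓ i S T) (h' : FStep ℓ i S T') : T = T' := by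
  obtain ⟨x, hx, rfl⟩ := h
  obtain ⟨y, hy, rfl⟩ := h'
  rw [hx.unique hy]

theorem move_back (hm : x ∈ S) (hm' : x + (ℓ : ℤ) ∉ S) :
    (((S \ {x}) ∪ {x + (ℓ : ℤ)}) \ {x + (ℓ : ℤ)}) ∪ {x} = S := by
  ext n
  simp only [Set.mem_union, Set.mem_sdiff, Set.mem_singleton_iff]
  constructor
  · rintro (⟨h1 | h1, h2⟩ | h1)
    · exact h1.1
    · exact absurd h1 h2
    · exact h1 ▸ hm
  · intro hn
    by_cases h : n = x
    · exact Or.inr h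
    · exact Or.inl ⟨Or.inl ⟨hn, h⟩, fun h' => hm' (h' ▸ hn)⟩

theorem move_forth (hm : x ∉ S) (hm' : x + (ℓ : ℤ) ∈ S) :
    (((S \ {x + (ℓ : ℤ)}) ∪ {x}) \ {x}) ∪ {x + (ℓ : ℤ)} = S := by
  ext n
  simp only [Set.mem_union, Set.mem_sdiff, Set.mem_singleton_iff]
  constructor
  · rintro (⟨h1 | h1, h2⟩ | h1)
    · exact h1.1
    · exact absurd h1 h2
    · exact h1 ▸ hm'
  · intro hn
    by_cases h : n = x + ℓ
    · exact Or.inr h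
    · exact Or.inl ⟨Or.inl ⟨hn, h⟩, fun h' => hm (h' ▸ hn)⟩

variable [NeZero ℓ] [Fact (1 < e)]

/-- As `e ≥ 2`, a step by `ℓ` changes the residue, so the other two signs involving `x` or `x + ℓ`
are not `i`-signs. The sign at `x` turns from `+` to `-`, whence the `2`. -/
theorem wt_move (hx : res e ℓ x = i) (hxS : x ∈ S) (hxS' : x + ℓ ∉ S) (n : ℤ) :
    wt ℓ i ((S \ {x}) ∪ {x + (ℓ : ℤ)}) n = wt ℓ i S n - if n = x then 2 else 0 := by
  by_cases hn : res e ℓ n = i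
  · by_cases hnx : n = x
    · subst hnx; simp [wt, hn, hxS, hxS', NeZero.ne ℓ]
    · have h1 : n ≠ x + ℓ := by
        rintro rfl
        rw [res_add, hx] at hn
        exact one_ne_zero (add_eq_left.1 hn)
      have h2 : n + ℓ ≠ x := by
        rintro rfl
        rw [res_add, hn] at hx
        exact one_ne_zero (add_eq_left.1 hx)
      have h3 : n ∈ (S \ {x}) ∪ {x + (ℓ : ℤ)} ↔ n ∈ S := by simp [hnx, h1]
      have h4 : n + ℓ ∈ (S \ {x}) ∪ {x + (ℓ : ℤ)} ↔ n + ℓ ∈ S := by simp [hnx, h2]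
      rw [if_neg hnx, sub_zero, wt_congr h3 h4]
  · have hnx : n ≠ x := by rintro rfl; exact hn hx
    simp [wt, hn, hnx]

/-- Reversing the sign at `x` lowers the potential by 2 to the right of `x`. The value at `x` was
one below the maximum, first reached at `x + 1`; now it is the maximum, reached for the last time.
-/
theorem Good.cogood (hx : Good ℓ i S x) : CoGood ℓ i ((S \ {x}) ∪ {x + (ℓ : ℤ)}) x := by
  obtain ⟨hr, hm, hm'⟩ := hx.mem
  obtain ⟨h, hh, h1, h2⟩ := hx
  have hs := hh x
  have hw := wt_le_one (ℓ := ℓ) (i := i) (S := S) x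
  have hlt := h1 x le_rfl
  refine ⟨fun n => h n - if x < n then 2 else 0, fun n => ?_, ?_, ?_⟩
  · have := hh n
    rw [wt_move hr hm hm']
    dsimp only
    split_ifs <;> omega
  · intro y hy
    have := h2 y
    simp [hy]
    omega
  · intro y
    have h2 := h2 y
    simp only [lt_irrefl, if_false]
    rcases le_or_gt y x with hy | hy
    · have := h1 y hy
      rw [if_neg (by omega)]
      omega
    · rw [if_pos hy]; omega

theorem CoGood.good (hx : CoGood ℓ i S x) : Good ℓ i ((S \ {x + (ℓ : ℤ)}) ∪ {x}) x := by
  obtain ⟨hr, hm, hm'⟩ := hx.mem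
  set R := (S \ {x + (ℓ : ℤ)}) ∪ {x} with hR
  have hRS : (R \ {x}) ∪ {x + (ℓ : ℤ)} = S := by
    ext n
    simp only [hR, Set.mem_union, Set.mem_sdiff, Set.mem_singleton_iff]
    constructor
    · rintro (⟨h1 | h1, h2⟩ | h1)
      · exact h1.1
      · exact absurd h1 h2
      · exact h1 ▸ hm'
    · intro hn
      by_cases h : n = x + ℓ
      · exact Or.inr h
      · exact Or.inl ⟨Or.inl ⟨hn, h⟩, fun h' => hm (h' ▸ hn)⟩
  have hmR : x ∈ R := by simp [hR]
  have hmR' : x + (ℓ : ℤ) ∉ R := by simp [hR, NeZero.ne ℓ]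
  obtain ⟨h, hh, h1, h2⟩ := hx
  have hs := hh x
  have hw := neg_one_le_wt (ℓ := ℓ) (i := i) (S := S) x
  have hlt := h1 (x + 1) (by omega)
  refine ⟨fun n => h n + if x < n then 2 else 0, fun n => ?_, ?_, ?_⟩
  · have := hh n
    rw [← hRS, wt_move hr hmR hmR'] at this
    dsimp only
    split_ifs at * <;> omega
  · intro y hy
    have := h2 y
    dsimp only
    rw [if_neg (by omega), if_pos (by omega)]
    omega
  · intro y
    dsimp only
    rw [if_pos (show x < x + 1 by omega)]
    rcases le_or_gt y x with hy | hy
    · have := h2 y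
      rw [if_neg (by omega)]
      omega
    · have := h1 y hy
      rw [if_pos hy]; omega

theorem FStep_iff_cogood :
    FStep ℓ i S T ↔ ∃ x, CoGood ℓ i T x ∧ S = (T \ {x + (ℓ : ℤ)}) ∪ {x} := by
  constructor
  · rintro ⟨x, hx, rfl⟩
    exact ⟨x, hx.cogood, (move_back hx.mem.2.1 hx.mem.2.2).symm⟩
  · rintro ⟨x, hx, rfl⟩
    exact ⟨x, hx.good, (move_forth hx.mem.2.1 hx.mem.2.2).symm⟩

end crystal

/-! ### Cycles and good positions -/

section transfer
variable {e ℓ : ℕ} {i : ZMod e} {S T : Set ℤ} {x y : ℤ} {h h' : ℤ → ℤ} {b : ZMod e → ℤ}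

theorem le_of_steps {u v a c : ℤ} (hs : ∀ k, a ≤ k → k < c → h k ≤ h (k + 1)) (hu : a ≤ u)
    (huv : u ≤ v) (hv : v ≤ c) : h u ≤ h v := by
  induction v, huv using Int.leInduction with
  | base => rfl
  | succ n hn ih => exact (ih (by omega)).trans (hs n (by omega) (by omega))

theorem exists_firstMax {m p : ℤ} (hh : ∀ n, h' n = h n - if m < n ∧ n ≤ p then 1 else 0)
    (hx : FirstMax h' x) (hle : ∀ n, m < n → n ≤ p → h n ≤ h' (x + 1)) :
    ∃ x', FirstMax h x' ∧ h (x' + 1) = h' (x + 1) := by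
  have hle' : ∀ n, h n ≤ h' (x + 1) := fun n => by
    have h1 := hh n
    have h2 := hx.2 n
    split_ifs at h1 with hn
    · exact hle n hn.1 hn.2
    · omega
  obtain ⟨n, hn, hmin⟩ := Int.exists_least_of_bdd (P := fun n => h n = h' (x + 1))
    ⟨min m x, fun z hz => by
      by_contra! hlt
      have h1 := hh z
      have h2 := hx.1 z (by omega)
      rw [if_neg (by omega)] at h1
      omega⟩ (by
      refine ⟨x + 1, le_antisymm (hle' _) ?_⟩
      have h1 := hh (x + 1)
      split_ifs at h1 <;> omega)
  refine ⟨n - 1, ⟨fun y hy => ?_, fun y => ?_⟩, by simpa using hn⟩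
  · rw [sub_add_cancel, hn]
    refine lt_of_le_of_ne (hle' y) fun hy' => ?_
    have := hmin y hy'
    omega
  · rw [sub_add_cancel, hn]; exact hle' y

theorem FirstMax.of_le {m p : ℤ} (hh : ∀ n, h' n = h n - if m < n ∧ n ≤ p then 1 else 0)
    (hx : FirstMax h x) (hn : ¬ (m ≤ x ∧ x < p)) : FirstMax h' x := by
  have h0 := hh (x + 1)
  rw [if_neg (by omega)] at h0
  refine ⟨fun y hy => ?_, fun y => ?_⟩
  · have := hx.1 y hy
    have := hh y
    split_ifs at this <;> omega
  · have := hx.2 y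
    have := hh y
    split_ifs at this <;> omega

theorem wt_spec (S : Set ℤ) {n : ℤ} (hn : res e ℓ n = i) : ∃ a c : ℤ, wt ℓ i S n = a - c ∧
    (n ∈ S → a = 1) ∧ (n ∉ S → a = 0) ∧ (n + ℓ ∈ S → c = 1) ∧ (n + ℓ ∉ S → c = 0) := by
  unfold wt
  exact ⟨_, _, if_pos hn, fun h => if_pos h, fun h => if_neg h, fun h => if_pos h,
    fun h => if_neg h⟩

variable [NeZero ℓ]

theorem wt_union_cycle (hb : IsCycle ℓ b) (hd : ∀ j, b j ∉ S) (n : ℤ) :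
    wt ℓ i (S ∪ Set.range b) n =
      wt ℓ i S n + (if n = b i then 1 else 0) - (if n + ℓ = b (i + 1) then 1 else 0) := by
  by_cases hn : res e ℓ n = i
  · have h1 : n ∈ S ∪ Set.range b ↔ n ∈ S ∨ n = b i := by
      rw [Set.mem_union, hb.mem_range, hn]
    have h2 : n + ℓ ∈ S ∪ Set.range b ↔ n + ℓ ∈ S ∨ n + ℓ = b (i + 1) := by
      rw [Set.mem_union, hb.mem_range, res_add, hn]
    have h3 : n = b i → n ∉ S := fun h => h ▸ hd i
    have h4 : n + ℓ = b (i + 1) → n + ℓ ∉ S := fun h => h ▸ hd _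
    obtain ⟨a, c, hU, a1, a2, c1, c2⟩ := wt_spec (S ∪ Set.range b) hn
    obtain ⟨a', c', hS, a1', a2', c1', c2'⟩ := wt_spec S hn
    rw [h1] at a1 a2
    rw [h2] at c1 c2
    rw [hU, hS]
    clear hU hS h1 h2 hd
    have e1 : a = a' + if n = b i then 1 else 0 := by
      by_cases p : n = b i
      · rw [a1 (Or.inr p), a2' (h3 p), if_pos p]; rfl
      · rw [if_neg p]
        by_cases q : n ∈ S
        · rw [a1 (Or.inl q), a1' q]; rfl
        · rw [a2 (not_or.2 ⟨q, p⟩), a2' q]; rfl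
    have e2 : c = c' + if n + ℓ = b (i + 1) then 1 else 0 := by
      by_cases p : n + ℓ = b (i + 1)
      · rw [c1 (Or.inr p), c2' (h4 p), if_pos p]; rfl
      · rw [if_neg p]
        by_cases q : n + ℓ ∈ S
        · rw [c1 (Or.inl q), c1' q]; rfl
        · rw [c2 (not_or.2 ⟨q, p⟩), c2' q]; rfl
    rw [e1, e2]; ring
  · have h1 : n ≠ b i := by rintro rfl; exact hn (hb.res_eq i)
    have h2 : n + ℓ ≠ b (i + 1) := by
      intro h
      have := hb.res_eq (i + 1)
      rw [← h, res_add] at this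
      exact hn (add_right_cancel this)
    unfold wt
    rw [if_neg hn, if_neg hn, if_neg h1, if_neg h2]; rfl

/-- Only `b i` and `b (i + 1)` affect the `i`-signature: they add a `+` at `b i` and a `-` at `b (i
+ 1) - ℓ`. The cycle inequality puts the `-` no later than the `+`, so the potential drops by one
exactly in between. -/
theorem IsPotential.union_cycle (hh : IsPotential ℓ i S h) (hb : IsCycle ℓ b)
    (hd : ∀ j, b j ∉ S) : IsPotential ℓ i (S ∪ Set.range b)
      (fun n => h n - if b (i + 1) - ℓ < n ∧ n ≤ b i then 1 else 0) := by
  intro n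
  have h1 := hh n
  have h2 := hb.succ_le i
  rw [wt_union_cycle hb hd]
  dsimp only
  split_ifs <;> omega

namespace Adm

/-- A `-` at `n` would come from the element `n + ℓ` of `S`, which lies in the wall at residue `i +
1`. -/
theorem wt_nonneg (ha : Adm ℓ S b) {n : ℤ} (h1 : b (i + 1) - ℓ ≤ n) (h2 : n ≤ b i) :
    0 ≤ wt ℓ i S n := by
  by_contra! hlt
  obtain ⟨hr, -, hm⟩ := wt_neg hlt
  have := ha.off_res hm (i := i + 1) (by rw [res_add, hr]) (by omega)
  simp only [add_sub_cancel_right] at this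
  omega

omit [NeZero ℓ] in
-- A `+` at `n` would be an element of `S` in the wall at residue `i`.
theorem wt_nonpos (ha : Adm ℓ S b) {n : ℤ} (h1 : b i ≤ n) (h2 : n ≤ b (i - 1) + ℓ) :
    wt ℓ i S n ≤ 0 := by
  by_contra! hlt
  obtain ⟨hr, hm, -⟩ := wt_pos hlt
  have := ha.off_res hm hr h1
  omega

theorem mono (ha : Adm ℓ S b) (hh : IsPotential ℓ i S h) {u v : ℤ} (hu : b (i + 1) - ℓ ≤ u)
    (huv : u ≤ v) (hv : v ≤ b i + 1) : h u ≤ h v := by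
  refine le_of_steps (a := b (i + 1) - ℓ) (c := b i + 1) (fun k h1 h2 => ?_) hu huv hv
  have := ha.wt_nonneg h1 (i := i) (by omega)
  have := hh k
  omega

omit [NeZero ℓ] in
theorem anti (ha : Adm ℓ S b) (hh : IsPotential ℓ i S h) {u v : ℤ} (hu : b i ≤ u)
    (huv : u ≤ v) (hv : v ≤ b (i - 1) + ℓ + 1) : h v ≤ h u := by
  have := le_of_steps (h := fun n => - h n) (a := b i) (c := b (i - 1) + ℓ + 1)
    (fun k h1 h2 => ?_) hu huv hv
  · simpa using this
  · have := ha.wt_nonpos (i := i) h1 (by omega)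
    have := hh k
    omega

/-- The potentials of `S` and of `S ∪ range b` reach the same maximum. -/
theorem exists_good (ha : Adm ℓ S b) (hx : Good ℓ i (S ∪ Set.range b) x) :
    ∃ x', Good ℓ i S x' := by
  obtain ⟨h, hh⟩ := exists_potential ℓ i S
  have hh' := hh.union_cycle ha.cycle ha.notMem
  have hx := hx.firstMax hh'
  obtain ⟨x', hx', -⟩ := exists_firstMax (fun n => rfl) hx fun n h1 h2 => by
    refine (ha.mono hh h1.le (by omega) le_rfl).trans ?_
    have := hx.2 (b i + 1)
    simp only at this ⊢
    rw [if_neg (by omega)] at this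
    omega
  exact ⟨x', h, hh, hx'⟩

/-- For `sh b` the lowered interval is the wall at residue `i`, on which the potential of `S` is
weakly decreasing. Its values there are bounded by the one at `b i`, where the two potentials agree.
-/
theorem exists_good_of_sh (ha : Adm ℓ S b) (hx : Good ℓ i (S ∪ Set.range (sh ℓ b)) x) :
    ∃ x', Good ℓ i S x' := by
  obtain ⟨h, hh⟩ := exists_potential ℓ i S
  have hh' := hh.union_cycle ha.cycle.sh ha.sh_notMem
  have hx := hx.firstMax hh'
  obtain ⟨x', hx', -⟩ := exists_firstMax (fun n => rfl) hx fun n h1 h2 => by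
    simp only [sh, add_sub_cancel_right] at h1 h2
    have h3 := ha.anti hh (i := i) le_rfl h1.le (by omega)
    have := hx.2 (b i)
    simp only [sh, add_sub_cancel_right] at this ⊢
    rw [if_neg (by omega)] at this
    omega
  exact ⟨x', h, hh, hx'⟩

/-- The good position is an element of `S`, so it is not in the wall, and the translate never
disturbs it. -/
theorem good_sh (ha : Adm ℓ S b) (hx : Good ℓ i S x) : Good ℓ i (S ∪ Set.range (sh ℓ b)) x := by
  have hm := hx.mem
  obtain ⟨h, hh, hx⟩ := hx
  refine ⟨_, hh.union_cycle ha.cycle.sh ha.sh_notMem, hx.of_le (fun n => rfl) fun hn => ?_⟩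
  simp only [sh, add_sub_cancel_right] at hn
  have := ha.off_res hm.2.1 hm.1 hn.1
  omega

theorem good_of_not_cross (ha : Adm ℓ S b) (hx : Good ℓ i S x)
    (hn : ¬ (b (i + 1) - ℓ ≤ x ∧ x < b i)) : Good ℓ i (S ∪ Set.range b) x := by
  obtain ⟨h, hh, hx⟩ := hx
  exact ⟨_, hh.union_cycle ha.cycle ha.notMem, hx.of_le (fun n => rfl) hn⟩

theorem eq_max (ha : Adm ℓ S b) (hh : IsPotential ℓ i S h) (hx : FirstMax h x)
    (h1 : b (i + 1) - ℓ ≤ x) {n : ℤ} (h2 : x < n) (h3 : n ≤ b i + 1) : h n = h (x + 1) :=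
  le_antisymm (hx.2 n) (ha.mono hh (by omega) (by omega) h3)

/-- The potential of `S` reaches its maximum at `x + 1` and, being monotone, keeps it up to `b i +
1`. Adding the cycle lowers the whole plateau except the last point, which becomes the first
maximum. -/
theorem good_of_cross (ha : Adm ℓ S b) (hx : Good ℓ i S x)
    (h1 : b (i + 1) - ℓ ≤ x) (h2 : x < b i) : Good ℓ i (S ∪ Set.range b) (b i) := by
  obtain ⟨h, hh, hx⟩ := hx
  refine ⟨_, hh.union_cycle ha.cycle ha.notMem, fun y hy => ?_, fun y => ?_⟩
  · dsimp only
    rw [if_neg (show ¬ (_ ∧ b i + 1 ≤ b i) by omega), ha.eq_max hh hx h1 (by omega) le_rfl]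
    rcases le_or_gt y x with hyx | hyx
    · have := hx.1 y hyx
      split_ifs <;> omega
    · rw [ha.eq_max hh hx h1 hyx (by omega), if_pos ⟨by omega, hy⟩]; omega
  · dsimp only
    rw [if_neg (show ¬ (_ ∧ b i + 1 ≤ b i) by omega), ha.eq_max hh hx h1 (by omega) le_rfl]
    have := hx.2 y
    split_ifs <;> omega

/-- On the plateau the potential is constant; an element of residue `i` there would be a `+`, since
the wall forbids `n + ℓ`, and would make the potential increase. -/
theorem notMem_of_cross (ha : Adm ℓ S b) (hx : Good ℓ i S x)
    (h1 : b (i + 1) - ℓ ≤ x) {n : ℤ} (h2 : x < n) (h3 : n ≤ b i) (hr : res e ℓ n = i) :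
    n ∉ S := by
  intro hn
  obtain ⟨h, hh, hx⟩ := hx
  have e1 := ha.eq_max hh hx h1 h2 (by omega)
  have e2 := ha.eq_max hh hx h1 (n := n + 1) (by omega) (by omega)
  have hs := hh n
  have hnot : n + ℓ ∉ S := fun hm => by
    have := ha.off_res hm (i := i + 1) (by rw [res_add, hr]) (by omega)
    simp only [add_sub_cancel_right] at this
    omega
  simp only [wt, hr, hn, hnot, if_true, if_false] at hs
  omega

/-- How the good position changes when a cycle is added. -/
theorem good_cases (ha : Adm ℓ S b) (hx : Good ℓ i (S ∪ Set.range b) x) :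
    ∃ x', Good ℓ i S x' ∧ ((x = x' ∧ ¬ (b (i + 1) - ℓ ≤ x' ∧ x' < b i)) ∨
      (x = b i ∧ b (i + 1) - ℓ ≤ x' ∧ x' < b i)) := by
  obtain ⟨x', hx'⟩ := ha.exists_good hx
  refine ⟨x', hx', ?_⟩
  by_cases hc : b (i + 1) - ℓ ≤ x' ∧ x' < b i
  · exact Or.inr ⟨hx.unique (ha.good_of_cross hx' hc.1 hc.2), hc⟩
  · exact Or.inl ⟨hx.unique (ha.good_of_not_cross hx' hc), hc⟩

/-- The crystal operator which lowers a set does not act on an admissible cycle in it. -/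
theorem cogood_of_union (ha : Adm ℓ S b) (hx : CoGood ℓ i (S ∪ Set.range b) x) :
    CoGood ℓ i S x := by
  obtain ⟨h, hh⟩ := exists_potential ℓ i S
  have hx := hx.lastMax (hh.union_cycle ha.cycle ha.notMem)
  have hp : b i + 1 ≠ x → h (b i + 1) ≤ h x - if b (i + 1) - ℓ < x ∧ x ≤ b i then 1 else 0 := by
    intro _
    have := hx.2 (b i + 1)
    simp only at this
    rw [if_neg (show ¬ (_ ∧ b i + 1 ≤ b i) by omega)] at this
    omega
  have hnot : ¬ (b (i + 1) - ℓ < x ∧ x ≤ b i) := by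
    intro hc
    have := hp (by omega)
    rw [if_pos hc] at this
    have := ha.mono hh hc.1.le (show x ≤ b i + 1 by omega) le_rfl
    omega
  refine ⟨h, hh, fun y hy => ?_, fun y => ?_⟩
  · by_cases hc : b (i + 1) - ℓ < y ∧ y ≤ b i
    · have := ha.mono hh hc.1.le (show y ≤ b i + 1 by omega) le_rfl
      have := hx.1 (b i + 1) (by omega)
      simp only at this
      rw [if_neg (show ¬ (_ ∧ b i + 1 ≤ b i) by omega), if_neg hnot] at this
      omega
    · have := hx.1 y hy
      simp only at this
      rw [if_neg hc, if_neg hnot] at this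
      omega
  · by_cases hc : b (i + 1) - ℓ < y ∧ y ≤ b i
    · have := ha.mono hh hc.1.le (show y ≤ b i + 1 by omega) le_rfl
      have := hx.2 (b i + 1)
      simp only at this
      rw [if_neg (show ¬ (_ ∧ b i + 1 ≤ b i) by omega), if_neg hnot] at this
      omega
    · have := hx.2 y
      simp only at this
      rw [if_neg hc, if_neg hnot] at this
      omega

end Adm

end transfer

/-! ### Crystal operators commute with the translation of an admissible cycle -/

section
variable {e ℓ : ℕ} {i : ZMod e} {S T : Set ℤ} {x : ℤ} {b : ZMod e → ℤ}

theorem mem_range_update (hb : IsCycle ℓ b) {n : ℤ} :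
    n ∈ Set.range (Function.update b i x) ↔ n = x ∨ (n ∈ Set.range b ∧ n ≠ b i) := by
  constructor
  · rintro ⟨j, rfl⟩
    by_cases hj : j = i
    · subst hj; simp
    · rw [Function.update_of_ne hj]
      exact Or.inr ⟨⟨j, rfl⟩, fun h => hj (hb.inj h)⟩
  · rintro (rfl | ⟨⟨j, rfl⟩, hj⟩)
    · exact ⟨i, by simp⟩
    · exact ⟨j, Function.update_of_ne (fun h : j = i => hj (by rw [h])) _ _⟩

theorem sh_update (b : ZMod e → ℤ) (i : ZMod e) (x : ℤ) :
    sh ℓ (Function.update b i x) = Function.update (sh ℓ b) (i + 1) (x + ℓ) := by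
  funext j
  by_cases hj : j = i + 1
  · subst hj; simp [sh]
  · rw [Function.update_of_ne hj, sh, sh, Function.update_of_ne]
    rintro rfl; simp at hj

theorem move_union_cycle (hxb : x ∉ Set.range b) :
    ((S ∪ Set.range b) \ {x}) ∪ {x + (ℓ : ℤ)} = ((S \ {x}) ∪ {x + (ℓ : ℤ)}) ∪ Set.range b := by
  ext n
  have : n ∈ Set.range b → n ≠ x := fun h h' => hxb (h' ▸ h)
  simp only [Set.mem_union, Set.mem_sdiff, Set.mem_singleton_iff]
  tauto

theorem IsCycle.update_cycle [Fact (1 < e)] (hb : IsCycle ℓ b) (hr : res e ℓ x = i)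
    (h1 : b (i + 1) ≤ x + ℓ) (h2 : x ≤ b (i - 1) + ℓ) : IsCycle ℓ (Function.update b i x) where
  res_eq j := by
    by_cases hj : j = i
    · subst hj; simp [hr]
    · rw [Function.update_of_ne hj, hb.res_eq]
  succ_le j := by
    by_cases hj : j = i
    · subst hj
      rw [Function.update_of_ne (by simp), Function.update_self]; exact h1
    · by_cases hj' : j + 1 = i
      · subst hj'
        rw [Function.update_self, Function.update_of_ne hj]
        simpa using h2
      · rw [Function.update_of_ne hj', Function.update_of_ne hj]; exact hb.succ_le j

variable [NeZero ℓ] [Fact (1 < e)]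

/-- If the good position `x` of `S` is not in the crossing interval, the same bead moves in both
unions. Otherwise `b i` moves in `S ∪ range b` while `x` moves in `S ∪ range (sh b)`. Exchanging
roles reconciles the two: `x` enters the cycle in place of `b i`, and `b i + ℓ` joins the
complement. -/
theorem Adm.transfer (ha : Adm ℓ S b) (hx : Good ℓ i S x) :
    ∃ (S₁ : Set ℤ) (b₁ : ZMod e → ℤ), Adm ℓ S₁ b₁ ∧ FStep ℓ i (S ∪ Set.range b) (S₁ ∪ Set.range b₁) ∧
      FStep ℓ i (S ∪ Set.range (sh ℓ b)) (S₁ ∪ Set.range (sh ℓ b₁)) ∧ b₁ ≤ b ∧ b ≤ sh ℓ b₁ := by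
  obtain ⟨hr, hm, hm'⟩ := hx.mem
  have hxb : x ∉ Set.range b := Set.disjoint_left.1 ha.disjoint hm
  have hxs : x ∉ Set.range (sh ℓ b) := Set.disjoint_left.1 ha.disjoint_sh hm
  have hl := ha.cycle.succ_le i
  by_cases hc : b (i + 1) - ℓ ≤ x ∧ x < b i
  · refine ⟨(S \ {x}) ∪ {b i + (ℓ : ℤ)}, Function.update b i x, ⟨?_, ?_⟩,
      ⟨b i, ha.good_of_cross hx hc.1 hc.2, ?_⟩, ⟨x, ha.good_sh hx, ?_⟩, ?_, ?_⟩
    · have := ha.cycle.le_pred i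
      exact ha.cycle.update_cycle hr (by omega) (by omega)
    · rintro n (⟨hn, hnx⟩ | rfl)
      · rw [Set.mem_singleton_iff] at hnx
        by_cases h1 : res e ℓ n = i
        · rw [h1, Function.update_self, Function.update_of_ne (by simp)]
          intro h2
          by_cases h3 : b i ≤ n
          · exact ha.off_res hn h1 h3
          · exact absurd hn (ha.notMem_of_cross hx hc.1 (by omega) (by omega) h1)
        · rw [Function.update_of_ne h1]
          intro h2
          by_cases h3 : res e ℓ n - 1 = i
          · rw [h3, Function.update_self]
            have := ha.off n hn h2
            rw [h3] at this
            omega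
          · rw [Function.update_of_ne h3]; exact ha.off n hn h2
      · rw [res_add, ha.cycle.res_eq, add_sub_cancel_right, Function.update_self]
        intro _; omega
    · ext n
      have h1 := mem_range_update (x := x) (i := i) ha.cycle (n := n)
      have h2 := ha.notMem i
      have h3 : n = b i → n ∉ S := fun h => h ▸ h2
      simp only [Set.mem_union, Set.mem_sdiff, Set.mem_singleton_iff, h1]
      have h4 : n = x → n ∈ S := fun h => h ▸ hm
      have h5 : n = x → n ≠ b i := fun h h' => h2 (h' ▸ h4 h)
      tauto
    · ext n
      rw [sh_update]
      have h1 := mem_range_update (x := x + ℓ) (i := i + 1) ha.cycle.sh (n := n)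
      have h2 := ha.sh_notMem (i + 1)
      have e1 : sh ℓ b (i + 1) = b i + ℓ := by simp [sh]
      rw [e1] at h1 h2
      have h6 : b i + ℓ ∈ Set.range (sh ℓ b) := ⟨i + 1, e1⟩
      have h7 : n = b i + ℓ → n ∈ Set.range (sh ℓ b) := fun h => h ▸ h6
      have h8 : n ∈ Set.range (sh ℓ b) → n ≠ x := fun h h' => hxs (h' ▸ h)
      simp only [Set.mem_union, Set.mem_sdiff, Set.mem_singleton_iff, h1]
      tauto
    · intro j
      by_cases hj : j = i
      · subst hj; simp [hc.2.le]
      · rw [Function.update_of_ne hj]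
    · intro j
      rw [sh_update]
      by_cases hj : j = i + 1
      · subst hj; rw [Function.update_self]; exact sub_le_iff_le_add.1 hc.1
      · rw [Function.update_of_ne hj]; exact ha.cycle.le_pred j
  · refine ⟨(S \ {x}) ∪ {x + (ℓ : ℤ)}, b, ⟨ha.cycle, ?_⟩, ⟨x, ha.good_of_not_cross hx hc, ?_⟩,
      ⟨x, ha.good_sh hx, ?_⟩, le_rfl, ha.cycle.le_sh⟩
    · rintro n (⟨hn, hnx⟩ | rfl)
      · exact ha.off n hn
      · rw [res_add, hr, add_sub_cancel_right]
        intro h1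
        have : x ≠ b i := fun h => hxb ⟨i, h.symm⟩
        omega
    · exact (move_union_cycle hxb).symm
    · exact (move_union_cycle hxs).symm

theorem Adm.fstep (ha : Adm ℓ S b) (hT : FStep ℓ i (S ∪ Set.range b) T) :
    ∃ (S₁ : Set ℤ) (b₁ : ZMod e → ℤ), Adm ℓ S₁ b₁ ∧ T = S₁ ∪ Set.range b₁ ∧
      FStep ℓ i (S ∪ Set.range (sh ℓ b)) (S₁ ∪ Set.range (sh ℓ b₁)) ∧ b₁ ≤ b ∧ b ≤ sh ℓ b₁ := by
  obtain ⟨x, hx, -⟩ := id hT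
  obtain ⟨x', hx'⟩ := ha.exists_good hx
  obtain ⟨S₁, b₁, h1, h2, h3, h4⟩ := ha.transfer hx'
  exact ⟨S₁, b₁, h1, hT.unique h2, h3, h4⟩

theorem Adm.fstep_sh (ha : Adm ℓ S b) (hT : FStep ℓ i (S ∪ Set.range (sh ℓ b)) T) :
    ∃ (S₁ : Set ℤ) (b₁ : ZMod e → ℤ), Adm ℓ S₁ b₁ ∧ T = S₁ ∪ Set.range (sh ℓ b₁) ∧
      FStep ℓ i (S ∪ Set.range b) (S₁ ∪ Set.range b₁) := by
  obtain ⟨x, hx, -⟩ := id hT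
  obtain ⟨x', hx'⟩ := ha.exists_good_of_sh hx
  obtain ⟨S₁, b₁, h1, h2, h3, h4⟩ := ha.transfer hx'
  exact ⟨S₁, b₁, h1, hT.unique h3, h2⟩

end

/-! ### Rotation by a half turn -/

/-- The image of a set of codes under the half turn `n ↦ -1 - n`. -/
def rot (S : Set ℤ) : Set ℤ := {n | -1 - n ∈ S}

/-- The half turn exchanges the two sides of the wall of a cycle. -/
def rotCycle {e : ℕ} (ℓ : ℕ) (b : ZMod e → ℤ) : ZMod e → ℤ := fun j => -1 - sh ℓ b (-1 - j)

section
variable {e ℓ : ℕ} {i : ZMod e} {S T : Set ℤ} {x : ℤ} {b : ZMod e → ℤ}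

theorem mem_rot {n : ℤ} : n ∈ rot S ↔ -1 - n ∈ S := Iff.rfl

theorem rot_rot : rot (rot S) = S := by
  ext n; simp [mem_rot]

theorem rotCycle_rotCycle : rotCycle ℓ (rotCycle ℓ b) = b := by
  funext j
  have : (-1 - (-1 - j - 1) - 1 : ZMod e) = j := by ring
  simp only [rotCycle, sh, this]; ring

theorem rot_union : rot (S ∪ T) = rot S ∪ rot T := rfl

theorem rot_range_sh : rot (Set.range (sh ℓ b)) = Set.range (rotCycle ℓ b) := by
  ext n
  constructor
  · rintro ⟨j, hj⟩
    refine ⟨-1 - j, ?_⟩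
    simp only [rotCycle, sub_sub_cancel, hj]
  · rintro ⟨j, rfl⟩
    exact ⟨-1 - j, by simp [rotCycle]⟩

theorem rot_range : rot (Set.range b) = Set.range (sh ℓ (rotCycle ℓ b)) := by
  ext n
  constructor
  · rintro ⟨j, hj⟩
    refine ⟨-1 - j, ?_⟩
    have : (-1 - (-1 - j - 1) - 1 : ZMod e) = j := by ring
    simp only [rotCycle, sh, this, hj]; ring
  · rintro ⟨j, rfl⟩
    refine ⟨-1 - j, ?_⟩
    have : (-1 - (j - 1) - 1 : ZMod e) = -1 - j := by ring
    simp only [rotCycle, sh, this]; ring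

variable [NeZero ℓ]

theorem Adm.rot (ha : Adm ℓ S b) : Adm ℓ (rot S) (rotCycle ℓ b) where
  cycle := {
    res_eq := fun j => by simp only [rotCycle]; rw [res_neg, ha.cycle.sh.res_eq]; ring
    succ_le := fun j => by
      have := ha.cycle.sh.succ_le (-1 - (j + 1))
      rw [show (-1 - (j + 1) + 1 : ZMod e) = -1 - j by ring] at this
      simp only [rotCycle]; omega }
  off n hn h1 := by
    by_contra! h2
    have h3 := ha.off_res hn rfl
    rw [res_neg] at h3
    simp only [rotCycle, sh] at h1 h2
    rw [show (-1 - (res e ℓ n - 1) - 1 : ZMod e) = -1 - res e ℓ n by ring] at h2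
    have := h3 (by omega)
    omega

/-- The half turn reverses the reading order and exchanges `+` and `-`. The sign of the pair `x, x +
ℓ` is recorded at its left end, and the left end of the image is `-1 - x - ℓ`; this gives the
residue `-2 - i`. -/
theorem wt_rot (n : ℤ) : wt ℓ (-2 - i) (rot S) n = - wt ℓ i S (-1 - n - ℓ) := by
  have h : res e ℓ (-1 - n - ℓ) = i ↔ res e ℓ n = -2 - i := by
    rw [res_sub, res_neg]
    constructor
    · intro h; rw [← h]; ring
    · intro h; rw [h]; ring
  have h1 : -1 - n - (ℓ : ℤ) + ℓ = -1 - n := by ring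
  have h2 : -1 - (n + (ℓ : ℤ)) = -1 - n - ℓ := by ring
  by_cases hn : res e ℓ n = -2 - i
  · obtain ⟨a, c, hU, a1, a2, c1, c2⟩ := wt_spec (rot S) hn
    obtain ⟨a', c', hS, a1', a2', c1', c2'⟩ := wt_spec S (h.2 hn)
    rw [mem_rot] at a1 a2 c1 c2
    rw [h1] at c1' c2'
    rw [h2] at c1 c2
    have e1 : a = c' := by
      by_cases p : -1 - n ∈ S
      · rw [a1 p, c1' p]
      · rw [a2 p, c2' p]
    have e2 : c = a' := by
      by_cases p : -1 - n - ℓ ∈ S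
      · rw [c1 p, a1' p]
      · rw [c2 p, a2' p]
    rw [hU, hS, e1, e2]; ring
  · have : res e ℓ (-1 - n - ℓ) ≠ i := fun h' => hn (h.1 h')
    simp [wt, hn, this]

theorem CoGood.rot (hx : CoGood ℓ i S x) : Good ℓ (-2 - i) (rot S) (-1 - x - ℓ) := by
  obtain ⟨h, hh, h1, h2⟩ := hx
  have e1 : -(-1 - x - ℓ + 1) - (ℓ : ℤ) = x := by ring
  refine ⟨fun n => h (-n - ℓ), fun n => ?_, fun y hy => ?_, fun y => ?_⟩
  · have := hh (-1 - n - ℓ)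
    rw [wt_rot]
    dsimp only
    rw [show -1 - n - (ℓ : ℤ) + 1 = -n - ℓ by ring] at this
    rw [show -(n + 1) - (ℓ : ℤ) = -1 - n - ℓ by ring]
    omega
  · dsimp only
    rw [e1]; exact h1 _ (by omega)
  · dsimp only
    rw [e1]; exact h2 _

variable [Fact (1 < e)]

theorem FStep.rot (h : FStep ℓ i S T) : FStep ℓ (-2 - i) (rot T) (rot S) := by
  rw [FStep_iff_cogood] at h
  obtain ⟨x, hx, rfl⟩ := h
  refine ⟨_, hx.rot, ?_⟩
  ext n
  have h1 : -1 - n = x + ℓ ↔ n = -1 - x - ℓ := by constructor <;> intro h <;> omega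
  have h2 : -1 - n = x ↔ n = -1 - x - ℓ + ℓ := by constructor <;> intro h <;> omega
  simp only [Set.mem_union, Set.mem_sdiff, Set.mem_singleton_iff, mem_rot, h1, h2]

/-- The half turn reverses crystal arrows and exchanges a cycle with its translate, so this is
`Adm.fstep_sh` seen upside down. -/
theorem Adm.estep (ha : Adm ℓ S b) (hT : FStep ℓ i T (S ∪ Set.range b)) :
    ∃ (S₁ : Set ℤ) (b₁ : ZMod e → ℤ), Adm ℓ S₁ b₁ ∧ T = S₁ ∪ Set.range b₁ ∧
      FStep ℓ i (S₁ ∪ Set.range (sh ℓ b₁)) (S ∪ Set.range (sh ℓ b)) := by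
  have hr := hT.rot
  rw [rot_union, rot_range (ℓ := ℓ)] at hr
  obtain ⟨S₁, b₁, h1, h2, h3⟩ := ha.rot.fstep_sh hr
  refine ⟨AbacusCrystal.rot S₁, rotCycle ℓ b₁, h1.rot, ?_, ?_⟩
  · rw [← rot_range_sh, ← rot_union, ← h2, rot_rot]
  · have := h3.rot
    rw [rot_union, rot_union, rot_rot, rot_range (ℓ := ℓ), rot_range (ℓ := ℓ),
      rotCycle_rotCycle] at this
    simpa using this

theorem Adm.estep_sh (ha : Adm ℓ S b) (hT : FStep ℓ i T (S ∪ Set.range (sh ℓ b))) :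
    ∃ (S₁ : Set ℤ) (b₁ : ZMod e → ℤ), Adm ℓ S₁ b₁ ∧ T = S₁ ∪ Set.range (sh ℓ b₁) ∧
      FStep ℓ i (S₁ ∪ Set.range b₁) (S ∪ Set.range b) := by
  have hr := hT.rot
  rw [rot_union, rot_range_sh] at hr
  obtain ⟨S₁, b₁, h1, h2, h3, -⟩ := ha.rot.fstep hr
  refine ⟨AbacusCrystal.rot S₁, rotCycle ℓ b₁, h1.rot, ?_, ?_⟩
  · rw [← rot_range, ← rot_union, ← h2, rot_rot]
  · have := h3.rot
    rw [← rot_range, rot_union, rot_union, rot_rot, rot_rot, rot_range_sh] at this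
    simpa using this

end

/-! ### The sequence of successive greatest cycles -/

/-- `S` contains all small integers and no large integer. -/
structure Semiinfinite (S : Set ℤ) : Prop where
  full : ∃ lo : ℤ, ∀ n ≤ lo, n ∈ S
  bdd : ∃ hi : ℤ, ∀ n ∈ S, n < hi

/-- `b` is the greatest cycle contained in `S`. -/
structure IsGreatestCycle {e : ℕ} (ℓ : ℕ) (S : Set ℤ) (b : ZMod e → ℤ) : Prop where
  cycle : IsCycle ℓ b
  mem : ∀ i, b i ∈ S
  ge : ∀ z, IsCycle ℓ z → (∀ i, z i ∈ S) → z ≤ b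

/-- What remains of `A` after removal of the first `k` cycles of a sequence. -/
def rest {e : ℕ} (A : Set ℤ) (P : ℕ → ZMod e → ℤ) (k : ℕ) : Set ℤ :=
  {n | n ∈ A ∧ ∀ m < k, n ∉ Set.range (P m)}

/-- Each `P k` is the greatest cycle in what remains after removal of the previous ones. -/
def IsGreedySeq {e : ℕ} (ℓ : ℕ) (A : Set ℤ) (P : ℕ → ZMod e → ℤ) : Prop :=
  ∀ k, IsGreatestCycle ℓ (rest A P k) (P k)

section
variable {e ℓ : ℕ} {i : ZMod e} {S A : Set ℤ} {x : ℤ} {b c : ZMod e → ℤ}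
  {P Q : ℕ → ZMod e → ℤ} {k m : ℕ}

theorem rest_zero : rest A P 0 = A := by ext; simp [rest]

theorem rest_succ : rest A P (k + 1) = rest A P k \ Set.range (P k) := by
  ext n
  simp only [rest, Set.mem_sdiff, Set.mem_ofPred_eq, Nat.lt_succ_iff_lt_or_eq]
  constructor
  · rintro ⟨h1, h2⟩
    exact ⟨⟨h1, fun m hm => h2 m (Or.inl hm)⟩, h2 k (Or.inr rfl)⟩
  · rintro ⟨⟨h1, h2⟩, h3⟩
    refine ⟨h1, fun m hm => ?_⟩
    rcases hm with hm | rfl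
    · exact h2 m hm
    · exact h3

theorem rest_anti (h : m ≤ k) : rest A P k ⊆ rest A P m :=
  fun _ hn => ⟨hn.1, fun m' hm' => hn.2 m' (by omega)⟩

theorem rest_congr (h : ∀ m < k, P m = Q m) : rest A P k = rest A Q k := by
  ext n
  simp only [rest, Set.mem_ofPred_eq]
  refine and_congr_right fun _ => forall₂_congr fun m hm => ?_
  rw [h m hm]

theorem rest_tail : rest (A \ Set.range (P 0)) (fun k => P (k + 1)) k = rest A P (k + 1) := by
  induction k with
  | zero => rw [rest_succ, rest_zero, rest_zero]
  | succ k ih => rw [rest_succ, ih, ← rest_succ]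

theorem IsGreatestCycle.unique (hb : IsGreatestCycle ℓ S b) (hc : IsGreatestCycle ℓ S c) :
    b = c := le_antisymm (hc.ge _ hb.cycle hb.mem) (hb.ge _ hc.cycle hc.mem)

/-- An element of the wall off the cycle could replace the entry of its residue and give a larger
cycle in `S`. -/
theorem IsGreatestCycle.adm [Fact (1 < e)] (hb : IsGreatestCycle ℓ S b) :
    Adm ℓ (S \ Set.range b) b where
  cycle := hb.cycle
  off n hn h1 := by
    by_contra! h2
    have h3 : b (res e ℓ n) ≠ n := fun h => hn.2 ⟨_, h⟩
    have h4 := hb.cycle.succ_le (res e ℓ n)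
    have h5 : _ ≤ b (res e ℓ n) := hb.ge _ (hb.cycle.update_cycle rfl (by omega) h2) (fun j => by
      by_cases hj : j = res e ℓ n
      · subst hj; rw [Function.update_self]; exact hn.1
      · rw [Function.update_of_ne hj]; exact hb.mem j) (res e ℓ n)
    rw [Function.update_self] at h5
    omega

theorem IsGreatestCycle.of_subset {T : Set ℤ} (hb : IsGreatestCycle ℓ S b) (hT : T ⊆ S)
    (hm : ∀ i, b i ∈ T) : IsGreatestCycle ℓ T b :=
  ⟨hb.cycle, hm, fun z hz h => hb.ge z hz fun i => hT (h i)⟩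

theorem union_range_sdiff (h : ∀ j, b j ∈ S) : (S \ Set.range b) ∪ Set.range b = S :=
  Set.sdiff_union_of_subset (by rintro _ ⟨j, rfl⟩; exact h j)

theorem union_sdiff_range (h : Disjoint S (Set.range b)) : (S ∪ Set.range b) \ Set.range b = S := by
  rw [Set.union_sdiff_right]; exact h.sdiff_eq_left

/-! ### Uniqueness and domination for greedy sequences -/

namespace IsGreedySeq

theorem unique (hP : IsGreedySeq ℓ A P) (hQ : IsGreedySeq ℓ A Q) : P = Q := by
  funext k
  induction k using Nat.strong_induction_on with
  | _ k ih =>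
    have h1 := hP k
    rw [rest_congr ih] at h1
    exact h1.unique (hQ k)

theorem tail (hP : IsGreedySeq ℓ A P) :
    IsGreedySeq ℓ (A \ Set.range (P 0)) (fun k => P (k + 1)) := fun k => by
  rw [rest_tail]; exact hP (k + 1)

theorem lt (hP : IsGreedySeq ℓ A P) (h : m < k) (j : ZMod e) : P k j < P m j := by
  have h1 := (hP m).ge _ (hP k).cycle (fun i => rest_anti h.le ((hP k).mem i)) j
  refine lt_of_le_of_ne h1 fun h2 => ((hP k).mem j).2 m h ⟨j, h2.symm⟩

theorem inj (hP : IsGreedySeq ℓ A P) {j j' : ZMod e} (h : P k j = P m j') : k = m := by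
  have hj : j = j' := by rw [← (hP k).cycle.res_eq j, h, (hP m).cycle.res_eq]
  subst hj
  rcases lt_trichotomy k m with hlt | heq | hlt
  · exact absurd h (hP.lt hlt j).ne'
  · exact heq
  · exact absurd h (hP.lt hlt j).ne

theorem mem (hP : IsGreedySeq ℓ A P) (k : ℕ) (j : ZMod e) : P k j ∈ A := ((hP k).mem j).1

theorem le_sub (hP : IsGreedySeq ℓ A P) (k : ℕ) (j : ZMod e) : P k j ≤ P 0 j - k := by
  induction k with
  | zero => simp
  | succ k ih => have := hP.lt (Nat.lt_add_one k) j; push_cast; omega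

theorem exists_le (hP : IsGreedySeq ℓ A P) (n : ℤ) (j : ZMod e) : ∃ k, P k j ≤ n :=
  ⟨(P 0 j - n).toNat, (hP.le_sub _ j).trans (by omega)⟩

/-- The greedy sequence dominates all strictly decreasing chains of cycles. -/
theorem chain_le (hP : IsGreedySeq ℓ A P) {Z : ℕ → ZMod e → ℤ} {n : ℕ}
    (hZ : ∀ m ≤ n, IsCycle ℓ (Z m)) (hA : ∀ m ≤ n, ∀ j, Z m j ∈ A)
    (hlt : ∀ m < n, ∀ j, Z (m + 1) j < Z m j) : ∀ m ≤ n, Z m ≤ P m := by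
  have hlt' : ∀ m' ≤ n, ∀ m < m', ∀ j, Z m' j < Z m j := by
    intro m' hm' m hm j
    induction m', hm using Nat.le_induction with
    | base => exact hlt m (by omega) j
    | succ p hp ih => exact (hlt p (by omega) j).trans (ih (by omega))
  intro m
  induction m using Nat.strong_induction_on with
  | _ m ih =>
    intro hm
    refine (hP m).ge _ (hZ m hm) fun j => ⟨hA m hm j, fun p hp => ?_⟩
    rintro ⟨j', hj'⟩
    have hj : j' = j := by rw [← (hP p).cycle.res_eq j', hj', (hZ m hm).res_eq]
    subst hj
    have h1 := hlt' m hm p hp j'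
    have h2 : Z p j' ≤ P p j' := ih p hp (by omega) j'
    omega

/-- Appending `P k` to the chain gives `n + 1` decreasing cycles; domination yields `P k ≤ P n`,
which is impossible if `k < n`. This is how lower bounds on the index are obtained. -/
theorem index_le (hP : IsGreedySeq ℓ A P) {Z : ℕ → ZMod e → ℤ} {n : ℕ}
    (hZ : ∀ m < n, IsCycle ℓ (Z m)) (hA : ∀ m < n, ∀ j, Z m j ∈ A)
    (hlt : ∀ m, m + 1 < n → ∀ j, Z (m + 1) j < Z m j)
    (hlast : ∀ m, m + 1 = n → ∀ j, P k j < Z m j) : n ≤ k := by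
  by_contra! hk
  have h := hP.chain_le (Z := fun m => if m < n then Z m else P k) (n := n)
    (fun m _ => by
      split_ifs with h
      · exact hZ m h
      · exact (hP k).cycle)
    (fun m _ j => by
      split_ifs with h
      · exact hA m h j
      · exact hP.mem k j)
    (fun m hm j => by
      rw [if_pos hm]
      split_ifs with h
      · exact hlt m h j
      · exact hlast m (by omega) j) n le_rfl 0
  simp only [lt_irrefl, if_false] at h
  have := hP.lt hk 0
  omega

/-- An admissible cycle is a term of the greedy sequence. -/
theorem exists_eq [NeZero e] (hP : IsGreedySeq ℓ (S ∪ Set.range b) P) (ha : Adm ℓ S b) :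
    ∃ k, P k = b := by
  classical
  have hex : ∃ k, ∃ j, P k j ≤ b j := by
    obtain ⟨k, hk⟩ := hP.exists_le (b 0) 0
    exact ⟨k, 0, hk⟩
  have hd : ∀ k, P k ≤ b ∨ ∀ i, b (i - 1) + ℓ < P k i := fun k =>
    ha.le_or_front (hP k).cycle (by rintro _ ⟨j, rfl⟩; exact hP.mem k j)
  refine ⟨Nat.find hex, le_antisymm ((hd _).resolve_right ?_) ?_⟩
  · intro h
    obtain ⟨j, hj⟩ := Nat.find_spec hex
    have := h j
    have := ha.cycle.le_pred j
    omega
  · refine (hP _).ge _ ha.cycle fun j => ⟨Or.inr ⟨j, rfl⟩, fun m hm => ?_⟩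
    rintro ⟨j', hj'⟩
    refine Nat.find_min hex hm ⟨j, ?_⟩
    have : j' = j := by rw [← (hP m).cycle.res_eq j', hj', ha.cycle.res_eq]
    rw [← this, hj', this]

end IsGreedySeq

theorem Semiinfinite.sdiff_finite (hS : Semiinfinite S) {F : Set ℤ} (hF : F.Finite) :
    Semiinfinite (S \ F) := by
  obtain ⟨⟨lo, hlo⟩, ⟨hi, hhi⟩⟩ := hS
  obtain ⟨l, hl⟩ := hF.bddBelow
  refine ⟨⟨min lo (l - 1), fun n hn => ⟨hlo n (by omega), fun h => ?_⟩⟩, ⟨hi, fun n h => hhi n h.1⟩⟩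
  have := hl h
  omega

theorem Semiinfinite.union_finite (hS : Semiinfinite S) {F : Set ℤ} (hF : F.Finite) :
    Semiinfinite (S ∪ F) := by
  obtain ⟨⟨lo, hlo⟩, ⟨hi, hhi⟩⟩ := hS
  obtain ⟨u, hu⟩ := hF.bddAbove
  refine ⟨⟨lo, fun n hn => Or.inl (hlo n hn)⟩, ⟨max hi (u + 1), fun n h => ?_⟩⟩
  rcases h with h | h
  · have := hhi n h; omega
  · have := hu h; omega

theorem FStep.semiinfinite {T : Set ℤ} (h : FStep ℓ i S T) (hS : Semiinfinite S) :
    Semiinfinite T := by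
  obtain ⟨x, -, rfl⟩ := h
  exact (hS.sdiff_finite (Set.finite_singleton _)).union_finite (Set.finite_singleton _)

/-! ### Existence of greedy sequences, and stability of the index -/

variable [NeZero ℓ] [Fact (1 < e)] [NeZero e]

theorem exists_cycle_le (lo : ℤ) : ∃ b : ZMod e → ℤ, IsCycle ℓ b ∧ ∀ i, b i ≤ lo := by
  have he : (0 : ℤ) < e := by exact_mod_cast Nat.pos_of_ne_zero (NeZero.ne e)
  have hℓ : (0 : ℤ) < ℓ := by exact_mod_cast Nat.pos_of_ne_zero (NeZero.ne ℓ)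
  -- Multiples of `ℓ` all lie in one row; subtracting a multiple of `e` columns goes below `lo`
  -- without changing residues.
  refine ⟨fun i => ((i.val : ℤ) - e * (lo.natAbs + 1)) * ℓ, ⟨fun i => ?_, fun i => ?_⟩, fun i => ?_⟩
  · simp [res, Int.mul_ediv_cancel _ hℓ.ne']
  · have h1 : (i + 1).val ≤ i.val + 1 := (ZMod.val_add_le _ _).trans (by rw [ZMod.val_one])
    have h2 : ((i + 1).val : ℤ) ≤ i.val + 1 := by exact_mod_cast h1
    nlinarith
  · have h1 : (i.val : ℤ) < e := by exact_mod_cast ZMod.val_lt i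
    have h2 : -(lo.natAbs : ℤ) ≤ lo := by omega
    have h3 : (0 : ℤ) ≤ lo.natAbs := by omega
    have h4 : (i.val : ℤ) - e * (lo.natAbs + 1) ≤ - lo.natAbs := by nlinarith
    dsimp only
    nlinarith

/-- For each residue take the greatest value attained by a cycle in `S`. These values form a cycle:
one attaining the value at `i + 1` bounds it by its own entry at `i` plus `ℓ`, hence by the greatest
value at `i` plus `ℓ`. -/
theorem Semiinfinite.exists_greatest (hS : Semiinfinite S) :
    ∃ b : ZMod e → ℤ, IsGreatestCycle ℓ S b := by
  obtain ⟨⟨lo, hlo⟩, ⟨hi, hhi⟩⟩ := hS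
  obtain ⟨z, hz, hzl⟩ := exists_cycle_le (e := e) (ℓ := ℓ) lo
  have h : ∀ i : ZMod e, ∃ z : ZMod e → ℤ, (IsCycle ℓ z ∧ ∀ j, z j ∈ S) ∧
      ∀ z' : ZMod e → ℤ, IsCycle ℓ z' → (∀ j, z' j ∈ S) → z' i ≤ z i := by
    intro i
    obtain ⟨n, ⟨z', h1, h2, rfl⟩, h3⟩ := Int.exists_greatest_of_bdd
      (P := fun n => ∃ z' : ZMod e → ℤ, IsCycle ℓ z' ∧ (∀ j, z' j ∈ S) ∧ z' i = n)
      ⟨hi, by rintro _ ⟨z', -, h, rfl⟩; exact (hhi _ (h i)).le⟩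
      ⟨z i, z, hz, fun j => hlo _ (hzl j), rfl⟩
    exact ⟨z', ⟨h1, h2⟩, fun w hw hw' => h3 _ ⟨w, hw, hw', rfl⟩⟩
  choose g hg hmax using h
  refine ⟨fun i => g i i, ⟨fun i => (hg i).1.res_eq i, fun i => ?_⟩, fun i => (hg i).2 i,
    fun w hw hw' i => hmax i w hw hw'⟩
  have h1 := (hg (i + 1)).1.succ_le i
  have h2 := hmax i _ (hg (i + 1)).1 (hg (i + 1)).2
  omega

theorem Semiinfinite.exists_greedy (hA : Semiinfinite A) :
    ∃ P : ℕ → ZMod e → ℤ, IsGreedySeq ℓ A P := by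
  -- The implication makes the choice of a greatest cycle total, with default `0`, so that the
  -- removal can be iterated by plain recursion.
  have h : ∀ S : Set ℤ, ∃ b : ZMod e → ℤ, Semiinfinite S → IsGreatestCycle ℓ S b := fun S => by
    by_cases hS : Semiinfinite S
    · obtain ⟨b, hb⟩ := hS.exists_greatest (e := e) (ℓ := ℓ)
      exact ⟨b, fun _ => hb⟩
    · exact ⟨0, fun h => absurd h hS⟩
  choose G hG using h
  let R : ℕ → Set ℤ := fun k => Nat.rec A (fun _ S => S \ Set.range (G S)) k
  have hR : ∀ k, Semiinfinite (R k) := by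
    intro k
    induction k with
    | zero => exact hA
    | succ k ih => exact ih.sdiff_finite (Set.finite_range _)
  have hr : ∀ k, rest A (fun k => G (R k)) k = R k := by
    intro k
    induction k with
    | zero => exact rest_zero
    | succ k ih => rw [rest_succ, ih]
  exact ⟨fun k => G (R k), fun k => by rw [hr]; exact hG _ (hR k)⟩

omit [NeZero e] in
/-- The front of the greedy sequence survives the removal of the good position. -/
theorem IsGreedySeq.exists_chain (n : ℕ) (hP : IsGreedySeq ℓ A P) (hx : Good ℓ i A x) :
    ∃ Z : ℕ → ZMod e → ℤ, (∀ m < n, IsCycle ℓ (Z m)) ∧ (∀ m < n, ∀ j, Z m j ∈ A ∧ Z m j ≠ x) ∧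
      (∀ m, m + 1 < n → ∀ j, Z (m + 1) j < Z m j) ∧
      ∀ m < n, (∀ j, j ≠ i → Z m j = P m j) ∧ P m (i + 1) - ℓ ≤ Z m i ∧ Z m i ≤ P m i := by
  induction n generalizing A P x with
  | zero => exact ⟨P, by simp⟩
  | succ n ih =>
    have h0 := hP 0
    rw [rest_zero] at h0
    have ha := h0.adm
    have hA := union_range_sdiff h0.mem
    rw [← hA] at hx
    -- Peel off `P 0`. Either the good position is that of the rest, and `P 0` is kept, or it is `P
    -- 0 i`, and the good position `x'` of the rest takes its place in the cycle. The induction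
    -- makes the later cycles avoid `x'`.
    obtain ⟨x', hx', hcase⟩ := ha.good_cases hx
    obtain ⟨Z, h1, h2, h3, h4⟩ := ih hP.tail hx'
    have hx'm := hx'.mem
    have hxb : ∀ j, P 0 j ≠ x' := fun j h => hx'm.2.1.2 ⟨j, h⟩
    obtain ⟨z, hz1, hz2, hz3, hz4⟩ : ∃ z : ZMod e → ℤ, IsCycle ℓ z ∧ (∀ j, z j ∈ A ∧ z j ≠ x) ∧
        (0 < n → ∀ j, Z 0 j < z j) ∧ (∀ j, j ≠ i → z j = P 0 j) ∧ P 0 (i + 1) - ℓ ≤ z i ∧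
        z i ≤ P 0 i := by
      have hlt : 0 < n → ∀ j, Z 0 j < P 0 j := fun hn j => by
        have h5 := (h4 0 hn)
        have h6 := hP.lt (Nat.zero_lt_one) j
        by_cases hj : j = i
        · subst hj; exact h5.2.2.trans_lt h6
        · rw [h5.1 j hj]; exact h6
      have := h0.cycle.succ_le i
      rcases hcase with ⟨rfl, -⟩ | ⟨rfl, hc1, hc2⟩
      · exact ⟨P 0, h0.cycle, fun j => ⟨h0.mem j, hxb j⟩, hlt, fun j _ => rfl, by omega, le_rfl⟩
      · have := h0.cycle.le_pred i
        refine ⟨Function.update (P 0) i x', h0.cycle.update_cycle hx'm.1 (by omega) (by omega),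
          fun j => ?_, fun hn j => ?_, fun j hj => Function.update_of_ne hj _ _,
          by rw [Function.update_self]; exact hc1, by rw [Function.update_self]; exact hc2.le⟩
        · by_cases hj : j = i
          · subst hj; rw [Function.update_self]; exact ⟨hx'm.2.1.1, hc2.ne⟩
          · rw [Function.update_of_ne hj]
            exact ⟨h0.mem j, fun h => hj (h0.cycle.inj h)⟩
        · by_cases hj : j = i
          · subst hj
            rw [Function.update_self]
            by_contra! hge
            have h5 := (h2 0 hn j)
            have h6 := hlt hn j
            -- The next cycle avoids `x'` and has no `i`-entry between `x'` and `P 0 i`, by flatness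
            -- of the plateau, so it stays strictly below the modified cycle.
            exact ha.notMem_of_cross hx' hc1 (lt_of_le_of_ne hge (Ne.symm h5.2)) h6.le
              ((h1 0 hn).res_eq j) h5.1
          · rw [Function.update_of_ne hj]; exact hlt hn j
    have hxA : ∀ m < n, ∀ j, Z m j ≠ x := fun m hm j => by
      rcases hcase with ⟨rfl, -⟩ | ⟨rfl, -⟩
      · exact (h2 m hm j).2
      · exact fun h => (h2 m hm j).1.2 ⟨i, h.symm⟩
    refine ⟨fun m => Nat.casesOn m z Z, fun m hm => ?_, fun m hm j => ?_, fun m hm j => ?_,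
      fun m hm => ?_⟩
    · cases m with
      | zero => exact hz1
      | succ m => exact h1 m (by omega)
    · cases m with
      | zero => exact hz2 j
      | succ m => exact ⟨(h2 m (by omega) j).1.1, hxA m (by omega) j⟩
    · cases m with
      | zero => exact hz3 (by omega) j
      | succ m => exact h3 m (by omega) j
    · cases m with
      | zero => exact hz4
      | succ m => exact h4 m (by omega)

omit [NeZero e] in
-- The inverse operator never acts on an admissible cycle, so the bead at `x + ℓ` that it moves
-- belongs to none of the removed greedy cycles.
theorem IsGreedySeq.cogood_rest (hP : IsGreedySeq ℓ A P) (hx : CoGood ℓ i A x) (k : ℕ) :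
    CoGood ℓ i (rest A P k) x := by
  induction k with
  | zero => rwa [rest_zero]
  | succ k ih =>
    rw [rest_succ]
    refine (hP k).adm.cogood_of_union ?_
    rwa [union_range_sdiff (hP k).mem]

omit [NeZero e] in
/-- Crystal operators preserve the index of an admissible cycle. -/
theorem index_eq {S₁ : Set ℤ} {b₁ : ZMod e → ℤ} {k₁ : ℕ} (ha : Adm ℓ S b) (ha₁ : Adm ℓ S₁ b₁)
    (hf : FStep ℓ i (S ∪ Set.range b) (S₁ ∪ Set.range b₁)) (h1 : b₁ ≤ b) (h2 : b ≤ sh ℓ b₁)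
    (hP : IsGreedySeq ℓ (S ∪ Set.range b) P) (hQ : IsGreedySeq ℓ (S₁ ∪ Set.range b₁) Q)
    (hk : P k = b) (hk₁ : Q k₁ = b₁) : k = k₁ := by
  apply le_antisymm
  · obtain ⟨x, hx, hA⟩ := hf
    -- The `k` cycles in front of `b` can be modified to avoid `x`, hence survive the step; they
    -- still lie in front of `b`, thus of `b₁`.
    obtain ⟨Z, c1, c2, c3, c4⟩ := hP.exists_chain k hx
    rw [hA] at hQ
    refine hQ.index_le c1 (fun m hm j => Or.inl (c2 m hm j)) c3 fun m hm j => ?_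
    rw [hk₁]
    refine (h1 j).trans_lt ?_
    have h4 := c4 m (by omega)
    have h5 := hP.lt (show m < k by omega)
    rw [hk] at h5
    by_cases hj : j = i
    · subst hj
      -- At residue `i` the modified entry may be smaller than `P m i`, but it is at least `P m (i +
      -- 1) - ℓ`, and `P m (i + 1)` is beyond the wall, that is, greater than `b i + ℓ`.
      refine lt_of_lt_of_le (show b j < _ from ?_) h4.2.1
      rcases hP.mem m (j + 1) with hS | ⟨j', hb⟩
      · have h6 := ha.off_res hS ((hP m).cycle.res_eq _) (h5 _).le
        simp only [add_sub_cancel_right] at h6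
        omega
      · exact absurd (hP.inj ((congrFun hk j').trans hb)) (by omega)
    · rw [h4.1 j hj]; exact h5 j
  · rw [FStep_iff_cogood] at hf
    obtain ⟨x, hx, hA⟩ := hf
    rw [hA] at hP
    refine hP.index_le (Z := Q) (fun m _ => (hQ m).cycle) (fun m hm j => Or.inl ⟨hQ.mem m j, ?_⟩)
      (fun m _ j => hQ.lt (Nat.lt_succ_self m) j) fun m hm j => ?_
    · have := (hQ.cogood_rest hx (m + 1)).mem.2.2
      exact fun h => this.2 m (Nat.lt_succ_self m) ⟨j, h⟩
    · rw [hk]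
      refine (h2 j).trans_lt ?_
      have h5 := hQ.lt (show m < k₁ by omega) j
      rw [hk₁] at h5
      rcases hQ.mem m j with hS | ⟨j', hb⟩
      · exact ha₁.off_res hS ((hQ m).cycle.res_eq _) h5.le
      · exact absurd (hQ.inj ((congrFun hk₁ j').trans hb)) (by omega)

end

/-! ### Moving a term of the greedy sequence -/

/-- `A'` is obtained from `A` by translating the `k`-th greedy cycle, whose wall is free. -/
def Moves (e ℓ k : ℕ) (A A' : Set ℤ) : Prop :=
  ∃ P : ℕ → ZMod e → ℤ, IsGreedySeq ℓ A P ∧ Adm ℓ (A \ Set.range (P k)) (P k) ∧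
    A' = (A \ Set.range (P k)) ∪ Set.range (sh ℓ (P k))

section
variable {e ℓ k k' : ℕ} {i : ZMod e} {S A A' A'' A₁ : Set ℤ} {b c : ZMod e → ℤ}

theorem Moves.unique (h : Moves e ℓ k A A') (h' : Moves e ℓ k A A'') : A' = A'' := by
  obtain ⟨P, hP, -, rfl⟩ := h
  obtain ⟨Q, hQ, -, rfl⟩ := h'
  rw [hP.unique hQ]

/-- Take the index just after one where `b` is greatest: the entry there is at most that maximum,
and the translate is the maximum plus `ℓ`. -/
theorem exists_lt_sh [NeZero e] [NeZero ℓ] (b : ZMod e → ℤ) :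
    ∃ j, b j < sh ℓ b j := by
  obtain ⟨j, hj⟩ := Finite.exists_max b
  refine ⟨j + 1, ?_⟩
  have h : (0 : ℤ) < ℓ := by exact_mod_cast Nat.pos_of_ne_zero (NeZero.ne ℓ)
  have := hj (j + 1)
  simp only [sh, add_sub_cancel_right]
  omega

theorem Moves.index_unique [NeZero e] [NeZero ℓ] (h : Moves e ℓ k A A')
    (h' : Moves e ℓ k' A A') : k = k' := by
  have key : ∀ {k k'}, Moves e ℓ k A A' → Moves e ℓ k' A A' → ¬ k < k' := by
    intro k k' h h' hlt
    obtain ⟨P, hP, ha, h1⟩ := h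
    obtain ⟨Q, hQ, ha', h2⟩ := h'
    obtain rfl := hP.unique hQ
    obtain ⟨j, hj⟩ := exists_lt_sh (ℓ := ℓ) (P k')
    have hm : P k' j ∈ A' := by
      rw [h1]
      refine Or.inl ⟨hP.mem k' j, ?_⟩
      rintro ⟨j', hj'⟩
      exact hlt.ne (hP.inj hj')
    rw [h2] at hm
    rcases hm with hm | hm
    · exact hm.2 ⟨j, rfl⟩
    · rw [(hP k').cycle.sh.mem_range, (hP k').cycle.res_eq] at hm
      omega
  rcases lt_trichotomy k k' with hlt | heq | hlt
  · exact absurd hlt (key h h')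
  · exact heq
  · exact absurd hlt (key h' h)

theorem Moves.semiinfinite [NeZero e] (h : Moves e ℓ k A A') (hA : Semiinfinite A) :
    Semiinfinite A' := by
  obtain ⟨P, -, -, rfl⟩ := h
  exact (hA.sdiff_finite (Set.finite_range _)).union_finite (Set.finite_range _)

variable [NeZero ℓ] [Fact (1 < e)] [NeZero e]

theorem Adm.exists_moves (ha : Adm ℓ S b) (hS : Semiinfinite (S ∪ Set.range b)) :
    ∃ k, Moves e ℓ k (S ∪ Set.range b) (S ∪ Set.range (sh ℓ b)) := by
  obtain ⟨P, hP⟩ := hS.exists_greedy (e := e) (ℓ := ℓ)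
  obtain ⟨k, hk⟩ := hP.exists_eq ha
  refine ⟨k, P, hP, ?_⟩
  rw [hk, union_sdiff_range ha.disjoint]
  exact ⟨ha, rfl⟩

/-- Moves commute with the crystal operators. -/
theorem Moves.fstep (h : Moves e ℓ k A A') (hA : Semiinfinite A) (hf : FStep ℓ i A A₁) :
    ∃ A₁', FStep ℓ i A' A₁' ∧ Moves e ℓ k A₁ A₁' := by
  have hA₁ := hf.semiinfinite hA
  obtain ⟨P, hP, ha, rfl⟩ := h
  have hd := union_range_sdiff (hP.mem k)
  have hf' := hf
  have hP' := hP
  rw [← hd] at hf' hP'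
  obtain ⟨S₁, b₁, ha₁, rfl, h2, h3, h4⟩ := ha.fstep hf'
  refine ⟨_, h2, ?_⟩
  obtain ⟨Q, hQ⟩ := hA₁.exists_greedy (e := e) (ℓ := ℓ)
  obtain ⟨k₁, hk₁⟩ := hQ.exists_eq ha₁
  obtain rfl := index_eq ha ha₁ hf' h3 h4 hP' hQ rfl hk₁
  refine ⟨Q, hQ, ?_⟩
  rw [hk₁, union_sdiff_range ha₁.disjoint]
  exact ⟨ha₁, rfl⟩

theorem Moves.fstep_target {A₁' : Set ℤ} (h : Moves e ℓ k A A') (hA : Semiinfinite A)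
    (hf : FStep ℓ i A' A₁') : ∃ A₁, FStep ℓ i A A₁ ∧ Moves e ℓ k A₁ A₁' := by
  obtain ⟨P, hP, ha, h'⟩ := id h
  rw [h'] at hf
  obtain ⟨S₁, b₁, ha₁, -, h2⟩ := ha.fstep_sh hf
  rw [union_range_sdiff (hP.mem k)] at h2
  obtain ⟨T, hT, hm⟩ := h.fstep hA h2
  rw [h'] at hT
  obtain rfl := hT.unique hf
  exact ⟨_, h2, hm⟩

/-- The admissible cycle pulled back to `B` has some index `k'` a priori. Following the crystal step
forward again gives a move from `A` to `A'` of index `k'`, and the index of a move is determined by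
its ends. -/
theorem Moves.estep {B : Set ℤ} (h : Moves e ℓ k A A') (hB : Semiinfinite B)
    (hf : FStep ℓ i B A) : ∃ B', FStep ℓ i B' A' ∧ Moves e ℓ k B B' := by
  obtain ⟨P, hP, ha, h'⟩ := id h
  have hf' := hf
  rw [← union_range_sdiff (hP.mem k)] at hf'
  obtain ⟨S₁, b₁, ha₁, rfl, h2⟩ := ha.estep hf'
  obtain ⟨k', hk'⟩ := ha₁.exists_moves hB
  obtain ⟨T, hT, hm⟩ := hk'.fstep hB hf
  rw [← h'] at h2
  obtain rfl := hT.unique h2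
  obtain rfl := h.index_unique hm
  exact ⟨_, h2, hk'⟩

theorem Moves.estep_target {B' : Set ℤ} (h : Moves e ℓ k A A') (hA : Semiinfinite A)
    (hf : FStep ℓ i B' A') : ∃ B, FStep ℓ i B A ∧ Moves e ℓ k B B' := by
  obtain ⟨P, hP, ha, h'⟩ := id h
  have hf' := hf
  rw [h'] at hf'
  obtain ⟨S₁, b₁, ha₁, rfl, h2⟩ := ha.estep_sh hf'
  rw [union_range_sdiff (hP.mem k)] at h2
  have hB : Semiinfinite (S₁ ∪ Set.range b₁) := by
    obtain ⟨x, -, hx⟩ := FStep_iff_cogood.1 h2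
    rw [hx]
    exact (hA.sdiff_finite (Set.finite_singleton _)).union_finite (Set.finite_singleton _)
  obtain ⟨k', hk'⟩ := ha₁.exists_moves hB
  obtain ⟨T, hT, hm⟩ := hk'.fstep hB h2
  obtain rfl := hT.unique hf
  obtain rfl := h.index_unique hm
  exact ⟨_, h2, hk'⟩

end

/-! ### Highest weight vertices for the affine crystal -/

section
variable {e ℓ : ℕ} {i : ZMod e} {S A : Set ℤ} {b : ZMod e → ℤ} {P : ℕ → ZMod e → ℤ}

/-- The potentials of `S` are eventually maximal: all `-` of the `i`-signature are cancelled. -/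
def Dominated (ℓ : ℕ) (i : ZMod e) (S : Set ℤ) : Prop :=
  ∀ h, IsPotential ℓ i S h → ∃ N, ∀ y, ∀ n ≥ N, h y ≤ h n

/-- A potential is constant far to the left and far to the right, so it attains its maximum. If the
final value were smaller, the last point of maximum would be a position where the inverse operator
acts. -/
theorem dominated_of_not_cogood (hA : Semiinfinite A) (hx : ∀ x, ¬ CoGood ℓ i A x) :
    Dominated ℓ i A := by
  intro h hh
  obtain ⟨⟨lo, hlo⟩, ⟨hi, hhi⟩⟩ := hA
  have hR : ∀ n ≥ hi, h n = h hi := by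
    intro n hn
    induction n, hn using Int.leInduction with
    | base => rfl
    | succ n hn ih =>
      rw [hh, ih, add_eq_left]
      have h1 : n ∉ A := fun h => by have := hhi _ h; omega
      have h2 : n + ℓ ∉ A := fun h => by have := hhi _ h; omega
      simp [wt, h1, h2]
  have hL : ∀ n ≤ lo - ℓ, h n = h (lo - ℓ) := by
    intro n hn
    induction n, hn using Int.leInductionDown with
    | base => rfl
    | pred n hn ih =>
      have := hh (n - 1)
      rw [sub_add_cancel, ih] at this
      have h1 : n - 1 ∈ A := hlo _ (by omega)
      have h2 : n - 1 + ℓ ∈ A := hlo _ (by omega)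
      simp [wt, h1, h2] at this
      exact this.symm
  by_contra! hN
  obtain ⟨y₀, n₀, hn₀, hy₀⟩ := hN hi
  rw [hR n₀ hn₀] at hy₀
  obtain ⟨y₁, hy₁, hmax⟩ := Finset.exists_max_image (insert y₀ (Finset.Icc (lo - ℓ) hi)) h
    ⟨y₀, by simp⟩
  have hmax' : ∀ y, h y ≤ h y₁ := by
    intro y
    rcases lt_or_ge y (lo - ℓ) with h1 | h1
    · rw [hL y h1.le]
      by_cases h2 : lo - ℓ ≤ hi
      · exact hmax _ (by simp [h2])
      · rw [hR _ (by omega)]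
        exact hy₀.le.trans (hmax _ (by simp))
    · rcases le_or_gt y hi with h2 | h2
      · exact hmax _ (by simp [h1, h2])
      · rw [hR y h2.le]; exact hy₀.le.trans (hmax _ (by simp))
  have hlt : h hi < h y₁ := hy₀.trans_le (hmax _ (by simp))
  obtain ⟨x, hxe, hxm⟩ := Int.exists_greatest_of_bdd (P := fun y => h y = h y₁)
    ⟨hi, fun z hz => by
      by_contra! h1
      rw [hR z h1.le] at hz
      omega⟩ ⟨y₁, rfl⟩
  refine hx x ⟨h, hh, fun y hy => ?_, fun y => ?_⟩
  · rw [hxe]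
    refine lt_of_le_of_ne (hmax' y) fun h1 => ?_
    have := hxm y h1
    omega
  · rw [hxe]; exact hmax' y

variable [NeZero ℓ]

theorem Adm.dominated (ha : Adm ℓ S b) (hd : Dominated ℓ i (S ∪ Set.range b)) :
    Dominated ℓ i S := by
  intro h hh
  obtain ⟨N, hN⟩ := hd _ (hh.union_cycle ha.cycle ha.notMem)
  refine ⟨max N (b i + 1), fun y n hn => ?_⟩
  have key : ∀ y, ¬ (b (i + 1) - ℓ < y ∧ y ≤ b i) → h y ≤ h n := fun y hy => by
    have := hN y n (by omega)
    rwa [if_neg hy, if_neg (by omega), sub_zero, sub_zero] at this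
  by_cases hy : b (i + 1) - ℓ < y ∧ y ≤ b i
  · exact (ha.mono hh hy.1.le (by omega) le_rfl).trans (key _ (by omega))
  · exact key y hy

/-- If `n - ℓ` is not in `S`, it carries a `-`. Without a `+` to its right the potential would never
climb back to its value at `n - ℓ`. -/
theorem Dominated.exists_mem (hd : Dominated ℓ i S) {n : ℤ} (hn : n ∈ S)
    (hr : res e ℓ n = i + 1) : ∃ p ∈ S, res e ℓ p = i ∧ n - ℓ ≤ p := by
  by_contra! hno
  obtain ⟨h, hh⟩ := exists_potential ℓ i S
  obtain ⟨N, hN⟩ := hd h hh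
  have hr' : res e ℓ (n - ℓ) = i := by rw [res_sub, hr, add_sub_cancel_right]
  have hstep : ∀ z ≥ n - ℓ, h (z + 1) ≤ h z := by
    intro z hz
    have h1 := hh z
    have : wt ℓ i S z ≤ 0 := by
      by_contra! hpos
      obtain ⟨h2, h3, -⟩ := wt_pos hpos
      have := hno z h3 h2
      omega
    omega
  have hanti : ∀ z ≥ n - ℓ + 1, h z ≤ h (n - ℓ + 1) := by
    intro z hz
    induction z, hz using Int.leInduction with
    | base => rfl
    | succ z hz ih => exact (hstep z (by omega)).trans ih
  have h1 := hh (n - ℓ)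
  have hnot : n - ℓ ∉ S := fun hm => by
    have := hno _ hm hr'
    omega
  simp only [wt, hr', hnot, sub_add_cancel, hn, if_true, if_false] at h1
  have h2 := hN (n - ℓ) (max N (n - ℓ + 1)) (le_max_left _ _)
  have h3 := hanti (max N (n - ℓ + 1)) (le_max_right _ _)
  omega

/-- The cycle consists of the greatest elements of the residue classes. `Dominated.exists_mem` shows
both that no class is empty and that consecutive maxima satisfy the cycle inequality. -/
theorem exists_max_cycle [NeZero e] (hd : ∀ i : ZMod e, Dominated ℓ i S)
    (hb : ∃ hi : ℤ, ∀ n ∈ S, n < hi) (hne : S.Nonempty) :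
    ∃ M : ZMod e → ℤ, IsCycle ℓ M ∧ (∀ i, M i ∈ S) ∧ ∀ n ∈ S, n ≤ M (res e ℓ n) := by
  obtain ⟨hi, hhi⟩ := hb
  obtain ⟨n₀, hn₀⟩ := hne
  have hex : ∀ i : ZMod e, ∃ n ∈ S, res e ℓ n = i := fun i =>
    cyclic_induction' (p := fun i => ∃ n ∈ S, res e ℓ n = i) (fun j ⟨n, hn, hr⟩ => by
      obtain ⟨p, hp, hp', -⟩ := (hd (j - 1)).exists_mem hn (by rw [hr, sub_add_cancel])
      exact ⟨p, hp, hp'⟩) (i := res e ℓ n₀) ⟨n₀, hn₀, rfl⟩ i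
  have hmax : ∀ i : ZMod e, ∃ n, (n ∈ S ∧ res e ℓ n = i) ∧
      ∀ m, (m ∈ S ∧ res e ℓ m = i) → m ≤ n := fun i => by
    obtain ⟨n, hn, hr⟩ := hex i
    exact Int.exists_greatest_of_bdd (P := fun n => n ∈ S ∧ res e ℓ n = i)
      ⟨hi, fun z hz => (hhi z hz.1).le⟩ ⟨n, hn, hr⟩
  choose M hM hM' using hmax
  refine ⟨M, ⟨fun i => (hM i).2, fun i => ?_⟩, fun i => (hM i).1, fun n hn => hM' _ n ⟨hn, rfl⟩⟩
  obtain ⟨p, hp, hr, hle⟩ := (hd i).exists_mem (hM (i + 1)).1 (hM (i + 1)).2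
  have := hM' i p ⟨hp, hr⟩
  omega

variable [Fact (1 < e)] [NeZero e]

omit [NeZero e] in
theorem IsGreedySeq.dominated (hP : IsGreedySeq ℓ A P) (hd : Dominated ℓ i A) (k : ℕ) :
    Dominated ℓ i (rest A P k) := by
  induction k with
  | zero => rwa [rest_zero]
  | succ k ih =>
    rw [rest_succ]
    refine (hP k).adm.dominated ?_
    rwa [union_range_sdiff (hP k).mem]

theorem IsGreedySeq.le_of_dominated (hP : IsGreedySeq ℓ A P) (hA : Semiinfinite A)
    (hd : ∀ i : ZMod e, Dominated ℓ i A) {k : ℕ} {n : ℤ} (hn : n ∈ rest A P k) :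
    n ≤ P k (res e ℓ n) := by
  obtain ⟨hi, hhi⟩ := hA.bdd
  obtain ⟨M, h1, h2, h3⟩ := exists_max_cycle (fun i => hP.dominated (hd i) k)
    ⟨hi, fun n hn => hhi n hn.1⟩ ⟨n, hn⟩
  exact (h3 n hn).trans ((hP k).ge M h1 h2 _)

/-- An element never removed would be bounded by the greedy entries of its residue, which tend to
`-∞`. -/
theorem IsGreedySeq.iUnion_of_dominated (hP : IsGreedySeq ℓ A P) (hA : Semiinfinite A)
    (hd : ∀ i : ZMod e, Dominated ℓ i A) : A = ⋃ k, Set.range (P k) := by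
  ext n
  simp only [Set.mem_iUnion]
  constructor
  · intro hn
    by_contra! h
    obtain ⟨k, hk⟩ := hP.exists_le (n - 1) (res e ℓ n)
    have := hP.le_of_dominated hA hd (k := k) ⟨hn, fun m _ => h m⟩
    omega
  · rintro ⟨k, j, rfl⟩
    exact hP.mem k j

end

/-! ### Decreasing families of cycles -/

/-- The translate of a cycle by `t` columns to the right. -/
def shn {e : ℕ} (ℓ : ℕ) (t : ℕ) (b : ZMod e → ℤ) : ZMod e → ℤ := fun i => b (i - t) + t * ℓ

/-- A pointwise strictly decreasing sequence of cycles. -/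
structure IsFamily {e : ℕ} (ℓ : ℕ) (R : ℕ → ZMod e → ℤ) : Prop where
  cycle : ∀ k, IsCycle ℓ (R k)
  lt : ∀ k j, R (k + 1) j < R k j

section
variable {e ℓ k : ℕ} {A A' : Set ℤ} {b c : ZMod e → ℤ} {R P : ℕ → ZMod e → ℤ} {t : ℕ → ℕ}

theorem shn_zero : shn ℓ 0 b = b := by funext j; simp [shn]

theorem sh_shn {t : ℕ} : sh ℓ (shn ℓ t b) = shn ℓ (t + 1) b := by
  funext j
  simp only [sh, shn]
  rw [show j - 1 - (t : ZMod e) = j - ((t + 1 : ℕ) : ZMod e) by push_cast; ring]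
  push_cast; ring

theorem shn_add {s t : ℕ} : shn ℓ s (shn ℓ t b) = shn ℓ (s + t) b := by
  funext j
  simp only [shn]
  rw [show j - (s : ZMod e) - t = j - ((s + t : ℕ) : ZMod e) by push_cast; ring]
  push_cast; ring

theorem shn_lt {t : ℕ} (h : ∀ j, b j < c j) (j : ZMod e) : shn ℓ t b j < shn ℓ t c j := by
  have := h (j - t)
  simp only [shn]; omega

theorem lt_of_shn_lt {t : ℕ} (h : ∀ j, shn ℓ t b j < shn ℓ t c j) (j : ZMod e) : b j < c j := by
  have := h (j + t)
  simp only [shn, add_sub_cancel_right] at this; omega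

theorem IsCycle.shn [NeZero ℓ] (hb : IsCycle ℓ b) (t : ℕ) : IsCycle ℓ (shn ℓ t b) := by
  induction t with
  | zero => rwa [shn_zero]
  | succ t ih => rw [← sh_shn]; exact ih.sh

theorem IsCycle.shn_le [NeZero ℓ] (hb : IsCycle ℓ b) {s t : ℕ} (h : s ≤ t) :
    AbacusCrystal.shn ℓ s b ≤ AbacusCrystal.shn ℓ t b := by
  induction t, h using Nat.le_induction with
  | base => rfl
  | succ t _ ih => rw [← sh_shn]; exact ih.trans (hb.shn t).le_sh

theorem IsGreedySeq.isFamily (hP : IsGreedySeq ℓ A P) : IsFamily ℓ P :=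
  ⟨fun k => (hP k).cycle, fun k => hP.lt (Nat.lt_add_one k)⟩

namespace IsFamily

theorem lt' (hR : IsFamily ℓ R) {m k : ℕ} (h : m < k) (j : ZMod e) : R k j < R m j := by
  induction k, h using Nat.le_induction with
  | base => exact hR.lt m j
  | succ p _ ih => exact (hR.lt p j).trans ih

theorem le' (hR : IsFamily ℓ R) {m k : ℕ} (h : m ≤ k) (j : ZMod e) : R k j ≤ R m j := by
  rcases h.eq_or_lt with rfl | h
  · rfl
  · exact (hR.lt' h j).le

/-- Within one residue class the elements of the union are the entries of the family in decreasing
order. After removal of the first `k` members, what remains in each class is at most the entry of `R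
k`. -/
theorem greedy (hR : IsFamily ℓ R) : IsGreedySeq ℓ (⋃ k, Set.range (R k)) R := by
  intro k
  refine ⟨hR.cycle k, fun j => ⟨Set.mem_iUnion.2 ⟨k, j, rfl⟩, fun m hm => ?_⟩, fun z hz h j => ?_⟩
  · rintro ⟨j', hj'⟩
    have : j' = j := by rw [← (hR.cycle m).res_eq j', hj', (hR.cycle k).res_eq]
    subst this
    exact (hR.lt' hm j').ne hj'.symm
  · obtain ⟨h1, h2⟩ := h j
    obtain ⟨m, j', hj'⟩ := Set.mem_iUnion.1 h1
    have : j' = j := by rw [← (hR.cycle m).res_eq j', hj', hz.res_eq]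
    subst this
    have hmk : k ≤ m := by
      by_contra! hlt
      exact h2 m hlt ⟨j', hj'⟩
    rw [← hj']
    exact hR.le' hmk j'

theorem iUnion_update (hR : IsFamily ℓ R) (k : ℕ) (c : ZMod e → ℤ) :
    ⋃ m, Set.range (Function.update R k c m) =
      ((⋃ m, Set.range (R m)) \ Set.range (R k)) ∪ Set.range c := by
  have hg := hR.greedy
  ext n
  simp only [Set.mem_iUnion, Set.mem_union, Set.mem_sdiff]
  constructor
  · rintro ⟨m, j, rfl⟩
    by_cases hm : m = k
    · subst hm; exact Or.inr ⟨j, by simp⟩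
    · rw [Function.update_of_ne hm]
      exact Or.inl ⟨⟨m, j, rfl⟩, fun ⟨j', hj'⟩ => hm (hg.inj hj').symm⟩
  · rintro (⟨⟨m, j, rfl⟩, h⟩ | ⟨j, rfl⟩)
    · have hm : m ≠ k := by rintro rfl; exact h ⟨j, rfl⟩
      exact ⟨m, j, by rw [Function.update_of_ne hm]⟩
    · exact ⟨k, j, by simp⟩

variable [NeZero ℓ]

omit [NeZero ℓ] in
-- An element in the wall or in front of it belongs to an earlier member, and the updated family
-- requires that member to lie strictly in front of the translate.
theorem adm_of_update (hR : IsFamily ℓ R)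
    (hR' : IsFamily ℓ (Function.update R k (sh ℓ (R k)))) :
    Adm ℓ ((⋃ m, Set.range (R m)) \ Set.range (R k)) (R k) := by
  refine ⟨hR.cycle k, fun n ⟨hn, hnk⟩ hle => ?_⟩
  obtain ⟨m, j, rfl⟩ := Set.mem_iUnion.1 hn
  rw [(hR.cycle m).res_eq] at hle ⊢
  have hmk : m < k := by
    by_contra! h
    rcases h.eq_or_lt with rfl | h
    · exact hnk ⟨j, rfl⟩
    · have := hR.lt' h j
      omega
  have := hR'.lt' hmk j
  rwa [Function.update_self, Function.update_of_ne hmk.ne] at this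

omit [NeZero ℓ] in
theorem moves_of_update (hR : IsFamily ℓ R)
    (hR' : IsFamily ℓ (Function.update R k (sh ℓ (R k)))) :
    Moves e ℓ k (⋃ m, Set.range (R m))
      (⋃ m, Set.range (Function.update R k (sh ℓ (R k)) m)) :=
  ⟨R, hR.greedy, hR.adm_of_update hR', hR.iUnion_update k _⟩

theorem update_of_moves (hR : IsFamily ℓ R) (h : Moves e ℓ k (⋃ m, Set.range (R m)) A') :
    IsFamily ℓ (Function.update R k (sh ℓ (R k))) ∧
      A' = ⋃ m, Set.range (Function.update R k (sh ℓ (R k)) m) := by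
  obtain ⟨P, hP, ha, rfl⟩ := h
  obtain rfl := hP.unique hR.greedy
  refine ⟨⟨fun m => ?_, fun m j => ?_⟩, (hR.iUnion_update k _).symm⟩
  · by_cases hm : m = k
    · subst hm; rw [Function.update_self]; exact (hR.cycle m).sh
    · rw [Function.update_of_ne hm]; exact hR.cycle m
  · by_cases hm : m = k
    · subst hm
      rw [Function.update_self, Function.update_of_ne (by omega)]
      exact (hR.lt m j).trans_le ((hR.cycle m).le_pred j)
    · by_cases hm' : m + 1 = k
      · subst hm'
        rw [Function.update_self, Function.update_of_ne hm]
        refine ha.off_res ⟨Set.mem_iUnion.2 ⟨m, j, rfl⟩, ?_⟩ ((hR.cycle m).res_eq j) (hR.lt m j).le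
        rintro ⟨j', hj'⟩
        exact absurd (hP.inj hj') (by omega)
      · rw [Function.update_of_ne hm, Function.update_of_ne hm']; exact hR.lt m j

theorem shn_antitone (hR : IsFamily ℓ R) (ht : Antitone t) :
    IsFamily ℓ (fun k => shn ℓ (t k) (R k)) :=
  ⟨fun k => (hR.cycle k).shn _, fun k j =>
    ((hR.cycle (k + 1)).shn_le (ht (Nat.le_succ k)) j).trans_lt (shn_lt (hR.lt k) j)⟩

/-- If no cycle of the family can be moved to the left, the translations which keep it decreasing
are given by partitions. -/
theorem antitone_of_shn (hR : IsFamily ℓ R)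
    (hmin : ∀ k, ¬ IsFamily ℓ (Function.update R k (unsh ℓ (R k))))
    (ht : IsFamily ℓ (fun k => shn ℓ (t k) (R k))) : Antitone t := by
  refine antitone_nat_of_succ_le fun k => ?_
  by_contra! hlt
  obtain ⟨d, hd⟩ := Nat.exists_eq_add_of_lt hlt
  -- Undo a translation by `t (k + 1)` on both sides. Since `t (k + 1) > t k`, the translate of `R
  -- k` by `t k` is at most that of `unsh (R k)` by `t (k + 1)`; so `R k` could have been moved
  -- left.
  have h1 : ∀ j, R (k + 1) j < unsh ℓ (R k) j := by
    refine lt_of_shn_lt (t := t (k + 1)) (ℓ := ℓ) fun j => (ht.lt k j).trans_le ?_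
    rw [hd]
    have h2 := (((hR.cycle k).unsh.shn_le (Nat.le_add_left (t k + 1) d))) j
    rw [← sh_shn, show AbacusCrystal.sh ℓ (AbacusCrystal.shn ℓ (t k) (unsh ℓ (R k))) =
      AbacusCrystal.shn ℓ (t k) (R k) by
        rw [sh_shn, ← shn_add, ← sh_shn, shn_zero, sh_unsh] ] at h2
    rwa [show t k + d + 1 = d + (t k + 1) by ring]
  refine hmin k ⟨fun m => ?_, fun m j => ?_⟩
  · by_cases hm : m = k
    · subst hm; rw [Function.update_self]; exact (hR.cycle m).unsh
    · rw [Function.update_of_ne hm]; exact hR.cycle m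
  · by_cases hm : m = k
    · subst hm
      rw [Function.update_self, Function.update_of_ne (by omega)]
      exact h1 j
    · by_cases hm' : m + 1 = k
      · subst hm'
        rw [Function.update_self, Function.update_of_ne hm]
        exact ((hR.cycle _).unsh_le j).trans_lt (hR.lt m j)
      · rw [Function.update_of_ne hm, Function.update_of_ne hm']; exact hR.lt m j

end IsFamily

end

/-! ### Codes of positions -/

section
variable {ℓ : ℕ} [NeZero ℓ]

/-- Positions are numbered by the integers, in increasing order. -/
def code : Pos ℓ ≃ ℤ where
  toFun x := x.1 * ℓ + (ℓ - 1 - (x.2 : ℕ))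
  invFun n := (n / ℓ, ⟨(ℓ - 1 - n % ℓ).toNat, by
    have h : (0 : ℤ) < ℓ := by exact_mod_cast Nat.pos_of_ne_zero (NeZero.ne ℓ)
    have := Int.emod_nonneg n h.ne'
    omega⟩)
  left_inv x := by
    have h : (0 : ℤ) < ℓ := by exact_mod_cast Nat.pos_of_ne_zero (NeZero.ne ℓ)
    have h2 := x.2.isLt
    have hd : (x.1 * ℓ + (ℓ - 1 - ((x.2 : ℕ) : ℤ))) / (ℓ : ℤ) = x.1 := by
      rw [Int.ediv_eq_iff_of_pos h]; constructor <;> nlinarith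
    have hm := Int.emod_add_mul_ediv (x.1 * ℓ + (ℓ - 1 - ((x.2 : ℕ) : ℤ))) ℓ
    rw [hd] at hm
    ext
    · exact hd
    · simp only
      have : (ℓ : ℤ) * x.1 = x.1 * ℓ := mul_comm _ _
      omega
  right_inv n := by
    have h : (0 : ℤ) < ℓ := by exact_mod_cast Nat.pos_of_ne_zero (NeZero.ne ℓ)
    have h1 := Int.emod_nonneg n h.ne'
    have h2 := Int.emod_lt_of_pos n h
    have h3 := Int.emod_add_mul_ediv n ℓ
    have : (ℓ : ℤ) * (n / ℓ) = n / ℓ * ℓ := mul_comm _ _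
    dsimp only
    omega

theorem code_apply (x : Pos ℓ) : code x = x.1 * ℓ + (ℓ - 1 - (x.2 : ℕ)) := rfl

theorem code_ediv (x : Pos ℓ) : code x / ℓ = x.1 :=
  congrArg Prod.fst (code.symm_apply_apply x)

theorem code_symm_fst (n : ℤ) : (code.symm n : Pos ℓ).1 = n / ℓ := rfl

theorem res_code (e : ℕ) (x : Pos ℓ) : res e ℓ (code x) = (x.1 : ZMod e) := by
  rw [res, code_ediv]

theorem code_lt_iff {x y : Pos ℓ} : code x < code y ↔ PosLT x y := by
  have h1 := x.2.isLt
  have h2 := y.2.isLt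
  rw [PosLT, code_apply, code_apply, Fin.lt_def]
  rcases lt_trichotomy x.1 y.1 with h | h | h
  · have : (x.1 + 1) * (ℓ : ℤ) ≤ y.1 * ℓ := mul_le_mul_of_nonneg_right (by omega) (by omega)
    simp only [h, true_or, iff_true]
    linarith
  · rw [h]; simp only [lt_irrefl, false_or, true_and]; omega
  · have : (y.1 + 1) * (ℓ : ℤ) ≤ x.1 * ℓ := mul_le_mul_of_nonneg_right (by omega) (by omega)
    simp only [h.not_gt, h.ne', false_or, false_and, iff_false, not_lt]
    linarith

theorem code_add (x : Pos ℓ) (t : ℤ) : code (x.1 + t, x.2) = code x + t * ℓ := by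
  simp only [code_apply]; ring

theorem code_right (x : Pos ℓ) : code (x.1 + 1, x.2) = code x + ℓ := by
  rw [code_add, one_mul]

theorem code_lt_of_fst_lt {x y : Pos ℓ} (h : x.1 < y.1) : code x < code y :=
  code_lt_iff.2 (Or.inl h)

theorem code_le_code {x y : Pos ℓ} (h : x.1 = y.1) : code x ≤ code y ↔ y.2 ≤ x.2 := by
  rw [code_apply, code_apply, h, Fin.le_def]; omega

theorem code_lt_code {x y : Pos ℓ} (h : x.1 = y.1) : code x < code y ↔ y.2 < x.2 := by
  rw [code_apply, code_apply, h, Fin.lt_def]; omega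

theorem fst_le_of_code_le {x y : Pos ℓ} (h : code x ≤ code y) : x.1 ≤ y.1 := by
  by_contra! hlt
  exact (code_lt_of_fst_lt hlt).not_ge h

/-- The set of codes of the beads of an abacus. -/
def codes (S : Set (Pos ℓ)) : Set ℤ := {n | code.symm n ∈ S}

theorem code_mem_codes {S : Set (Pos ℓ)} {x : Pos ℓ} : code x ∈ codes S ↔ x ∈ S := by
  show code.symm (code x) ∈ S ↔ _
  rw [code.symm_apply_apply]

theorem mem_codes {S : Set (Pos ℓ)} {n : ℤ} : n ∈ codes S ↔ code.symm n ∈ S := Iff.rfl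

theorem codes_injective {S T : Set (Pos ℓ)} (h : codes S = codes T) : S = T := by
  ext x; rw [← code_mem_codes, h, code_mem_codes]

theorem codes_union {S T : Set (Pos ℓ)} : codes (S ∪ T) = codes S ∪ codes T := rfl

theorem codes_sdiff {S T : Set (Pos ℓ)} : codes (S \ T) = codes S \ codes T := rfl

theorem codes_singleton {x : Pos ℓ} : codes {x} = {code x} := by
  ext n; simp [mem_codes, Equiv.symm_apply_eq]

theorem Abacus.semiinfinite (A : Abacus ℓ) : Semiinfinite (codes A.beads) := by
  have h : (0 : ℤ) < ℓ := by exact_mod_cast Nat.pos_of_ne_zero (NeZero.ne ℓ)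
  obtain ⟨lo, hlo⟩ := A.full_left
  obtain ⟨hi, hhi⟩ := A.empty_right
  refine ⟨⟨lo * ℓ, fun n hn => hlo _ ?_ _⟩, ⟨hi * ℓ, fun n hn => ?_⟩⟩
  · exact Int.ediv_le_of_le_mul h hn
  · by_contra! hle
    exact hhi _ ((Int.le_ediv_iff_mul_le h).2 hle) _ hn

/-- The abacus with a given semi-infinite set of codes. -/
def abacusOf (S : Set ℤ) (hS : Semiinfinite S) : Abacus ℓ where
  beads := {x | code x ∈ S}
  full_left := by
    have h : (0 : ℤ) < ℓ := by exact_mod_cast Nat.pos_of_ne_zero (NeZero.ne ℓ)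
    obtain ⟨lo, hlo⟩ := hS.full
    refine ⟨lo / ℓ - 1, fun β hβ j => hlo _ ?_⟩
    have h1 := Int.ediv_mul_le lo h.ne'
    have h2 : (β + 1) * (ℓ : ℤ) ≤ lo / ℓ * ℓ := mul_le_mul_of_nonneg_right (by omega) h.le
    rw [code_apply]
    dsimp only
    linarith [j.isLt]
  empty_right := by
    have h : (0 : ℤ) < ℓ := by exact_mod_cast Nat.pos_of_ne_zero (NeZero.ne ℓ)
    obtain ⟨hi, hhi⟩ := hS.bdd
    refine ⟨hi / ℓ + 1, fun β hβ j hm => ?_⟩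
    have h1 := hhi _ hm
    have h2 := Int.lt_ediv_add_one_mul_self hi h
    have h3 : (hi / ℓ + 1) * (ℓ : ℤ) ≤ β * ℓ := mul_le_mul_of_nonneg_right (by omega) h.le
    rw [code_apply] at h1
    dsimp only at h1
    have := j.isLt
    have : ((j : ℕ) : ℤ) + 1 ≤ ℓ := by exact_mod_cast this
    linarith

theorem codes_abacusOf (S : Set ℤ) (hS : Semiinfinite S) :
    codes (abacusOf (ℓ := ℓ) S hS).beads = S := by
  ext n
  show code (code.symm n) ∈ S ↔ _
  rw [code.apply_symm_apply]

theorem Abacus.ext_codes {A B : Abacus ℓ} (h : codes A.beads = codes B.beads) : A = B :=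
  Abacus.ext (codes_injective h)

end

/-! ### Quasiperiods and cycles -/

section
variable {e ℓ : ℕ} {S T : Set (Pos ℓ)} {p q : Fin e → Pos ℓ}

theorem IsQuasiperiod.mono (h : IsQuasiperiod e S p) (hT : ∀ i, p i ∈ T) : IsQuasiperiod e T p :=
  ⟨hT, h.2⟩

variable [NeZero e]

theorem IsQuasiperiod.fst_eq (h : IsQuasiperiod e S p) (i : Fin e) : (p i).1 = (p 0).1 - i := by
  obtain ⟨n, hn⟩ := i
  induction n with
  | zero => have : (⟨0, hn⟩ : Fin e) = 0 := rfl
            simp [this]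
  | succ n ih =>
    have h1 := ih (by omega)
    have h2 := (h.2 ⟨n, by omega⟩ ⟨n + 1, hn⟩ rfl).1
    rw [h2, h1]; push_cast; ring

omit [NeZero e] in
theorem IsQuasiperiod.snd_le (h : IsQuasiperiod e S p) {i j : Fin e} (hij : i ≤ j) :
    (p j).2 ≤ (p i).2 := by
  obtain ⟨i, hi⟩ := i
  obtain ⟨n, hn⟩ := j
  rw [Fin.mk_le_mk] at hij
  induction n, hij using Nat.le_induction with
  | base => rfl
  | succ n hin ih => exact (h.2 ⟨n, by omega⟩ ⟨n + 1, hn⟩ rfl).2.trans (ih (by omega))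

/-- The index in a quasiperiod of the bead of residue `j`. -/
def beadIndex (p : Fin e → Pos ℓ) (j : ZMod e) : Fin e := ⟨((p 0).1 - j : ZMod e).val, ZMod.val_lt _⟩

theorem IsQuasiperiod.cast_beadIndex (h : IsQuasiperiod e S p) (j : ZMod e) :
    ((p (beadIndex p j)).1 : ZMod e) = j := by
  rw [h.fst_eq]
  simp [beadIndex]

theorem IsQuasiperiod.beadIndex_cast (h : IsQuasiperiod e S p) (i : Fin e) :
    beadIndex p ((p i).1 : ZMod e) = i := by
  rw [h.fst_eq]
  ext
  simp [beadIndex, ZMod.val_natCast, Nat.mod_eq_of_lt i.isLt]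

variable [NeZero ℓ]

/-- The codes of the beads of a quasiperiod, indexed by their residues. -/
def cyc (p : Fin e → Pos ℓ) : ZMod e → ℤ := fun j => code (p (beadIndex p j))

theorem IsQuasiperiod.cyc_cast (h : IsQuasiperiod e S p) (i : Fin e) :
    cyc p ((p i).1 : ZMod e) = code (p i) := by rw [cyc, h.beadIndex_cast]

theorem IsQuasiperiod.range_cyc (h : IsQuasiperiod e S p) :
    Set.range (cyc p) = codes (Set.range p) := by
  ext n
  constructor
  · rintro ⟨j, rfl⟩
    exact code_mem_codes.2 ⟨_, rfl⟩
  · rintro ⟨i, hi⟩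
    exact ⟨_, by rw [h.cyc_cast i, hi, code.apply_symm_apply]⟩

theorem IsQuasiperiod.isCycle (h : IsQuasiperiod e S p) : IsCycle ℓ (cyc p) where
  res_eq j := by rw [cyc, res_code, h.cast_beadIndex]
  succ_le j := by
    have hr : code (p (beadIndex p j)) + ℓ = code ((p (beadIndex p j)).1 + 1, (p (beadIndex p j)).2) :=
      (code_right _).symm
    rw [cyc, cyc, hr]
    have h1 := h.fst_eq (beadIndex p j)
    have h2 := h.fst_eq (beadIndex p (j + 1))
    -- The wrap-around case: `j` is the residue of the first bead and `j + 1` that of the last,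
    -- which is `e - 1` columns further left. The inequality then says nothing about rows.
    by_cases hj : ((p 0).1 - j : ZMod e) = 0
    · have h3 : ((beadIndex p j : Fin e) : ℕ) = 0 := by simp [beadIndex, hj]
      refine (code_lt_of_fst_lt ?_).le
      dsimp only
      rw [h1, h2, h3]
      push_cast
      omega
    · have h3 : ((beadIndex p j : Fin e) : ℕ) = (beadIndex p (j + 1) : Fin e) + 1 := by
        simp only [beadIndex]
        have hpos : 0 < ((p 0).1 - j : ZMod e).val := by
          rw [Nat.pos_iff_ne_zero, Ne, ZMod.val_eq_zero]; exact hj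
        have hcast : ((p 0).1 - (j + 1) : ZMod e) =
            ((((p 0).1 - j : ZMod e).val - 1 : ℕ) : ZMod e) := by
          rw [Nat.cast_sub hpos]; simp; ring
        rw [hcast, ZMod.val_natCast, Nat.mod_eq_of_lt]
        · omega
        · have := ZMod.val_lt ((p 0).1 - j : ZMod e); omega
      have h4 := (h.2 _ _ h3)
      rw [code_le_code]
      · exact h4.2
      · dsimp only; rw [h4.1]; ring

theorem IsQuasiperiod.cyc_mem (h : IsQuasiperiod e S p) (j : ZMod e) : cyc p j ∈ codes S :=
  code_mem_codes.2 (h.1 _)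

theorem IsQuasiperiod.fst_le_of_cyc_le {S : Set (Pos ℓ)} (hp : IsQuasiperiod e S p)
    (hq : IsQuasiperiod e T q) (h : cyc p ≤ cyc q) : (p 0).1 ≤ (q 0).1 := by
  have h1 := h ((p 0).1 : ZMod e)
  rw [hp.cyc_cast 0, cyc] at h1
  have h2 := fst_le_of_code_le h1
  rw [hq.fst_eq] at h2
  omega

theorem IsQuasiperiod.code_le_of_cyc_le (hp : IsQuasiperiod e S p)
    (hq : IsQuasiperiod e T q) (h : cyc p ≤ cyc q) (h0 : (p 0).1 = (q 0).1) (i : Fin e) :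
    code (p i) ≤ code (q i) := by
  have h1 := h ((p i).1 : ZMod e)
  have h2 : (p i).1 = (q i).1 := by rw [hp.fst_eq, hq.fst_eq, h0]
  rwa [hp.cyc_cast i, h2, hq.cyc_cast i] at h1

/-- A pointwise smaller cycle does not start further right. If it starts in the same column, beads
of equal index have equal residue and can be compared, and the first difference decides. -/
theorem IsQuasiperiod.eq_or_qlt (hp : IsQuasiperiod e S p) (hq : IsQuasiperiod e T q)
    (h : cyc p ≤ cyc q) : p = q ∨ QLT p q := by
  classical
  rcases (hp.fst_le_of_cyc_le hq h).lt_or_eq with h0 | h0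
  · exact Or.inr ⟨0, fun m hm => absurd hm (Fin.not_lt_zero m), Or.inl h0⟩
  · by_cases hex : ∃ i, p i ≠ q i
    · right
      obtain ⟨i, hi, hmin⟩ := WellFounded.has_min (wellFounded_lt (α := Fin e)) {i | p i ≠ q i} hex
      refine ⟨i, fun m hm => ?_, ?_⟩
      · by_contra hne
        exact hmin m hne hm
      · rw [← code_lt_iff]
        exact lt_of_le_of_ne (hp.code_le_of_cyc_le hq h h0 i) fun h => hi (code.injective h)
    · push Not at hex
      exact Or.inl (funext hex)

omit [NeZero e] in
theorem QLT.asymm (h : QLT p q) : ¬ QLT q p := by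
  rintro ⟨j, hj, hlt'⟩
  obtain ⟨i, hi, hlt⟩ := h
  rw [← code_lt_iff] at hlt hlt'
  rcases lt_trichotomy i j with h | rfl | h
  · rw [hj i h] at hlt; exact lt_irrefl _ hlt
  · exact lt_asymm hlt hlt'
  · rw [hi j h] at hlt'; exact lt_irrefl _ hlt'

omit [NeZero e] [NeZero ℓ] in
theorem shift_quasiperiod (h : IsQuasiperiod e S p) (t : ℤ) :
    IsQuasiperiod e Set.univ (shift t p) :=
  ⟨fun _ => trivial, fun i i' hi => by
    have := h.2 i i' hi
    exact ⟨by simp only [shift, this.1]; ring, this.2⟩⟩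

theorem cyc_shift (t : ℤ) : cyc (shift t p) = fun j => cyc p (j - t) + t * ℓ := by
  funext j
  have : beadIndex (shift t p) j = beadIndex p (j - t) := by
    ext
    simp only [beadIndex, shift]
    congr 1
    push_cast; ring
  rw [cyc, this, shift, code_add, cyc]

theorem cyc_shift_one : cyc (shift 1 p) = sh ℓ (cyc p) := by
  rw [cyc_shift]; funext j; simp [sh]

theorem cyc_shift_nat (t : ℕ) : cyc (shift (t : ℤ) p) = shn ℓ t (cyc p) := by
  rw [cyc_shift]; funext j; simp [shn]

/-- Every cycle is the cycle of a quasiperiod. -/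
theorem IsCycle.exists_quasiperiod {b : ZMod e → ℤ} (hb : IsCycle ℓ b)
    (hS : ∀ j, b j ∈ codes S) : ∃ p, IsQuasiperiod e S p ∧ cyc p = b := by
  have hℓ : (0 : ℤ) < ℓ := by exact_mod_cast Nat.pos_of_ne_zero (NeZero.ne ℓ)
  -- The first bead of the quasiperiod must be the greatest entry of the cycle; the others follow in
  -- order of decreasing residue.
  obtain ⟨j₀, hj₀⟩ := Finite.exists_max b
  set p : Fin e → Pos ℓ := fun t => code.symm (b (j₀ - (t : ℕ))) with hp
  have hle : ∀ j, (code.symm (b j) : Pos ℓ).1 ≤ (code.symm (b j₀) : Pos ℓ).1 := fun j =>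
    fst_le_of_code_le (by simpa using hj₀ j)
  have hge : ∀ t : ℕ, (code.symm (b j₀) : Pos ℓ).1 - t ≤ (code.symm (b (j₀ - t)) : Pos ℓ).1 := by
    intro t
    induction t with
    | zero => simp
    | succ t ih =>
      have h1 := hb.succ_le (j₀ - (t + 1 : ℕ))
      rw [show j₀ - ((t + 1 : ℕ) : ZMod e) + 1 = j₀ - t by push_cast; ring] at h1
      have h2 : (b (j₀ - t)) / (ℓ : ℤ) ≤ (b (j₀ - (t + 1 : ℕ)) + ℓ) / ℓ := Int.ediv_le_ediv hℓ h1
      have h3 := Int.add_mul_ediv_right (b (j₀ - (t + 1 : ℕ))) 1 hℓ.ne'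
      rw [one_mul] at h3
      rw [h3] at h2
      rw [code_symm_fst] at ih ⊢
      rw [code_symm_fst] at ih ⊢
      push_cast at *
      linarith
  have hfst : ∀ t : Fin e, (p t).1 = (code.symm (b j₀) : Pos ℓ).1 - (t : ℕ) := by
    intro t
    have h1 := hge t
    have h2 := hle (j₀ - (t : ℕ))
    -- The column of bead `t` is between the expected one and that of the first bead, fewer than `e`
    -- columns away, and has the expected residue. So it is the expected one.
    have h3 : (((p t).1 - ((code.symm (b j₀) : Pos ℓ).1 - (t : ℕ)) : ℤ) : ZMod e) = 0 := by
      have h4 := hb.res_eq (j₀ - (t : ℕ))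
      have h5 := hb.res_eq j₀
      rw [res] at h4 h5
      push_cast
      rw [hp, code_symm_fst, code_symm_fst, h4, h5]
      ring
    rw [ZMod.intCast_zmod_eq_zero_iff_dvd] at h3
    have h6 := t.isLt
    have h7 := Int.eq_zero_of_abs_lt_dvd h3 (by
      rw [abs_lt]
      have : (p t).1 = (code.symm (b (j₀ - (t : ℕ))) : Pos ℓ).1 := rfl
      constructor <;> omega)
    omega
  have hq : IsQuasiperiod e S p := by
    refine ⟨fun t => hS _, fun t t' ht => ?_⟩
    have h1 : (p t').1 = (p t).1 - 1 := by rw [hfst, hfst, ht]; push_cast; ring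
    refine ⟨h1, ?_⟩
    have h2 := hb.succ_le (j₀ - (t' : ℕ))
    rw [ht, show j₀ - ((t + 1 : ℕ) : ZMod e) + 1 = j₀ - (t : ℕ) by push_cast; ring, ← ht] at h2
    have h3 : code (p t) ≤ code ((p t').1 + 1, (p t').2) := by
      rw [code_right]
      simpa [hp] using h2
    rwa [code_le_code (by simp [h1])] at h3
  refine ⟨p, hq, ?_⟩
  funext j
  have h1 := hq.isCycle.res_eq j
  rw [cyc] at h1 ⊢
  simp only [hp, code.apply_symm_apply] at h1 ⊢
  rw [hb.res_eq] at h1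
  rw [h1]

end

/-! ### Fore periods and greedy sequences -/

section
variable {e ℓ : ℕ} [NeZero e] [NeZero ℓ] {A A' : Abacus ℓ} {P Q : ℕ → Fin e → Pos ℓ}
  {p q : Fin e → Pos ℓ} {k : ℕ}

omit [NeZero e] [NeZero ℓ] in
theorem IsForeSeq.quasiperiod (h : IsForeSeq e A P) (k : ℕ) : IsQuasiperiod e A.beads (P k) :=
  (h k).1.1

omit [NeZero e] in
theorem IsForeSeq.unique (hP : IsForeSeq e A P) (hQ : IsForeSeq e A Q) : P = Q := by
  funext k
  induction k using Nat.strong_induction_on with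
  | _ k ih =>
    obtain ⟨⟨p1, p2, p3⟩, p4⟩ := hP k
    obtain ⟨⟨q1, q2, q3⟩, q4⟩ := hQ k
    rcases p4 (Q k) q1 (fun i hi => by rw [ih i (by omega)]; exact q2 i hi)
      (fun i hi => by rw [ih i hi]; exact q3 i hi) with h1 | h1
    · exact h1.symm
    · rcases q4 (P k) p1 (fun i hi => by rw [← ih i (by omega)]; exact p2 i hi)
        (fun i hi => by rw [← ih i hi]; exact p3 i hi) with h2 | h2
      · exact h2
      · exact absurd h2 h1.asymm

/-- A competitor disjoint from the earlier terms is a cycle in what remains, so it is pointwise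
below the greedy cycle and therefore lexicographically below it. -/
theorem isForeSeq_of_greedy (hP : ∀ k, IsQuasiperiod e A.beads (P k))
    (hG : IsGreedySeq ℓ (codes A.beads) (fun k => cyc (P k))) : IsForeSeq e A P := by
  intro k
  refine ⟨⟨hP k, fun i hi => ?_, fun i hi => ?_⟩, fun Q hQ _ hd => ?_⟩
  · refine ((hP k).eq_or_qlt (hP i) fun j => (hG.lt (show i < k by omega) j).le).resolve_left
      fun h => ?_
    have := hG.lt (show i < k by omega) 0
    rw [h] at this
    exact lt_irrefl _ this
  · rw [Set.disjoint_left]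
    rintro _ ⟨t, rfl⟩ ⟨t', ht'⟩
    have h1 := (hP k).cyc_cast t
    rw [← ht', ← (hP i).cyc_cast t'] at h1
    exact absurd (hG.inj h1) (by omega)
  · refine hQ.eq_or_qlt (hP k) ((hG k).ge _ hQ.isCycle fun j => ⟨hQ.cyc_mem j, fun m hm => ?_⟩)
    rintro ⟨j', hj'⟩
    exact Set.disjoint_left.1 (hd m hm) ⟨_, rfl⟩ ⟨beadIndex (P m) j', code.injective hj'⟩

variable [Fact (1 < e)]

theorem exists_foreSeq (A : Abacus ℓ) : ∃ P : ℕ → Fin e → Pos ℓ,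
    IsForeSeq e A P ∧ IsGreedySeq ℓ (codes A.beads) (fun k => cyc (P k)) := by
  obtain ⟨G, hG⟩ := A.semiinfinite.exists_greedy (e := e) (ℓ := ℓ)
  have h := fun k => (hG k).cycle.exists_quasiperiod (S := A.beads) (hG.mem k)
  choose P hP hPG using h
  have : (fun k => cyc (P k)) = G := funext hPG
  exact ⟨P, isForeSeq_of_greedy hP (by rwa [this]), by rwa [this]⟩

theorem IsForeSeq.greedy (hP : IsForeSeq e A P) :
    IsGreedySeq ℓ (codes A.beads) (fun k => cyc (P k)) := by
  obtain ⟨Q, hQ, hG⟩ := exists_foreSeq (e := e) A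
  rwa [hP.unique hQ]

end

/-! ### The affine crystal -/

section
variable {e ℓ : ℕ} [NeZero ℓ] {i : ZMod e} {A A' : Abacus ℓ} {x : Pos ℓ} {h : ℤ → ℤ}

theorem isPlus_iff : IsPlus e i A x ↔ 0 < wt ℓ i (codes A.beads) (code x) := by
  constructor
  · rintro ⟨h1, h2, h3⟩
    rw [← code_mem_codes] at h1 h2
    rw [code_right] at h2
    rw [← res_code] at h3
    simp [wt, h1, h2, h3]
  · intro h
    obtain ⟨h1, h2, h3⟩ := wt_pos h
    rw [← code_right] at h3
    exact ⟨code_mem_codes.1 h2, fun h => h3 (code_mem_codes.2 h), by rw [← res_code, h1]⟩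

theorem isMinus_iff : IsMinus e i A x ↔ wt ℓ i (codes A.beads) (code x) < 0 := by
  constructor
  · rintro ⟨h1, h2, h3⟩
    rw [← code_mem_codes] at h1 h2
    rw [code_right] at h2
    rw [← res_code] at h3
    simp [wt, h1, h2, h3]
  · intro h
    obtain ⟨h1, h2, h3⟩ := wt_neg h
    rw [← code_right] at h3
    exact ⟨fun h => h2 (code_mem_codes.2 h), code_mem_codes.1 h3, by rw [← res_code, h1]⟩

theorem ncard_code_succ (p : Pos ℓ → Prop) {m n : ℤ} (hmn : m ≤ n) :
    ({z | p z ∧ m ≤ code z ∧ code z < n + 1}.ncard = {z | p z ∧ m ≤ code z ∧ code z < n}.ncard + 1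
      ∧ p (code.symm n)) ∨
    ({z | p z ∧ m ≤ code z ∧ code z < n + 1} = {z | p z ∧ m ≤ code z ∧ code z < n}
      ∧ ¬ p (code.symm n)) := by
  by_cases hp : p (code.symm n)
  · refine Or.inl ⟨?_, hp⟩
    have hfin : {z | p z ∧ m ≤ code z ∧ code z < n}.Finite := by
      refine ((Set.finite_Ico m n).preimage code.injective.injOn).subset fun z hz => hz.2
    rw [← Set.ncard_insert_of_notMem (a := code.symm n) (by simp) hfin]
    congr 1
    ext z
    simp only [Set.mem_ofPred_eq, Set.mem_insert_iff, Equiv.eq_symm_apply]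
    constructor
    · rintro ⟨h1, h2, h3⟩
      by_cases h4 : code z = n
      · exact Or.inl h4
      · exact Or.inr ⟨h1, h2, by omega⟩
    · rintro (h1 | ⟨h1, h2, h3⟩)
      · subst h1
        rw [code.symm_apply_apply] at hp
        exact ⟨hp, hmn, by omega⟩
      · exact ⟨h1, h2, by omega⟩
  · refine Or.inr ⟨?_, hp⟩
    ext z
    simp only [Set.mem_ofPred_eq]
    refine and_congr_right fun h1 => and_congr_right fun _ => ?_
    have : code z ≠ n := fun h => by
      rw [← h, code.symm_apply_apply] at hp
      exact hp h1
    omega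

/-- Links the counting definition of a surviving `+` to potentials: an increment is the number of
`+` minus the number of `-` read in between. -/
theorem IsPotential.sub_eq (hh : IsPotential ℓ i (codes A.beads) h) {m n : ℤ} (hmn : m ≤ n) :
    h n - h m = ({z | IsPlus e i A z ∧ m ≤ code z ∧ code z < n}.ncard : ℤ) -
      {z | IsMinus e i A z ∧ m ≤ code z ∧ code z < n}.ncard := by
  induction n, hmn using Int.leInduction with
  | base =>
    have : ∀ p : Pos ℓ → Prop, {z | p z ∧ m ≤ code z ∧ code z < m} = ∅ := fun p => by
      ext z; simp only [Set.mem_ofPred_eq, Set.mem_empty_iff_false, iff_false]; omega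
    simp [this]
  | succ n hmn ih =>
    have h1 := hh n
    have h2 := wt_le_one (ℓ := ℓ) (i := i) (S := codes A.beads) n
    have h3 := neg_one_le_wt (ℓ := ℓ) (i := i) (S := codes A.beads) n
    have hp := ncard_code_succ (IsPlus e i A) hmn
    have hm := ncard_code_succ (IsMinus e i A) hmn
    rw [isPlus_iff, code.apply_symm_apply] at hp
    rw [isMinus_iff, code.apply_symm_apply] at hm
    rcases hp with ⟨p1, p2⟩ | ⟨p1, p2⟩ <;> rcases hm with ⟨m1, m2⟩ | ⟨m1, m2⟩ <;>
      rw [p1, m1] <;> push_cast <;> omega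

theorem survivingPlus_iff (hh : IsPotential ℓ i (codes A.beads) h) :
    SurvivingPlus e i A x ↔ IsPlus e i A x ∧ ∀ n ≤ code x, h n ≤ h (code x) := by
  refine and_congr_right fun _ => ?_
  have hset : ∀ (p : Pos ℓ → Prop) (y : Pos ℓ), {z | p z ∧ (z = y ∨ PosLT y z) ∧ PosLT z x} =
      {z | p z ∧ code y ≤ code z ∧ code z < code x} := by
    intro p y
    ext z
    simp only [Set.mem_ofPred_eq, ← code_lt_iff, le_iff_lt_or_eq, code.injective.eq_iff]
    tauto
  constructor
  · intro hs n hn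
    have h1 := hs (code.symm n)
    rw [hset, hset, code.apply_symm_apply] at h1
    have := hh.sub_eq hn
    omega
  · intro hs y
    rw [hset, hset]
    rcases le_or_gt (code y) (code x) with hy | hy
    · have := hh.sub_eq hy
      have := hs _ hy
      omega
    · have : ∀ p : Pos ℓ → Prop, {z | p z ∧ code y ≤ code z ∧ code z < code x} = ∅ := fun p => by
        ext z; simp only [Set.mem_ofPred_eq, Set.mem_empty_iff_false, iff_false]; omega
      simp [this]

theorem isGood_iff : IsGood e i A x ↔ Good ℓ i (codes A.beads) (code x) := by
  obtain ⟨h, hh⟩ := exists_potential ℓ i (codes A.beads)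
  have hstep := hh (code x)
  have hone := wt_le_one (ℓ := ℓ) (i := i) (S := codes A.beads)
  constructor
  · rintro ⟨hs, hmax⟩
    rw [survivingPlus_iff hh, isPlus_iff] at hs
    refine ⟨h, hh, fun y hy => ?_, ?_⟩
    · have := hs.2 y hy
      omega
    · by_contra! hex
      -- If the potential exceeded its value just after `x`, the first point `y` where this happens
      -- would come right after a surviving `+` at `y - 1`, to the right of `x`.
      obtain ⟨y, ⟨hy, hyx⟩, hmin⟩ := Int.exists_least_of_bdd
        (P := fun y => h (code x + 1) < h y ∧ code x < y) ⟨code x, fun z hz => hz.2.le⟩ (by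
          obtain ⟨y, hy⟩ := hex
          refine ⟨y, hy, ?_⟩
          by_contra! hle
          have := hs.2 y hle
          omega)
      have h1 : y ≠ code x + 1 := by rintro rfl; exact lt_irrefl _ hy
      have h2 := hh (y - 1)
      rw [sub_add_cancel] at h2
      have h3 := hone (y - 1)
      have h4 : ∀ z, code x < z → z < y → h z ≤ h (code x + 1) := fun z hz hzy => by
        by_contra! hlt
        have := hmin z ⟨hlt, hz⟩
        omega
      have h5 := h4 (y - 1) (by omega) (by omega)
      have hsurv : SurvivingPlus e i A (code.symm (y - 1)) := by
        rw [survivingPlus_iff hh, isPlus_iff, code.apply_symm_apply]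
        refine ⟨by omega, fun n hn => ?_⟩
        rcases le_or_gt n (code x) with hnx | hnx
        · have := hs.2 n hnx
          omega
        · have := h4 n hnx (by omega)
          omega
      rcases hmax _ hsurv with h6 | h6
      · have := congrArg code h6
        rw [code.apply_symm_apply] at this
        omega
      · rw [← code_lt_iff, code.apply_symm_apply] at h6
        omega
  · intro hg
    have hf := hg.firstMax hh
    have h1 := hf.1 _ le_rfl
    refine ⟨?_, fun z hz => ?_⟩
    · rw [survivingPlus_iff hh, isPlus_iff]
      have := hone (code x)
      refine ⟨by omega, fun n hn => ?_⟩
      have := hf.1 n hn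
      omega
    · rw [survivingPlus_iff hh, isPlus_iff] at hz
      rw [← code_lt_iff, ← code.injective.eq_iff]
      by_contra! hne
      have h2 := hz.2 (code x + 1) (by omega)
      have h3 := hf.2 (code z + 1)
      have := hh (code z)
      omega

theorem affineArrow_iff : AffineArrow e i A A' ↔ FStep ℓ i (codes A.beads) (codes A'.beads) := by
  have hset : ∀ x : Pos ℓ, codes ((A.beads \ {x}) ∪ {(x.1 + 1, x.2)}) =
      (codes A.beads \ {code x}) ∪ {code x + (ℓ : ℤ)} := fun x => by
    rw [codes_union, codes_sdiff, codes_singleton, codes_singleton, code_right]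
  constructor
  · rintro ⟨x, hx, hA⟩
    exact ⟨code x, isGood_iff.1 hx, by rw [hA, hset]⟩
  · rintro ⟨n, hn, hA⟩
    refine ⟨code.symm n, isGood_iff.2 (by rwa [code.apply_symm_apply]), codes_injective ?_⟩
    rw [hset, hA, code.apply_symm_apply]

end

/-! ### The greedy sequence after a move -/

section
variable {e ℓ k m : ℕ} [NeZero e] [NeZero ℓ] {A A' S : Set ℤ} {G G' : ℕ → ZMod e → ℤ}

omit [NeZero e] in
-- The translate `sh (G k)` lies below the earlier cycles. So the maximum of `G m` with a competing
-- cycle of the new set uses none of its new beads and is a cycle of the old set, already dominated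
-- by `G m`.
theorem Adm.greedy_eq_of_lt (ha : Adm ℓ (A \ Set.range (G k)) (G k)) (hG : IsGreedySeq ℓ A G)
    (hG' : IsGreedySeq ℓ ((A \ Set.range (G k)) ∪ Set.range (sh ℓ (G k))) G') (hm : m < k) :
    G' m = G m := by
  induction m using Nat.strong_induction_on with
  | _ m ih =>
    have hS : ∀ j, G m j ∈ A \ Set.range (G k) := fun j => ⟨hG.mem m j, by
      rintro ⟨j', hj'⟩
      exact hm.ne (hG.inj hj').symm⟩
    have hr := rest_congr (A := (A \ Set.range (G k)) ∪ Set.range (sh ℓ (G k)))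
      fun m' (h : m' < m) => ih m' h (h.trans hm)
    refine (hG' m).unique ⟨(hG m).cycle, fun j => ?_, fun z hz hzm => ?_⟩
    · rw [hr]
      exact ⟨Or.inl (hS j), ((hG m).mem j).2⟩
    · rw [hr] at hzm
      refine le_trans le_sup_left ((hG m).ge _ (hz.max (hG m).cycle) fun j => ?_)
      rcases le_total (z j) (G m j) with h | h
      · rw [Pi.sup_apply, sup_eq_right.2 h]; exact (hG m).mem j
      · rw [Pi.sup_apply, sup_eq_left.2 h]
        refine ⟨?_, (hzm j).2⟩
        rcases (hzm j).1 with h1 | h1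
        · exact h1.1
        · rw [ha.cycle.sh.mem_range, hz.res_eq] at h1
          have h2 := ha.off_res (hS j) ((hG m).cycle.res_eq j) (hG.lt hm j).le
          simp only [sh] at h1
          omega

omit [NeZero e] in
theorem Adm.sh_le_greedy (ha : Adm ℓ (A \ Set.range (G k)) (G k)) (hG : IsGreedySeq ℓ A G)
    (hG' : IsGreedySeq ℓ ((A \ Set.range (G k)) ∪ Set.range (sh ℓ (G k))) G') :
    sh ℓ (G k) ≤ G' k := by
  refine (hG' k).ge _ ha.cycle.sh fun j => ⟨Or.inr ⟨j, rfl⟩, fun m hm => ?_⟩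
  rw [ha.greedy_eq_of_lt hG hG' hm]
  rintro ⟨j', hj'⟩
  refine ha.sh_notMem j (hj' ▸ ⟨hG.mem m j', ?_⟩)
  rintro ⟨i, hi⟩
  exact hm.ne (hG.inj hi).symm

/-- Otherwise `G' k` would consist of old beads and be dominated by `G k`, although it dominates `sh
(G k)`, which exceeds `G k` somewhere. -/
theorem Adm.exists_greedy_eq_sh (ha : Adm ℓ (A \ Set.range (G k)) (G k)) (hG : IsGreedySeq ℓ A G)
    (hG' : IsGreedySeq ℓ ((A \ Set.range (G k)) ∪ Set.range (sh ℓ (G k))) G') :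
    ∃ j, G' k j = sh ℓ (G k) j := by
  by_contra! hne
  obtain ⟨j, hj⟩ := exists_lt_sh (ℓ := ℓ) (G k)
  have h1 : sh ℓ (G k) j ≤ G' k j := ha.sh_le_greedy hG hG' j
  have h2 : G' k j ≤ G k j := (hG k).ge _ (hG' k).cycle (fun i => ⟨?_, fun m hm => ?_⟩) j
  · omega
  · rcases hG'.mem k i with h3 | h3
    · exact h3.1
    · rw [ha.cycle.sh.mem_range, (hG' k).cycle.res_eq] at h3
      exact absurd h3 (hne i)
  · rw [← ha.greedy_eq_of_lt hG hG' hm]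
    exact ((hG' k).mem i).2 m hm

/-- By the dichotomy at the wall, the alternative is to dominate `sh (G k)`. That fails where `G' k`
meets it, since `G' m` is strictly below `G' k`. -/
theorem Adm.greedy_lt_of_gt (ha : Adm ℓ (A \ Set.range (G k)) (G k)) (hG : IsGreedySeq ℓ A G)
    (hG' : IsGreedySeq ℓ ((A \ Set.range (G k)) ∪ Set.range (sh ℓ (G k))) G') (hm : k < m)
    (j : ZMod e) : G' m j < G k j := by
  refine (ha.sh_le_or_behind (hG' m).cycle (by rintro _ ⟨i, rfl⟩; exact hG'.mem m i)).resolve_left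
    (fun h => ?_) j
  obtain ⟨i, hi⟩ := ha.exists_greedy_eq_sh hG hG'
  have h1 : sh ℓ (G k) i ≤ G' m i := h i
  have h2 := hG'.lt hm i
  omega

omit [NeZero ℓ] in
/-- A translate of a greedy cycle which avoids all terms but the `k`-th of the new greedy
sequence, and lies behind the `k`-th term, is a translate across a free wall. -/
theorem IsGreedySeq.adm_of_sh_le (hG : IsGreedySeq ℓ A G) [Fact (1 < e)]
    (hG' : IsGreedySeq ℓ ((A \ Set.range (G k)) ∪ Set.range (sh ℓ (G k))) G')
    (hle : sh ℓ (G k) ≤ G' k) (hd : ∀ m < k, ∀ j, sh ℓ (G k) j ∉ Set.range (G' m)) :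
    Adm ℓ (A \ Set.range (G k)) (G k) := by
  have heq : ∀ m < k, G m = G' m := by
    intro m hm
    induction m using Nat.strong_induction_on with
    | _ m ih =>
      -- Both `G m` and `G' m` avoid the beads affected by the move, so each is the greatest cycle
      -- of the same set of unaffected beads.
      have h1 : IsGreatestCycle ℓ (rest (A \ Set.range (G k)) G m) (G m) :=
        (hG m).of_subset (fun n hn => ⟨hn.1.1, hn.2⟩) fun j => ⟨⟨hG.mem m j, by
          rintro ⟨j', hj'⟩
          exact hm.ne (hG.inj hj').symm⟩, ((hG m).mem j).2⟩
      have h2 : IsGreatestCycle ℓ (rest (A \ Set.range (G k)) G' m) (G' m) :=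
        (hG' m).of_subset (fun n hn => ⟨Or.inl hn.1, hn.2⟩) fun j => ⟨by
          rcases hG'.mem m j with h | ⟨j', hj'⟩
          · exact h
          · exact absurd ⟨j, hj'.symm⟩ (hd m hm j'), ((hG' m).mem j).2⟩
      rw [rest_congr fun m' h => ih m' h (h.trans hm)] at h1
      exact h1.unique h2
  refine ⟨(hG k).cycle, fun n hn hbn => ?_⟩
  -- Beads left at stage `k` avoid the wall by maximality of `G k`; the others lie on an earlier
  -- cycle, unchanged by the move and strictly in front of `G' k ≥ sh (G k)`.
  by_cases hr : n ∈ rest A G k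
  · exact (hG k).adm.off n ⟨hr, hn.2⟩ hbn
  · obtain ⟨m, hm, hnm⟩ : ∃ m < k, n ∈ Set.range (G m) := by
      by_contra! h
      exact hr ⟨hn.1, h⟩
    rw [(hG m).cycle.mem_range, heq m hm] at hnm
    have h1 := hG'.lt hm (res e ℓ n)
    have h2 := hle (res e ℓ n)
    simp only [sh] at h2
    omega

end

/-! ### Vessels -/

section
variable {e ℓ : ℕ} [NeZero e] [NeZero ℓ] {S T F : Set (Pos ℓ)} {p q : Fin e → Pos ℓ} {x : Pos ℓ}

/-- The bead of `p` with the residue of the column of `x` is in that column or to its right: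
otherwise `p` would extend over more than `e` columns. -/
theorem IsQuasiperiod.code_lt_cyc (hp : IsQuasiperiod e S p) (h1 : ∃ i, x.1 ≤ (p i).1)
    (h2 : ∀ i, x.1 = (p i).1 → (p i).2 < x.2) : code x < cyc p (x.1 : ZMod e) := by
  have hc := hp.cast_beadIndex (x.1 : ZMod e)
  rw [cyc]
  set i := beadIndex p (x.1 : ZMod e)
  obtain ⟨i', hi'⟩ := h1
  by_cases h : x.1 = (p i).1
  · exact (code_lt_code h).2 (h2 i h)
  · refine code_lt_of_fst_lt (lt_of_le_of_ne ?_ h)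
    by_contra! hlt
    rw [ZMod.intCast_eq_intCast_iff_dvd_sub] at hc
    have := Int.le_of_dvd (by omega) hc
    have h3 := hp.fst_eq i
    have h4 := hp.fst_eq i'
    have := i.isLt
    omega

theorem IsQuasiperiod.cyc_lt_code (hp : IsQuasiperiod e S p) (h1 : ∃ i, (p i).1 ≤ x.1)
    (h2 : ∀ i, x.1 = (p i).1 → x.2 < (p i).2) : cyc p (x.1 : ZMod e) < code x := by
  have hc := hp.cast_beadIndex (x.1 : ZMod e)
  rw [cyc]
  set i := beadIndex p (x.1 : ZMod e)
  obtain ⟨i', hi'⟩ := h1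
  by_cases h : x.1 = (p i).1
  · exact (code_lt_code h.symm).2 (h2 i h)
  · refine code_lt_of_fst_lt (lt_of_le_of_ne ?_ (Ne.symm h))
    by_contra! hlt
    rw [eq_comm, ZMod.intCast_eq_intCast_iff_dvd_sub] at hc
    have := Int.le_of_dvd (by omega) hc
    have h3 := hp.fst_eq i
    have h4 := hp.fst_eq i'
    have := i'.isLt
    omega

/-- Eliminates the case distinction on columns from the definition of vessels: position relative to
a fore period is read off from the entry of the same residue. -/
theorem between_iff (hp : IsQuasiperiod e S p) (hq : IsQuasiperiod e T q) :
    Between p q x ↔ cyc q (x.1 : ZMod e) < code x ∧ code x < cyc p (x.1 : ZMod e) := by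
  constructor
  · rintro ⟨h1, h2, h3, h4⟩
    exact ⟨hq.cyc_lt_code h1 h4, hp.code_lt_cyc h2 h3⟩
  · rintro ⟨h1, h2⟩
    refine ⟨⟨_, fst_le_of_code_le h1.le⟩, ⟨_, fst_le_of_code_le h2.le⟩, fun i hi => ?_,
      fun i hi => ?_⟩
    · rwa [hi, hp.cyc_cast, code_lt_code hi] at h2
    · rwa [hi, hq.cyc_cast, code_lt_code hi.symm] at h1

omit [NeZero e] [NeZero ℓ] in
theorem Vessel.cases' (h : Vessel F p q x) : x ∈ Set.range p ∨ x ∈ F ∧ Between p q x := by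
  cases h with
  | fore i => exact Or.inl ⟨i, rfl⟩
  | near _ hF hb _ => exact Or.inr ⟨hF, hb⟩
  | far _ hF hb _ _ _ => exact Or.inr ⟨hF, hb⟩

omit [NeZero ℓ] in
/-- A quasiperiod is in a vessel as soon as its beads are beads of the fore period, or free beads
in between, and one of its beads is in the fore period. -/
theorem IsQuasiperiod.vessel {r : Fin e → Pos ℓ} (hr : IsQuasiperiod e S r)
    (h : ∀ i, r i ∈ Set.range p ∨ r i ∈ F ∧ Between p q (r i)) (hex : ∃ i, r i ∈ Set.range p)
    (i : Fin e) : Vessel F p q (r i) := by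
  obtain ⟨n, hn⟩ := i
  induction n with
  | zero =>
    rcases h ⟨0, hn⟩ with ⟨i', hi'⟩ | ⟨hF, hb⟩
    · rw [← hi']; exact .fore i'
    · refine .near _ hF hb ?_
      obtain ⟨i, i', hi⟩ := hex
      refine ⟨i', ?_⟩
      have h0 : (⟨0, hn⟩ : Fin e) = 0 := rfl
      rw [hi, hr.fst_eq i, h0]
      omega
  | succ n ih =>
    rcases h ⟨n + 1, hn⟩ with ⟨i', hi'⟩ | ⟨hF, hb⟩
    · rw [← hi']; exact .fore i'
    · by_cases hc : ∃ i, (p i).1 ≤ (r ⟨n + 1, hn⟩).1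
      · exact .near _ hF hb hc
      · push Not at hc
        refine .far _ hF hb hc (r ⟨n, by omega⟩).2 ?_
        have h1 := (hr.2 ⟨n, by omega⟩ ⟨n + 1, hn⟩ rfl).1
        rw [h1, sub_add_cancel]
        exact ih (by omega)

omit [NeZero e] [NeZero ℓ] in
theorem shift_shift (s t : ℤ) : shift s (shift t p) = shift (t + s) p := by
  funext i; simp only [shift, add_assoc]

omit [NeZero e] [NeZero ℓ] in
theorem shift_zero : shift 0 p = p := by
  funext i; simp only [shift, add_zero]

end

/-! ### Traveling downstream -/

section
variable {e ℓ k : ℕ} [NeZero e] [NeZero ℓ] {A A' : Abacus ℓ} {p q : Fin e → Pos ℓ}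

theorem IsQuasiperiod.codes_shift (hp : IsQuasiperiod e A.beads p)
    (h : A'.beads = (A.beads \ Set.range p) ∪ Set.range (shift 1 p)) :
    codes A'.beads = (codes A.beads \ Set.range (cyc p)) ∪ Set.range (sh ℓ (cyc p)) := by
  rw [h, codes_union, codes_sdiff, ← hp.range_cyc, ← (shift_quasiperiod hp 1).range_cyc,
    cyc_shift_one]

theorem IsForeSeq.mem_range_cyc {P : ℕ → Fin e → Pos ℓ} (hP : IsForeSeq e A P) (k : ℕ) {x : Pos ℓ} :
    x ∈ Set.range (P k) ↔ code x ∈ Set.range (cyc (P k)) := by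
  rw [(hP.quasiperiod k).range_cyc, code_mem_codes]

variable [Fact (1 < e)]

/-- Membership of `shift 1 (P k)` in the vessel of `P' k` gives exactly what `adm_of_sh_le` asks
for: it is behind `P' k` and avoids the earlier fore periods. -/
theorem Downstream.moves (h : Downstream e k A A') : Moves e ℓ k (codes A.beads) (codes A'.beads) := by
  obtain ⟨_, ⟨P, hP, rfl⟩, -, hA', P', hP', hq, -⟩ := h
  have hp := hP.quasiperiod k
  have hA'c := hp.codes_shift hA'
  have hG := hP.greedy
  have hG' := hP'.greedy
  have hv : ∀ i, code (shift 1 (P k) i) ≤ cyc (P' k) ((shift 1 (P k) i).1 : ZMod e) ∧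
      ∀ m < k, shift 1 (P k) i ∉ Set.range (P' m) := fun i => by
    rcases (hq.1 i).cases' with hr | ⟨hF, hb⟩
    · constructor
      · obtain ⟨i', hi'⟩ := hr
        rw [← hi', (hP'.quasiperiod k).cyc_cast]
      · rintro m hm hr'
        rw [hP'.mem_range_cyc] at hr hr'
        obtain ⟨⟨j, hj⟩, ⟨j', hj'⟩⟩ := And.intro hr hr'
        exact hm.ne (hG'.inj (hj'.trans hj.symm))
    · exact ⟨((between_iff (hP'.quasiperiod k) (hP'.quasiperiod (k + 1))).1 hb).2.le,
        fun m _ => hF.2 m⟩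
  rw [hA'c] at hG'
  have hsh := shift_quasiperiod hp 1
  refine ⟨_, hG, hG.adm_of_sh_le hG' (fun j => ?_) (fun m hm j hj => ?_), hA'c⟩
  · rw [← cyc_shift_one, cyc]
    have := (hv (beadIndex (shift 1 (P k)) j)).1
    rwa [hsh.cast_beadIndex] at this
  · rw [← cyc_shift_one, cyc, ← hP'.mem_range_cyc] at hj
    exact (hv _).2 m hm hj

theorem downstream_of_moves (h : Moves e ℓ k (codes A.beads) (codes A'.beads)) :
    Downstream e k A A' := by
  obtain ⟨P, hP, hG⟩ := exists_foreSeq (e := e) A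
  obtain ⟨P', hP', hG'⟩ := exists_foreSeq (e := e) A'
  obtain ⟨G₁, hG₁, ha, hA'⟩ := h
  obtain rfl := hG₁.unique hG
  have hp := hP.quasiperiod k
  have hsh := shift_quasiperiod hp 1
  have hG'A := hG'
  rw [hA'] at hG'
  have hb : A'.beads = (A.beads \ Set.range (P k)) ∪ Set.range (shift 1 (P k)) := by
    apply codes_injective
    rw [hA', codes_union, codes_sdiff, ← hp.range_cyc, ← hsh.range_cyc, cyc_shift_one]
  have hcode : ∀ i, code (shift 1 (P k) i) = sh ℓ (cyc (P k)) ((shift 1 (P k) i).1 : ZMod e) :=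
    fun i => by rw [← cyc_shift_one, hsh.cyc_cast]
  have hmem : ∀ i, shift 1 (P k) i ∈ Set.range (P' k) ↔
      code (shift 1 (P k) i) = cyc (P' k) ((shift 1 (P k) i).1 : ZMod e) := fun i => by
    rw [hP'.mem_range_cyc, (hP'.quasiperiod k).isCycle.mem_range, res_code]
  have hle := ha.sh_le_greedy hG₁ hG'
  have hor : ∀ i, shift 1 (P k) i ∈ Set.range (P' k) ∨ shift 1 (P k) i ∈ freeBeads A' P' ∧
      Between (P' k) (P' (k + 1)) (shift 1 (P k) i) := by
    intro i
    by_cases hi : shift 1 (P k) i ∈ Set.range (P' k)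
    · exact Or.inl hi
    · refine Or.inr ⟨⟨by rw [hb]; exact Or.inr ⟨i, rfl⟩, fun m hm => ?_⟩,
        (between_iff (hP'.quasiperiod k) (hP'.quasiperiod (k + 1))).2 ⟨?_, ?_⟩⟩
      · rcases lt_trichotomy m k with h1 | rfl | h1
        · rw [hP'.mem_range_cyc] at hm
          have h2 := ha.greedy_eq_of_lt hG₁ hG' h1
          rw [h2, hcode] at hm
          obtain ⟨j, hj⟩ := hm
          refine ha.sh_notMem ((shift 1 (P k) i).1 : ZMod e) ?_
          rw [← hj]
          refine ⟨hG₁.mem m j, ?_⟩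
          rintro ⟨j', hj'⟩
          exact h1.ne (hG₁.inj hj').symm
        · exact hi hm
        · rw [hP'.mem_range_cyc, (hP'.quasiperiod m).isCycle.mem_range, res_code] at hm
          have h2 : cyc (P' m) _ < cyc (P k) _ := ha.greedy_lt_of_gt hG₁ hG' h1 ((shift 1 (P k) i).1 : ZMod e)
          have h3 : cyc (P k) _ ≤ sh ℓ (cyc (P k)) _ := ha.cycle.le_sh ((shift 1 (P k) i).1 : ZMod e)
          rw [hcode] at hm
          omega
      · have h2 := ha.greedy_lt_of_gt hG₁ hG' (Nat.lt_add_one k) ((shift 1 (P k) i).1 : ZMod e)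
        have h3 : cyc (P k) _ ≤ sh ℓ (cyc (P k)) _ := ha.cycle.le_sh ((shift 1 (P k) i).1 : ZMod e)
        rw [hcode]
        omega
      · rw [hmem] at hi
        refine lt_of_le_of_ne ?_ hi
        rw [hcode]
        exact hle _
  -- The meeting point anchors the translate in the vessel: through consecutive columns it validates
  -- the recursive condition on beads to the left of `P' k`.
  have hex : ∃ i, shift 1 (P k) i ∈ Set.range (P' k) := by
    obtain ⟨j, hj⟩ := ha.exists_greedy_eq_sh hG₁ hG'
    refine ⟨beadIndex (shift 1 (P k)) j, ?_⟩
    rw [hmem, hcode, hsh.cast_beadIndex]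
    exact hj.symm
  refine ⟨P k, ⟨P, hP, rfl⟩, fun i hi hm => ?_, hb, P', hP',
    hsh.mono (hsh.vessel hor hex), fun Q hQ => ?_⟩
  · refine ha.sh_notMem ((shift 1 (P k) i).1 : ZMod e) ?_
    rw [← hcode]
    refine ⟨code_mem_codes.2 hm, ?_⟩
    rw [hp.range_cyc, code_mem_codes]
    rintro ⟨i', hi'⟩
    have := hi i' (by rw [hi']; rfl)
    rw [hi'] at this
    simp only [shift] at this
    omega
  · have hQc := hQ.isCycle
    rcases ha.sh_le_or_behind hQc (by
      rintro _ ⟨j, rfl⟩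
      rw [← hA', cyc, code_mem_codes]
      rcases (hQ.1 (beadIndex Q j)).cases' with ⟨i, hi⟩ | ⟨hF, -⟩
      · rw [← hi]; exact (hP'.quasiperiod k).1 i
      · exact hF.1) with h1 | h1
    · rw [← cyc_shift_one] at h1
      rcases hsh.eq_or_qlt hQ h1 with h2 | h2
      · exact Or.inl h2.symm
      · exact Or.inr h2
    · exfalso
      -- A quasiperiod of the vessel behind the wall misses `P' k`, so it consists of free beads
      -- strictly in front of `P' (k + 1)`, against the maximality of `P' (k + 1)`.
      have hv : ∀ i, Q i ∈ freeBeads A' P' ∧ Between (P' k) (P' (k + 1)) (Q i) := fun i => by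
        refine (hQ.1 i).cases'.resolve_left fun hm => ?_
        rw [hP'.mem_range_cyc, (hP'.quasiperiod k).isCycle.mem_range, res_code] at hm
        have h2 : _ < cyc (P k) _ := h1 ((Q i).1 : ZMod e)
        rw [hQ.cyc_cast] at h2
        have h3 : sh ℓ (cyc (P k)) _ ≤ cyc (P' k) ((Q i).1 : ZMod e) := hle ((Q i).1 : ZMod e)
        have h4 : cyc (P k) _ ≤ sh ℓ (cyc (P k)) _ := ha.cycle.le_sh ((Q i).1 : ZMod e)
        omega
      have h2 : _ ≤ cyc (P' (k + 1)) ((Q 0).1 : ZMod e) := (hG'A (k + 1)).ge _ hQc (fun j =>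
        ⟨code_mem_codes.2 (hv (beadIndex Q j)).1.1, fun m _ hm => (hv (beadIndex Q j)).1.2 m (by
          rw [hP'.mem_range_cyc]; exact hm)⟩) ((Q 0).1 : ZMod e)
      have h3 := ((between_iff (hP'.quasiperiod k) (hP'.quasiperiod (k + 1))).1 (hv 0).2).1
      rw [hQ.cyc_cast] at h2
      omega

theorem Downstream.upstream (h : Downstream e k A A') : Upstream e k A A' := by
  obtain ⟨P, hP, ha, hA'⟩ := h.moves
  obtain ⟨p, hp, hR, hb, hq⟩ := h
  obtain ⟨P₁, hP₁, rfl⟩ := hp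
  obtain rfl := hP.unique hP₁.greedy
  have hpq := hP₁.quasiperiod k
  have hd : Disjoint (A.beads \ Set.range (P₁ k)) (Set.range (shift 1 (P₁ k))) := by
    rw [Set.disjoint_left]
    rintro x hx hx'
    have h1 : code x ∈ codes A.beads \ Set.range (cyc (P₁ k)) :=
      ⟨code_mem_codes.2 hx.1, by rw [hpq.range_cyc, code_mem_codes]; exact hx.2⟩
    have h2 : code x ∈ Set.range (sh ℓ (cyc (P₁ k))) := by
      rw [← cyc_shift_one, (shift_quasiperiod hpq 1).range_cyc, code_mem_codes]; exact hx'
    exact Set.disjoint_left.1 ha.disjoint_sh h1 h2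
  have hs : shift (-1) (shift 1 (P₁ k)) = P₁ k := by
    rw [shift_shift, add_neg_cancel, shift_zero]
  refine ⟨_, hq, fun i hi hm => ?_, ?_, ?_⟩
  · rw [hb] at hm
    have hpi : ((shift 1 (P₁ k) i).1 - 1, (shift 1 (P₁ k) i).2) = P₁ k i := by
      simp [shift]
    rw [hpi] at hm
    rcases hm with hm | ⟨i', hi'⟩
    · exact hm.2 ⟨i, rfl⟩
    · have h1 := hi i' (by rw [hi']; rfl)
      rw [hi'] at h1
      simp only [shift] at h1
      omega
  · rw [hs, hb, Set.union_sdiff_right, hd.sdiff_eq_left]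
    exact (Set.sdiff_union_of_subset (by rintro _ ⟨i, rfl⟩; exact hpq.1 i)).symm
  · rw [hs]; exact ⟨P₁, hP₁, rfl⟩

omit [Fact (1 < e)] [NeZero ℓ] in
theorem Upstream.downstream (h : Upstream e k A A') : Downstream e k A A' := by
  obtain ⟨q, hq, hL, hb, hp⟩ := h
  have hqq : IsQuasiperiod e A'.beads q := by
    obtain ⟨P', hP', hq1, -⟩ := hq
    refine hq1.mono fun i => ?_
    rcases (hq1.1 i).cases' with ⟨i', hi'⟩ | ⟨hF, -⟩
    · rw [← hi']; exact (hP'.quasiperiod k).1 i'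
    · exact hF.1
  have hs : shift 1 (shift (-1) q) = q := by
    rw [shift_shift, neg_add_cancel, shift_zero]
  -- If the position left of a bead of `q` is occupied, the bead is not the leftmost of `q` in its
  -- row, by left-shiftability. Rows being monotone along `q`, the next bead of `q` is then exactly
  -- that position.
  have hd : Disjoint (A'.beads \ Set.range q) (Set.range (shift (-1) q)) := by
    rw [Set.disjoint_right]
    rintro _ ⟨i, rfl⟩ ⟨h1, h2⟩
    refine hL i (fun i' hi' => ?_) h1
    by_contra! hlt
    have e1 := hqq.fst_eq i
    have e2 := hqq.fst_eq i'
    have hii : (i : ℕ) < i' := by omega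
    have hi1 : (i : ℕ) + 1 < e := by omega
    refine h2 ⟨⟨i + 1, hi1⟩, ?_⟩
    have h3 := hqq.2 i ⟨i + 1, hi1⟩ rfl
    have h4 : (q i').2 ≤ (q ⟨i + 1, hi1⟩).2 := hqq.snd_le (by rw [Fin.le_def]; exact hii)
    refine Prod.ext h3.1 (le_antisymm h3.2 ?_)
    rwa [hi'] at h4
  refine ⟨_, hp, fun i hi hm => ?_, ?_, by rwa [hs]⟩
  · rw [hb] at hm
    have hqi : ((shift (-1) q i).1 + 1, (shift (-1) q i).2) = q i := by simp [shift]
    rw [hqi] at hm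
    rcases hm with hm | ⟨i', hi'⟩
    · exact hm.2 ⟨i, rfl⟩
    · have h1 := hi i' (by rw [hi']; rfl)
      rw [hi'] at h1
      simp only [shift] at h1
      omega
  · rw [hs, hb, Set.union_sdiff_right, hd.sdiff_eq_left]
    exact (Set.sdiff_union_of_subset (by rintro _ ⟨i, rfl⟩; exact hqq.1 i)).symm

theorem downstream_iff_upstream : Downstream e k A A' ↔ Upstream e k A A' :=
  ⟨Downstream.upstream, Upstream.downstream⟩

theorem Downstream.target_unique {B : Abacus ℓ} (h : Downstream e k A A') (h' : Downstream e k A B) :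
    A' = B := Abacus.ext_codes (h.moves.unique h'.moves)

omit [NeZero e] [Fact (1 < e)] in
theorem IsAftPeriod.unique (hp : IsAftPeriod e k A p) (hq : IsAftPeriod e k A q) : p = q := by
  obtain ⟨P, hP, hp1, hp2⟩ := hp
  obtain ⟨Q, hQ, hq1, hq2⟩ := hq
  obtain rfl := hP.unique hQ
  rcases hp2 _ hq1 with h | h
  · exact h.symm
  · exact (hq2 _ hp1).elim id fun h' => absurd h h'.asymm

theorem Downstream.source_unique {B : Abacus ℓ} (h : Downstream e k A A') (h' : Downstream e k B A') :
    A = B := by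
  obtain ⟨p, hp, -, hA, -⟩ := h.upstream
  obtain ⟨q, hq, -, hB, -⟩ := h'.upstream
  obtain rfl := hp.unique hq
  exact Abacus.ext (hA.trans hB.symm)

end

/-! ### Descending in both crystals terminates -/

section
variable {e ℓ k : ℕ} {S : Set ℤ} {ι : Type*} {c d : ι → ℤ} {lo : ℤ}

/-- The total distance of the elements of `S` from `lo`, for those greater than `lo`. -/
noncomputable def energy (lo : ℤ) (S : Set ℤ) : ℕ := ∑ᶠ n ∈ S, (n - lo).toNat

theorem energy_union_range [Fintype ι] (hS : ∃ hi : ℤ, ∀ n ∈ S, n < hi) (hc : Function.Injective c)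
    (hd : Disjoint S (Set.range c)) :
    energy lo (S ∪ Set.range c) = energy lo S + ∑ j, (c j - lo).toNat := by
  obtain ⟨hi, hhi⟩ := hS
  rw [energy, finsum_mem_union' hd _ ((Set.finite_range c).inter_of_left _), finsum_mem_range hc,
    finsum_eq_sum_of_fintype (fun j => (c j - lo).toNat), energy]
  · refine (Set.finite_Icc lo hi).subset fun n hn => ?_
    have h1 := hhi n hn.1
    have h2 : (n - lo).toNat ≠ 0 := hn.2
    rw [Set.mem_Icc]
    omega

theorem energy_lt [Finite ι] (hS : ∃ hi : ℤ, ∀ n ∈ S, n < hi) (hc : Function.Injective c)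
    (hd : Function.Injective d) (hcS : Disjoint S (Set.range c)) (hdS : Disjoint S (Set.range d))
    (h : ∀ j, c j ≤ d j) (hlt : ∃ j, c j < d j ∧ lo < d j) :
    energy lo (S ∪ Set.range c) < energy lo (S ∪ Set.range d) := by
  have := Fintype.ofFinite ι
  rw [energy_union_range hS hc hcS, energy_union_range hS hd hdS]
  refine Nat.add_lt_add_left (Finset.sum_lt_sum (fun j _ => ?_) ?_) _
  · have := h j
    omega
  · obtain ⟨j, h1, h2⟩ := hlt
    exact ⟨j, Finset.mem_univ j, by omega⟩

theorem FStep.energy_lt [NeZero ℓ] [Fact (1 < e)] {i : ZMod e} {A B : Set ℤ} (h : FStep ℓ i B A)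
    (hA : Semiinfinite A) (hlo : ∀ n ≤ lo, n ∈ A) :
    (∀ n ≤ lo, n ∈ B) ∧ energy lo B < energy lo A := by
  obtain ⟨x, hx, rfl⟩ := FStep_iff_cogood.1 h
  have hℓ : (0 : ℤ) < ℓ := by exact_mod_cast Nat.pos_of_ne_zero (NeZero.ne ℓ)
  obtain ⟨-, h1, h2⟩ := hx.mem
  have h3 : lo < x := by
    by_contra! hle
    exact h1 (hlo x hle)
  refine ⟨fun n hn => Or.inl ⟨hlo n hn, fun h => ?_⟩, ?_⟩
  · rw [Set.mem_singleton_iff] at h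
    omega
  · have := AbacusCrystal.energy_lt (S := A \ {x + (ℓ : ℤ)}) (c := fun _ : Unit => x)
      (d := fun _ : Unit => x + (ℓ : ℤ)) (lo := lo) (hA.sdiff_finite (Set.finite_singleton _)).bdd
      (fun _ _ _ => rfl) (fun _ _ _ => rfl) (by simp [h1]) (by simp) (fun _ => by omega)
      ⟨(), by omega, by omega⟩
    rw [Set.range_const, Set.range_const, Set.sdiff_union_of_subset (by simpa using h2)] at this
    exact this

theorem Moves.energy_lt [NeZero ℓ] [NeZero e] {A B : Set ℤ} (h : Moves e ℓ k B A)
    (hB : Semiinfinite B) (hlo : ∀ n ≤ lo, n ∈ A) :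
    (∀ n ≤ lo, n ∈ B) ∧ energy lo B < energy lo A := by
  obtain ⟨P, hP, ha, rfl⟩ := h
  set b := P k
  -- All integers up to `lo` are occupied in the target. If `sh b j ≤ lo`, then `b j` is occupied as
  -- well, and only `sh b` can occupy it; so the move fixes this entry.
  have hsh : ∀ j, sh ℓ b j ≤ lo → sh ℓ b j = b j := fun j hj => by
    have h1 : b j ≤ sh ℓ b j := ha.cycle.le_sh j
    rcases hlo (b j) (by omega) with h2 | h2
    · exact absurd h2 (ha.notMem j)
    · rw [ha.cycle.sh.mem_range, ha.cycle.res_eq] at h2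
      exact h2.symm
  constructor
  · intro n hn
    rcases hlo n hn with h1 | ⟨j, rfl⟩
    · exact h1.1
    · rw [hsh j hn]; exact hP.mem k j
  · have := AbacusCrystal.energy_lt (S := B \ Set.range b) (c := b) (d := sh ℓ b) (lo := lo)
      (hB.sdiff_finite (Set.finite_range _)).bdd (fun _ _ => ha.cycle.inj)
      (fun _ _ => ha.cycle.sh.inj) ha.disjoint ha.disjoint_sh ha.cycle.le_sh (by
        obtain ⟨j, hj⟩ := exists_lt_sh (ℓ := ℓ) b
        refine ⟨j, hj, ?_⟩
        by_contra! hle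
        have := hsh j hle
        omega)
    rwa [union_range_sdiff (hP.mem k)] at this

end

section
variable {e ℓ k : ℕ} {i : ZMod e} [NeZero e] [NeZero ℓ] [Fact (1 < e)] {A A' A₁ B B' : Abacus ℓ}

variable (e) in
-- Both kinds of arrows into `A` start at abaci of smaller energy relative to the same bound `lo`,
-- below which every position stays full.
@[elab_as_elim]
theorem Abacus.crystal_induction {p : Abacus ℓ → Prop}
    (h : ∀ A, (∀ (i : ZMod e) B, AffineArrow e i B A → p B) →
      (∀ k B, Downstream e k B A → p B) → p A) (A : Abacus ℓ) : p A := by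
  obtain ⟨lo, hlo⟩ := A.semiinfinite.full
  generalize hN : energy lo (codes A.beads) = N
  induction N using Nat.strong_induction_on generalizing A with
  | _ N ih =>
    subst hN
    refine h A (fun i B hB => ?_) fun k B hB => ?_
    · obtain ⟨h1, h2⟩ := (affineArrow_iff.1 hB).energy_lt A.semiinfinite hlo
      exact ih _ h2 B h1 rfl
    · obtain ⟨h1, h2⟩ := hB.moves.energy_lt B.semiinfinite hlo
      exact ih _ h2 B h1 rfl

/-! ### Traveling downstream commutes with the affine crystal -/

theorem exists_abacus {S : Set ℤ} (hS : Semiinfinite S) : ∃ A : Abacus ℓ, codes A.beads = S :=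
  ⟨abacusOf S hS, codes_abacusOf S hS⟩

omit [NeZero e] [Fact (1 < e)] in
theorem AffineArrow.unique (h : AffineArrow e i A B) (h' : AffineArrow e i A B') : B = B' :=
  Abacus.ext_codes ((affineArrow_iff.1 h).unique (affineArrow_iff.1 h'))

theorem Downstream.exists_affineArrow (h : Downstream e k A A') (hf : AffineArrow e i A A₁) :
    ∃ A₁', AffineArrow e i A' A₁' ∧ Downstream e k A₁ A₁' := by
  obtain ⟨S, h1, h2⟩ := h.moves.fstep A.semiinfinite (affineArrow_iff.1 hf)
  obtain ⟨A₁', rfl⟩ := exists_abacus (ℓ := ℓ) (h1.semiinfinite A'.semiinfinite)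
  exact ⟨A₁', affineArrow_iff.2 h1, downstream_of_moves h2⟩

theorem Downstream.exists_affineArrow_of_target (h : Downstream e k A A')
    (hf : AffineArrow e i A' B') : ∃ B, AffineArrow e i A B ∧ Downstream e k B B' := by
  obtain ⟨S, h1, h2⟩ := h.moves.fstep_target A.semiinfinite (affineArrow_iff.1 hf)
  obtain ⟨B, rfl⟩ := exists_abacus (ℓ := ℓ) (h1.semiinfinite A.semiinfinite)
  exact ⟨B, affineArrow_iff.2 h1, downstream_of_moves h2⟩

omit [NeZero e] in
theorem FStep.semiinfinite_source {S T : Set ℤ} (h : FStep ℓ i S T) (hT : Semiinfinite T) :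
    Semiinfinite S := by
  obtain ⟨x, -, rfl⟩ := FStep_iff_cogood.1 h
  exact (hT.sdiff_finite (Set.finite_singleton _)).union_finite (Set.finite_singleton _)

theorem Downstream.exists_affineArrow_to (h : Downstream e k A A') (hf : AffineArrow e i B A) :
    ∃ B', AffineArrow e i B' A' ∧ Downstream e k B B' := by
  obtain ⟨S, h1, h2⟩ := h.moves.estep B.semiinfinite (affineArrow_iff.1 hf)
  obtain ⟨B', rfl⟩ := exists_abacus (ℓ := ℓ) (h1.semiinfinite_source A'.semiinfinite)
  exact ⟨B', affineArrow_iff.2 h1, downstream_of_moves h2⟩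

theorem Downstream.exists_affineArrow_to_of_target (h : Downstream e k A A')
    (hf : AffineArrow e i B' A') : ∃ B, AffineArrow e i B A ∧ Downstream e k B B' := by
  obtain ⟨S, h1, h2⟩ := h.moves.estep_target A.semiinfinite (affineArrow_iff.1 hf)
  obtain ⟨B, rfl⟩ := exists_abacus (ℓ := ℓ) (h1.semiinfinite_source A.semiinfinite)
  exact ⟨B, affineArrow_iff.2 h1, downstream_of_moves h2⟩

end

/-! ### Partitions -/

section
variable {k : ℕ} {θ ρ : YoungDiagram} {t : ℕ → ℕ}

theorem AddBox.rowLen (h : AddBox k θ ρ) :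
    ρ.rowLen = Function.update θ.rowLen k (θ.rowLen k + 1) := by
  funext m
  refine eq_of_forall_lt_iff fun c => ?_
  rw [← YoungDiagram.mem_iff_lt_rowLen, ← YoungDiagram.mem_cells, h.1, Finset.mem_insert,
    YoungDiagram.mem_cells, YoungDiagram.mem_iff_lt_rowLen, Prod.mk.injEq]
  by_cases hm : m = k
  · subst hm
    rw [Function.update_self]
    omega
  · rw [Function.update_of_ne hm]
    simp [hm]

theorem addBox_of_rowLen (h : ρ.rowLen = Function.update θ.rowLen k (θ.rowLen k + 1)) :
    AddBox k θ ρ := by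
  refine ⟨?_, by rw [YoungDiagram.mem_cells, YoungDiagram.mem_iff_lt_rowLen]; exact lt_irrefl _⟩
  ext ⟨m, c⟩
  rw [Finset.mem_insert, YoungDiagram.mem_cells, YoungDiagram.mem_cells,
    YoungDiagram.mem_iff_lt_rowLen, YoungDiagram.mem_iff_lt_rowLen, h, Prod.mk.injEq]
  by_cases hm : m = k
  · subst hm
    rw [Function.update_self]
    omega
  · rw [Function.update_of_ne hm]
    simp [hm]

theorem exists_rowLen_eq (ht : Antitone t) {N : ℕ} (hN : ∀ k ≥ N, t k = 0) :
    ∃ θ : YoungDiagram, θ.rowLen = t := by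
  refine ⟨⟨(Finset.range N ×ˢ Finset.range (t 0)).filter fun c => c.2 < t c.1, ?_⟩, ?_⟩
  · rintro ⟨a, b⟩ ⟨a', b'⟩ ⟨h1, h2⟩ hab
    simp only [Finset.coe_filter, Set.mem_ofPred_eq, Finset.mem_product, Finset.mem_range] at *
    have h3 : t a ≤ t a' := ht h1
    omega
  · funext m
    refine eq_of_forall_lt_iff fun c => ?_
    rw [← YoungDiagram.mem_iff_lt_rowLen, ← YoungDiagram.mem_cells]
    simp only [Finset.mem_filter, Finset.mem_product, Finset.mem_range]
    refine ⟨fun h => h.2, fun h => ⟨⟨?_, h.trans_le (ht (Nat.zero_le m))⟩, h⟩⟩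
    by_contra! hm
    rw [hN m hm] at h
    omega

/-- `Fill w θ` means that adding boxes successively in the rows listed in `w` (in reverse order)
leads from the empty partition to `θ`. -/
inductive Fill : List ℕ → YoungDiagram → Prop
  | nil : Fill [] ⊥
  | cons {w : List ℕ} {θ ρ : YoungDiagram} {k : ℕ} (h : Fill w θ) (hk : AddBox k θ ρ) :
      Fill (k :: w) ρ

theorem YoungDiagram.exists_addBox (h : ρ ≠ ⊥) : ∃ k θ, AddBox k θ ρ := by
  have hne : ρ.cells.Nonempty := by
    rw [Finset.nonempty_iff_ne_empty]
    intro h0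
    exact h (YoungDiagram.ext h0)
  obtain ⟨⟨a, b⟩, hab, hmax⟩ := ρ.cells.exists_maximal hne
  have hmem : ∀ c : ℕ × ℕ, c ∈ ρ.cells.erase (a, b) ↔ c ≠ (a, b) ∧ c ∈ ρ.cells := fun c =>
    Finset.mem_erase
  let θ : YoungDiagram := ⟨ρ.cells.erase (a, b), fun c c' hle hc => by
    rw [Finset.mem_coe, hmem] at hc ⊢
    refine ⟨?_, ρ.isLowerSet hle hc.2⟩
    rintro rfl
    exact hc.1 (le_antisymm (hmax hc.2 hle) hle)⟩
  have hθ : θ.rowLen a = b := by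
    refine eq_of_forall_lt_iff fun c => ?_
    rw [← YoungDiagram.mem_iff_lt_rowLen, ← YoungDiagram.mem_cells]
    show (a, c) ∈ ρ.cells.erase (a, b) ↔ _
    rw [hmem]
    constructor
    · rintro ⟨h1, h2⟩
      by_contra! hle
      have h3 := hmax h2 ⟨le_rfl, hle⟩
      exact h1 (Prod.ext rfl (le_antisymm h3.2 hle))
    · intro hc
      exact ⟨fun h => by rw [Prod.mk.injEq] at h; omega,
        ρ.isLowerSet (show ((a, c) : ℕ × ℕ) ≤ (a, b) from ⟨le_rfl, hc.le⟩) hab⟩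
  refine ⟨a, θ, ?_, ?_⟩
  · rw [hθ]; exact (Finset.insert_erase hab).symm
  · rw [hθ]; exact Finset.notMem_erase _ _

theorem exists_fill (θ : YoungDiagram) : ∃ w, Fill w θ := by
  generalize hn : θ.cells.card = n
  induction n generalizing θ with
  | zero =>
    refine ⟨[], ?_⟩
    have : θ = ⊥ := YoungDiagram.ext (Finset.card_eq_zero.1 hn)
    rw [this]
    exact .nil
  | succ n ih =>
    obtain ⟨k, θ', h⟩ := YoungDiagram.exists_addBox (ρ := θ) (by rintro rfl; simp at hn)
    obtain ⟨w, hw⟩ := ih θ' (by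
      rw [h.1, Finset.card_insert_of_notMem h.2] at hn
      omega)
    exact ⟨_, hw.cons h⟩

end

/-! ### Periods of highest weight vertices for the affine crystal -/

section
variable {e ℓ k : ℕ} [NeZero e] [NeZero ℓ] {S : Set (Pos ℓ)} {p : Fin e → Pos ℓ} {A : Abacus ℓ}
  {P : ℕ → Fin e → Pos ℓ}

theorem IsFirstPeriod.code_le (hp : IsFirstPeriod e S p) {x : Pos ℓ} (hx : x ∈ S) :
    code x ≤ cyc p (x.1 : ZMod e) := by
  obtain ⟨h1, h2, h3⟩ := hp
  by_cases hex : ∃ i, x.1 = (p i).1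
  · obtain ⟨i, hi⟩ := hex
    rw [hi, h1.cyc_cast, code_le_code hi]
    exact h3 i x hx hi
  · push Not at hex
    exact (h1.code_lt_cyc ⟨0, h2 0 rfl x hx⟩ fun i hi => absurd hi (hex i)).le

theorem IsFirstPeriod.greatest (hp : IsFirstPeriod e S p) : IsGreatestCycle ℓ (codes S) (cyc p) :=
  ⟨hp.1.isCycle, hp.1.cyc_mem, fun z hz hzS j => by
    have h1 := hp.code_le (mem_codes.1 (hzS j))
    rwa [← res_code, code.apply_symm_apply, hz.res_eq] at h1⟩

theorem isFirstPeriod_of_code_le (hp : IsQuasiperiod e S p)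
    (h : ∀ x ∈ S, code x ≤ cyc p (x.1 : ZMod e)) : IsFirstPeriod e S p := by
  refine ⟨hp, fun i hi x hx => ?_, fun i x hx hxi => ?_⟩
  · have h1 := fst_le_of_code_le (h x hx)
    have h2 := hp.fst_eq (beadIndex p (x.1 : ZMod e))
    have h3 := hp.fst_eq i
    omega
  · have h1 := h x hx
    rwa [hxi, hp.cyc_cast, code_le_code hxi] at h1

theorem codes_sdiff_iUnion (hP : ∀ m, IsQuasiperiod e A.beads (P m)) :
    codes (A.beads \ ⋃ i ∈ Set.Iio k, Set.range (P i)) =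
      rest (codes A.beads) (fun m => cyc (P m)) k := by
  ext n
  simp only [mem_codes, rest, Set.mem_sdiff, Set.mem_iUnion, Set.mem_Iio, (hP _).range_cyc,
    Set.mem_ofPred_eq, not_exists]

omit [NeZero e] [NeZero ℓ] in
theorem IsPeriodSeq.quasiperiod (hP : IsPeriodSeq e A P) (k : ℕ) :
    IsQuasiperiod e A.beads (P k) := (hP k).1.mono fun i => ((hP k).1.1 i).1

theorem IsPeriodSeq.greedy (hP : IsPeriodSeq e A P) :
    IsGreedySeq ℓ (codes A.beads) (fun m => cyc (P m)) := fun k => by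
  rw [← codes_sdiff_iUnion hP.quasiperiod]
  exact (hP k).greatest

variable [Fact (1 < e)]

omit [NeZero e] in
theorem AffineHighestWeight.dominated (hA : AffineHighestWeight e A) (i : ZMod e) :
    Dominated ℓ i (codes A.beads) := by
  refine dominated_of_not_cogood A.semiinfinite fun x hx => ?_
  have hf := FStep_iff_cogood.2 ⟨x, hx, rfl⟩
  obtain ⟨B, hB⟩ := exists_abacus (ℓ := ℓ) (hf.semiinfinite_source A.semiinfinite)
  rw [← hB] at hf
  exact hA i B (affineArrow_iff.2 hf)

/-- On such a vertex the greedy cycles bound all remaining elements of their residues, so the fore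
periods are also periods in the sense of Jacon and Lecouvey. -/
theorem AffineHighestWeight.exists_periodSeq (hA : AffineHighestWeight e A) :
    ∃ P : ℕ → Fin e → Pos ℓ, IsPeriodSeq e A P := by
  obtain ⟨P, hP, hG⟩ := exists_foreSeq (e := e) A
  refine ⟨P, fun k => isFirstPeriod_of_code_le ((hP.quasiperiod k).mono fun i => ?_) fun x hx => ?_⟩
  · rw [← code_mem_codes, codes_sdiff_iUnion hP.quasiperiod, ← (hP.quasiperiod k).cyc_cast]
    exact (hG k).mem _
  · rw [← code_mem_codes, codes_sdiff_iUnion hP.quasiperiod] at hx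
    have := hG.le_of_dominated A.semiinfinite hA.dominated hx
    rwa [res_code] at this

theorem AffineHighestWeight.codes_eq (hA : AffineHighestWeight e A)
    (hG : IsGreedySeq ℓ (codes A.beads) (fun m => cyc (P m))) :
    codes A.beads = ⋃ m, Set.range (cyc (P m)) :=
  hG.iUnion_of_dominated A.semiinfinite hA.dominated

omit [Fact (1 < e)] in
theorem codes_iUnion_shift (hP : ∀ m, IsQuasiperiod e A.beads (P m)) (t : ℕ → ℕ) :
    codes (⋃ m, Set.range (shift (t m : ℤ) (P m))) = ⋃ m, Set.range (shn ℓ (t m) (cyc (P m))) := by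
  ext n
  simp only [mem_codes, Set.mem_iUnion, ← cyc_shift_nat, (shift_quasiperiod (hP _) _).range_cyc]

end

/-! ### The operators `b_σ` and sequences of downstream moves -/

/-- `B` is obtained from `A` by traveling downstream along the periods listed in `w` (in reverse
order). -/
inductive Chain {ℓ : ℕ} (e : ℕ) : List ℕ → Abacus ℓ → Abacus ℓ → Prop
  | nil (A : Abacus ℓ) : Chain e [] A A
  | cons {w : List ℕ} {k : ℕ} {A B C : Abacus ℓ} (h : Chain e w A B) (hk : Downstream e k B C) :
      Chain e (k :: w) A C

theorem update_shn {e ℓ : ℕ} (k : ℕ) (t : ℕ → ℕ) (R : ℕ → ZMod e → ℤ) :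
    Function.update (fun m => shn ℓ (t m) (R m)) k (sh ℓ (shn ℓ (t k) (R k))) =
      fun m => shn ℓ (Function.update t k (t k + 1) m) (R m) := by
  funext m
  by_cases hm : m = k
  · subst hm
    rw [Function.update_self, Function.update_self, sh_shn]
  · rw [Function.update_of_ne hm, Function.update_of_ne hm]

section
variable {e ℓ k : ℕ} {i : ZMod e} [NeZero e] [NeZero ℓ] [Fact (1 < e)] {A A' A₀ A₁ B B₁ C : Abacus ℓ}
  {w : List ℕ} {θ ρ σ : YoungDiagram}

theorem Chain.unique (h : Chain e w A B) (h' : Chain e w A C) : B = C := by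
  induction h generalizing C with
  | nil A => cases h'; rfl
  | cons h hk ih =>
    cases h' with
    | cons h' hk' =>
      obtain rfl := ih h'
      exact hk.target_unique hk'

theorem Chain.exists_affineArrow (h : Chain e w A B) (hf : AffineArrow e i A A₁) :
    ∃ B₁, AffineArrow e i B B₁ ∧ Chain e w A₁ B₁ := by
  induction h with
  | nil A => exact ⟨A₁, hf, .nil _⟩
  | cons h hk ih =>
    obtain ⟨B₁, h1, h2⟩ := ih hf
    obtain ⟨C₁, h3, h4⟩ := hk.exists_affineArrow h1
    exact ⟨C₁, h3, h2.cons h4⟩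

theorem Chain.exists_affineArrow_of_target (h : Chain e w A B) (hf : AffineArrow e i B B₁) :
    ∃ A₁, AffineArrow e i A A₁ ∧ Chain e w A₁ B₁ := by
  induction h generalizing B₁ with
  | nil A => exact ⟨B₁, hf, .nil _⟩
  | cons h hk ih =>
    obtain ⟨C₁, h3, h4⟩ := hk.exists_affineArrow_of_target hf
    obtain ⟨A₁, h1, h2⟩ := ih h3
    exact ⟨A₁, h1, h2.cons h4⟩

theorem IsFamily.exists_chain {R : ℕ → ZMod e → ℤ} (hR : IsFamily ℓ R)
    (hA : codes A.beads = ⋃ m, Set.range (R m)) (hw : Fill w θ) :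
    ∃ B : Abacus ℓ, codes B.beads = (⋃ m, Set.range (shn ℓ (θ.rowLen m) (R m))) ∧ Chain e w A B := by
  induction hw with
  | nil =>
    refine ⟨A, ?_, .nil A⟩
    have : ∀ m, (⊥ : YoungDiagram).rowLen m = 0 := fun m => by
      by_contra hne
      exact YoungDiagram.notMem_bot _ (YoungDiagram.mem_iff_lt_rowLen.2 (Nat.pos_of_ne_zero hne))
    simp only [this, shn_zero, hA]
  | @cons w θ ρ k h hk ih =>
    obtain ⟨B, hB, hc⟩ := ih
    have h1 := hR.shn_antitone (t := θ.rowLen) fun a b hab => θ.rowLen_anti a b hab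
    have h2 := hR.shn_antitone (t := ρ.rowLen) fun a b hab => ρ.rowLen_anti a b hab
    rw [hk.rowLen, ← update_shn] at h2
    have h3 := h1.moves_of_update h2
    rw [update_shn, ← hk.rowLen, ← hB] at h3
    obtain ⟨C, hC⟩ := exists_abacus (ℓ := ℓ) (h3.semiinfinite B.semiinfinite)
    rw [← hC] at h3
    exact ⟨C, hC, hc.cons (downstream_of_moves h3)⟩

/-- On affine highest weight vertices, shifting the periods by `σ` amounts to adding its boxes one
at a time, each box being a move; commutation with the affine crystal extends this to all abaci. As
chains are deterministic, so is `b_σ`. -/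
theorem BOp.chain (h : BOp e σ A B) (hw : Fill w σ) : Chain e w A B := by
  induction h with
  | highestWeight A B P hA hP hB =>
    have hG := hP.greedy
    obtain ⟨C, hC, hc⟩ := hG.isFamily.exists_chain (hA.codes_eq hG) hw
    have : C = B := Abacus.ext_codes (by rw [hC, hB, codes_iUnion_shift hP.quasiperiod])
    rwa [this] at hc
  | commute i A B A₁ B₁ h hA hB ih =>
    obtain ⟨C, hC, hc⟩ := ih.exists_affineArrow hA
    rwa [hC.unique hB] at hc

theorem AddBoxOp.downstream (h : AddBoxOp e k A A') : Downstream e k A A' := by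
  obtain ⟨A₀, θ, ρ, -, hθ, hρ, hk⟩ := h
  obtain ⟨w, hw⟩ := exists_fill θ
  have h1 := hθ.chain hw
  have h2 := hρ.chain (hw.cons hk)
  cases h2 with
  | cons h2 h3 =>
    obtain rfl := h1.unique h2
    exact h3

theorem highestWeight_of_not_downstream (h : ∀ k (C : Abacus ℓ), ¬ Downstream e k C A) :
    HighestWeight e A := by
  intro B σ hB
  obtain ⟨w, hw⟩ := exists_fill σ
  have hc := hB.chain hw
  cases hw with
  | nil => rfl
  | cons _ _ =>
    cases hc with
    | cons _ hk => exact absurd hk (h _ _)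

/-! ### Sources of both crystals, and the partition attached to an abacus -/

/-- An affine highest weight vertex is obtained from a highest weight vertex for both crystals by
translating its periods. -/
theorem AffineHighestWeight.exists_source (hA : AffineHighestWeight e A) :
    ∃ (A₀ : Abacus ℓ) (R : ℕ → ZMod e → ℤ) (t : ℕ → ℕ) (N : ℕ), AffineHighestWeight e A₀ ∧
      (∀ k (C : Abacus ℓ), ¬ Downstream e k C A₀) ∧ IsFamily ℓ R ∧
      codes A₀.beads = (⋃ m, Set.range (R m)) ∧ IsFamily ℓ (fun m => shn ℓ (t m) (R m)) ∧
      codes A.beads = (⋃ m, Set.range (shn ℓ (t m) (R m))) ∧ ∀ m ≥ N, t m = 0 := by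
  revert hA
  refine Abacus.crystal_induction e ?_ A
  intro A _ ih hA
  · by_cases hno : ∀ k (C : Abacus ℓ), ¬ Downstream e k C A
    · obtain ⟨P, hP⟩ := hA.exists_periodSeq
      have hG := hP.greedy
      refine ⟨A, fun m => cyc (P m), fun _ => 0, 0, hA, hno, hG.isFamily, hA.codes_eq hG, ?_, ?_,
        fun _ _ => rfl⟩
      · simpa only [shn_zero] using hG.isFamily
      · simpa only [shn_zero] using hA.codes_eq hG
    · push Not at hno
      obtain ⟨j, B, hB⟩ := hno
      -- The source of a move into an affine highest weight vertex is one too: an arrow into `B`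
      -- would be carried by the move to an arrow into `A`.
      obtain ⟨A₀, R, t, N, h1, h2, h3, h4, h5, h6, h7⟩ := ih j B hB fun i C hC => by
        obtain ⟨C', hC', -⟩ := hB.exists_affineArrow_to hC
        exact hA i C' hC'
      have hm := hB.moves
      rw [h6] at hm
      obtain ⟨h8, h9⟩ := h5.update_of_moves hm
      rw [update_shn] at h8 h9
      refine ⟨A₀, R, _, max N (j + 1), h1, h2, h3, h4, h8, h9, fun m hm => ?_⟩
      rw [Function.update_of_ne (by omega)]
      exact h7 m (by omega)

/-- If the leftward update still decreased, moving the cycle back would be a downstream move ending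
at `A`. -/
theorem IsFamily.not_isFamily_update {R : ℕ → ZMod e → ℤ} (hR : IsFamily ℓ R)
    (hA : codes A.beads = ⋃ m, Set.range (R m))
    (h : ∀ k (C : Abacus ℓ), ¬ Downstream e k C A) (k : ℕ) :
    ¬ IsFamily ℓ (Function.update R k (unsh ℓ (R k))) := by
  intro hU
  have hs := hR.iUnion_update k (unsh ℓ (R k))
  obtain ⟨C, hC⟩ := exists_abacus (ℓ := ℓ) (S := ⋃ m, Set.range (Function.update R k (unsh ℓ (R k)) m))
    (by
      rw [hs, ← hA]
      exact (A.semiinfinite.sdiff_finite (Set.finite_range _)).union_finite (Set.finite_range _))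
  have hback : Function.update (Function.update R k (unsh ℓ (R k))) k
      (sh ℓ (Function.update R k (unsh ℓ (R k)) k)) = R := by
    rw [Function.update_self, sh_unsh, Function.update_idem, Function.update_eq_self]
  have hm := hU.moves_of_update (k := k) (by rwa [hback])
  rw [hback, ← hA, ← hC] at hm
  exact h k C (downstream_of_moves hm)

theorem bOp_of_family {R : ℕ → ZMod e → ℤ} (hA₀ : AffineHighestWeight e A₀) (hR : IsFamily ℓ R)
    (h : codes A₀.beads = ⋃ m, Set.range (R m))
    (hA : codes A.beads = ⋃ m, Set.range (shn ℓ (θ.rowLen m) (R m))) : BOp e θ A₀ A := by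
  obtain ⟨P, hP⟩ := hA₀.exists_periodSeq
  have hG := hP.greedy
  rw [h] at hG
  obtain rfl := hG.unique hR.greedy
  refine .highestWeight A₀ A P hA₀ hP (codes_injective ?_)
  rw [codes_iUnion_shift hP.quasiperiod, hA]

/-- On affine highest weight vertices, translation amounts form a partition because the source
admits no move to the left, and this holds before and after a further move. Elsewhere, descend one
affine arrow and carry the source, the operators and the further move along it; the partitions do
not change. -/
theorem exists_bOp (A : Abacus ℓ) : ∃ (A₀ : Abacus ℓ) (θ : YoungDiagram),
    (∀ k (C : Abacus ℓ), ¬ Downstream e k C A₀) ∧ BOp e θ A₀ A ∧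
      ∀ k A', Downstream e k A A' → ∃ ρ, AddBox k θ ρ ∧ BOp e ρ A₀ A' := by
  refine Abacus.crystal_induction e ?_ A
  intro A ih _
  · by_cases hA : AffineHighestWeight e A
    · obtain ⟨A₀, R, t, N, h1, h2, h3, h4, h5, h6, h7⟩ := hA.exists_source
      have hmin := h3.not_isFamily_update h4 h2
      obtain ⟨θ, rfl⟩ := exists_rowLen_eq (h3.antitone_of_shn hmin h5) h7
      refine ⟨A₀, θ, h2, bOp_of_family h1 h3 h4 h6, fun k A' hk => ?_⟩
      have hm := hk.moves
      rw [h6] at hm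
      obtain ⟨h8, h9⟩ := h5.update_of_moves hm
      rw [update_shn] at h8 h9
      obtain ⟨ρ, hρ⟩ := exists_rowLen_eq (h3.antitone_of_shn hmin h8) (N := max N (k + 1))
        fun m hm => by
          rw [Function.update_of_ne (by omega)]
          exact h7 m (by omega)
      rw [← hρ] at h9
      exact ⟨ρ, addBox_of_rowLen hρ, bOp_of_family h1 h3 h4 h9⟩
    · simp only [AffineHighestWeight, not_forall, not_not] at hA
      obtain ⟨i, B, hB⟩ := hA
      obtain ⟨A₀, θ, h1, h2, h3⟩ := ih i B hB
      obtain ⟨w, hw⟩ := exists_fill θ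
      obtain ⟨A₁, h4, -⟩ := (h2.chain hw).exists_affineArrow_of_target hB
      refine ⟨A₁, θ, fun k C hC => ?_, .commute i _ _ _ _ h2 h4 hB, fun k A' hk => ?_⟩
      · obtain ⟨C', -, hC'⟩ := hC.exists_affineArrow_to_of_target h4
        exact h1 _ _ hC'
      · obtain ⟨B', hB', hk'⟩ := hk.exists_affineArrow_to hB
        obtain ⟨ρ, hρ, hb⟩ := h3 k B' hk'
        exact ⟨ρ, hρ, .commute i _ _ _ _ hb h4 hB'⟩

theorem addBoxOp_iff : AddBoxOp e k A A' ↔ Downstream e k A A' := by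
  refine ⟨AddBoxOp.downstream, fun h => ?_⟩
  obtain ⟨A₀, θ, h1, h2, h3⟩ := exists_bOp (e := e) A
  obtain ⟨ρ, h4, h5⟩ := h3 k A' h
  exact ⟨A₀, θ, ρ, highestWeight_of_not_downstream h1, h2, h5, h4⟩

theorem Downstream.upsilonPlus (h : Downstream e k A A') : UpsilonPlus e k A = some A' := by
  have hex : ∃ A', AddBoxOp e k A A' := ⟨A', addBoxOp_iff.2 h⟩
  rw [UpsilonPlus, dif_pos hex, (addBoxOp_iff.1 hex.choose_spec).target_unique h]

theorem Downstream.upsilonMinus (h : Downstream e k A A') : UpsilonMinus e k A' = some A := by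
  have hex : ∃ A, AddBoxOp e k A A' := ⟨A, addBoxOp_iff.2 h⟩
  rw [UpsilonMinus, dif_pos hex, (addBoxOp_iff.1 hex.choose_spec).source_unique h]

end

end AbacusCrystal

theorem theorem3 (e ℓ : ℕ) (he : 2 ≤ e) (hℓ : 2 ≤ ℓ) (A A' : AbacusCrystal.Abacus ℓ) :
    (AbacusCrystal.Arrow e A A' ↔ ∃ k, AbacusCrystal.Downstream e k A A') ∧
    (∀ k, AbacusCrystal.Downstream e k A A' ↔ AbacusCrystal.Upstream e k A A') ∧
    (∀ k, AbacusCrystal.Downstream e k A A' →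
      AbacusCrystal.UpsilonPlus e k A = some A' ∧ AbacusCrystal.UpsilonMinus e k A' = some A) := by
  have : NeZero e := ⟨by omega⟩
  have : NeZero ℓ := ⟨by omega⟩
  have : Fact (1 < e) := ⟨by omega⟩
  exact ⟨exists_congr fun _ => AbacusCrystal.addBoxOp_iff,
    fun _ => AbacusCrystal.downstream_iff_upstream,
    fun _ h => ⟨h.upsilonPlus, h.upsilonMinus⟩⟩
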